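/- Let $p$ be a prime, let $\mathbf N$ be a unipotent algebraic group defined over $\mathbb{Q}$ (that is, an affine algebraic group isomorphic over $\mathbb{Q}$ to a closed subgroup of the group of upper unitriangular $n\times n$ matrices for some $n$), and let $N=\mathbf N(\mathbb{Q}_p)$ with its $p$-adic topology. A representation of $N$ on a complex vector space $V$ is called smooth if the stabilizer of every vector contains a compact open subgroup of $N$. The smooth dual of $N$ is the set of equivalence classes of algebraically irreducible smooth representations of $N$; the unitary dual of $N$ is the set of unitary equivalence classes of irreducible (strongly continuous) unitary representations of $N$ on complex Hilbert spaces. Every irreducible smooth representation $(\sigma,V)$ of $N$ admits an $N$-invariant positive definite Hermitian form. For every such form, let $(\hat\sigma,\hat V)$ be the unitary representation of $N$ obtained by extending the operators $\sigma(g)$, $g\in N$, to the Hilbert space completion $\hat V$ of $V$. Then $(\hat\sigma,\hat V)$ is an irreducible unitary representation whose unitary equivalence class depends only on the equivalence class of $(\sigma,V)$ (and not on the choice of the form), and the assignment $(\sigma,V)\mapsto(\hat\sigma,\hat V)$ induces a bijection from the smooth dual of $N$ onto the unitary dual of $N$. -/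

import Mathlib

open scoped TensorProduct

universe u v

noncomputable section

/-! ### Unipotent groups and their `p`-adic points -/

/-- The affine group scheme over the field `k` with coordinate Hopf algebra `A` is a unipotent
algebraic group: it is isomorphic to a closed subgroup of the group `U_n` of upper unitriangular
`n × n` matrices, for some `n`.  A homomorphism to `U_n` is an upper unitriangular matrix `M` with
entries in `A` such that `Δ(M i j) = ∑ l, M i l ⊗ M l j` and `ε(M i j) = δ i j`; it is a closed
immersion exactly when the entries of `M` generate the algebra `A`. -/
def IsUnipotentGroup (k : Type u) [Field k] (A : Type v) [CommRing A] [HopfAlgebra k A] : Prop :=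
  ∃ (n : ℕ) (M : Matrix (Fin n) (Fin n) A),
    (∀ i, M i i = 1) ∧ (∀ i j, j < i → M i j = 0) ∧
    (∀ i j, Coalgebra.comul (R := k) (M i j) = ∑ l, M i l ⊗ₜ[k] M l j) ∧
    (∀ i j, Coalgebra.counit (R := k) (M i j) = if i = j then 1 else 0) ∧
    Algebra.adjoin k (Set.range fun ij : Fin n × Fin n => M ij.1 ij.2) = ⊤

/-- The set of `ℚ_p`-points of the affine group scheme over `ℚ` with coordinate Hopf algebra `A`.
Its product is the convolution product `x * y = m ∘ (x ⊗ y) ∘ Δ` (Mathlib's monoid structure on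
`WithConv`), the inverse of `x` is `x ∘ S` with the antipode `S`. -/
abbrev QpPoints (p : ℕ) [Fact p.Prime] (A : Type v) [CommRing A] [HopfAlgebra ℚ A] : Type v :=
  WithConv (A →ₐ[ℚ] ℚ_[p])

section Points

variable {p : ℕ} [Fact p.Prime] {A : Type v} [CommRing A] [HopfAlgebra ℚ A]

instance QpPoints.instGroup : Group (QpPoints p A) where
  inv x := WithConv.toConv (x.ofConv.comp (HopfAlgebra.antipodeAlgHom ℚ A))
  inv_mul_cancel x := by
    refine WithConv.ext (AlgHom.ext fun a => ?_)
    have key : ∀ t : A ⊗[ℚ] A,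
        Algebra.TensorProduct.lift (x.ofConv.comp (HopfAlgebra.antipodeAlgHom ℚ A)) x.ofConv
          (fun _ _ => .all _ _) t =
        x.ofConv (LinearMap.mul' ℚ A ((HopfAlgebra.antipode ℚ).rTensor A t)) := by
      intro t
      induction t with
      | zero => simp
      | tmul a b => simp
      | add s t hs ht => simp only [map_add, hs, ht]
    refine (AlgHom.convMul_apply (WithConv.toConv _) x a).trans ((key _).trans ?_)
    rw [HopfAlgebra.mul_antipode_rTensor_comul_apply, AlgHom.commutes]
    rfl

/-- The `p`-adic topology on the points: the coarsest topology for which every regular function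
`a ∈ A` is continuous as a function with values in `ℚ_p`. -/
instance QpPoints.instTopologicalSpace : TopologicalSpace (QpPoints p A) :=
  TopologicalSpace.induced (fun (x : QpPoints p A) (a : A) => x.ofConv a) inferInstance

theorem QpPoints.continuous_eval (a : A) : Continuous fun x : QpPoints p A => x.ofConv a :=
  (continuous_apply a).comp continuous_induced_dom

instance QpPoints.instIsTopologicalGroup : IsTopologicalGroup (QpPoints p A) where
  continuous_mul := by
    refine continuous_induced_rng.2 (continuous_pi fun a => ?_)
    have key : ∀ t : A ⊗[ℚ] A, Continuous fun xy : QpPoints p A × QpPoints p A =>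
        Algebra.TensorProduct.lift xy.1.ofConv xy.2.ofConv (fun _ _ => .all _ _) t := by
      intro t
      induction t with
      | zero => simpa using continuous_const
      | tmul a b =>
        have h1 : Continuous fun xy : QpPoints p A × QpPoints p A => xy.1.ofConv a :=
          (QpPoints.continuous_eval a).comp continuous_fst
        have h2 : Continuous fun xy : QpPoints p A × QpPoints p A => xy.2.ofConv b :=
          (QpPoints.continuous_eval b).comp continuous_snd
        simp only [Algebra.TensorProduct.lift_tmul]
        exact h1.mul h2
      | add s t hs ht =>
        simp only [map_add]
        exact hs.add ht
    refine (key (Coalgebra.comul a)).congr fun xy => ?_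
    exact (AlgHom.convMul_apply xy.1 xy.2 a).symm
  continuous_inv := by
    refine continuous_induced_rng.2 (continuous_pi fun a => ?_)
    exact QpPoints.continuous_eval (HopfAlgebra.antipodeAlgHom ℚ A a)

end Points

/-! ### Smooth representations and the smooth dual -/

section Smooth

variable {G : Type v} [Group G] [TopologicalSpace G]

/-- A representation is smooth if the stabilizer of every vector contains a compact open
subgroup. -/
def IsSmoothRep {V : Type u} [AddCommGroup V] [Module ℂ V] (ρ : Representation ℂ G V) : Prop :=
  ∀ w : V, ∃ K : Subgroup G, IsOpen (K : Set G) ∧ IsCompact (K : Set G) ∧ ∀ g ∈ K, ρ g w = w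

variable (G) in
/-- An (algebraically) irreducible smooth complex representation of `G`. -/
structure IrrSmoothRep where
  V : Type u
  [addCommGroup : AddCommGroup V]
  [module : Module ℂ V]
  ρ : Representation ℂ G V
  smooth : IsSmoothRep ρ
  irreducible : ρ.IsIrreducible

attribute [instance] IrrSmoothRep.addCommGroup IrrSmoothRep.module

/-- Two irreducible smooth representations are equivalent if there is an invertible linear
intertwining map between them. -/
instance IrrSmoothRep.setoid : Setoid (IrrSmoothRep.{u} G) where
  r σ τ := ∃ T : σ.V ≃ₗ[ℂ] τ.V, ∀ g x, T (σ.ρ g x) = τ.ρ g (T x)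
  iseqv :=
    { refl := fun σ => ⟨LinearEquiv.refl ℂ σ.V, fun _ _ => rfl⟩
      symm := by
        rintro σ τ ⟨T, hT⟩
        refine ⟨T.symm, fun g x => T.injective ?_⟩
        rw [hT]
        simp
      trans := by
        rintro σ τ υ ⟨T, hT⟩ ⟨S, hS⟩
        exact ⟨T.trans S, fun g x => by simp [hT, hS]⟩ }

variable (G) in
/-- The smooth dual of `G`: equivalence classes of irreducible smooth representations. -/
def SmoothDual : Type (max v (u + 1)) := Quotient (IrrSmoothRep.setoid.{u, v} (G := G))

end Smooth

/-! ### Unitary representations and the unitary dual -/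

section Unitary

variable {G : Type v} [Group G] [TopologicalSpace G]

variable (G) in
/-- A unitary representation of `G`: a strongly continuous homomorphism to the group of unitary
operators of a complex Hilbert space. -/
structure UnitaryRep where
  H : Type u
  [normedAddCommGroup : NormedAddCommGroup H]
  [innerProductSpace : InnerProductSpace ℂ H]
  [completeSpace : CompleteSpace H]
  π : G →* (H ≃ₗᵢ[ℂ] H)
  continuous_orbit : ∀ x : H, Continuous fun g => π g x

attribute [instance] UnitaryRep.normedAddCommGroup UnitaryRep.innerProductSpace
  UnitaryRep.completeSpace

/-- A unitary representation is irreducible if it is nonzero and has no closed invariant subspaces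
other than `0` and the whole space. -/
def UnitaryRep.IsIrreducible (π : UnitaryRep.{u} G) : Prop :=
  Nontrivial π.H ∧ ∀ W : Submodule ℂ π.H, IsClosed (W : Set π.H) →
    (∀ g, ∀ x ∈ W, π.π g x ∈ W) → W = ⊥ ∨ W = ⊤

/-- Unitary equivalence of irreducible unitary representations. -/
instance UnitaryRep.setoid : Setoid {π : UnitaryRep.{u} G // π.IsIrreducible} where
  r π τ := ∃ T : π.1.H ≃ₗᵢ[ℂ] τ.1.H, ∀ g x, T (π.1.π g x) = τ.1.π g (T x)
  iseqv :=
    { refl := fun π => ⟨LinearIsometryEquiv.refl ℂ π.1.H, fun _ _ => rfl⟩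
      symm := by
        rintro π τ ⟨T, hT⟩
        refine ⟨T.symm, fun g x => T.injective ?_⟩
        rw [hT]
        simp
      trans := by
        rintro π τ υ ⟨T, hT⟩ ⟨S, hS⟩
        exact ⟨T.trans S, fun g x => by simp [hT, hS]⟩ }

variable (G) in
/-- The unitary dual of `G`: equivalence classes of irreducible unitary representations. -/
def UnitaryDual : Type (max v (u + 1)) := Quotient (UnitaryRep.setoid.{u, v} (G := G))

end Unitary

/-! ### Pre-unitary structures and Hilbert space completion -/

section Completion

open UniformSpace

/-- The extension of a unitary operator of a pre-Hilbert space to the Hilbert space completion. -/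
def completionUnitary {E : Type u} [NormedAddCommGroup E] [InnerProductSpace ℂ E]
    (e : E ≃ₗᵢ[ℂ] E) : Completion E ≃ₗᵢ[ℂ] Completion E where
  toLinearEquiv := LinearEquiv.ofLinearMap
    (e.toLinearIsometry.toContinuousLinearMap.completion : Completion E →ₗ[ℂ] Completion E)
    (e.symm.toLinearIsometry.toContinuousLinearMap.completion : Completion E →ₗ[ℂ] Completion E)
    (by
      ext x
      induction x using Completion.induction_on with
      | hp => exact isClosed_eq (by simp; fun_prop) (by simp; fun_prop)
      | ih x => simp)
    (by
      ext x
      induction x using Completion.induction_on with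
      | hp => exact isClosed_eq (by simp; fun_prop) (by simp; fun_prop)
      | ih x => simp)
  norm_map' x := by
    induction x using Completion.induction_on with
    | hp => exact isClosed_eq (by simp; fun_prop) (by fun_prop)
    | ih x => simp

@[simp]
theorem completionUnitary_coe {E : Type u} [NormedAddCommGroup E] [InnerProductSpace ℂ E]
    (e : E ≃ₗᵢ[ℂ] E) (x : E) : completionUnitary e (x : Completion E) = (e x : Completion E) := by
  simp [completionUnitary]

variable {G : Type v} [Group G] {V : Type u} [AddCommGroup V] [Module ℂ V]

/-- An invariant positive definite Hermitian form for the representation `ρ` (a pre-unitary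
structure). -/
structure InvariantForm (ρ : Representation ℂ G V) where
  form : InnerProductSpace.Core ℂ V
  invariant : ∀ g x y, form.inner (ρ g x) (ρ g y) = form.inner x y

variable {ρ : Representation ℂ G V}

/-- The space of `ρ`, regarded as a pre-Hilbert space through the invariant form `c`. -/
def InvariantForm.Space (_c : InvariantForm ρ) : Type u := V

namespace InvariantForm

variable (c : InvariantForm ρ)

instance : AddCommGroup c.Space := inferInstanceAs (AddCommGroup V)

instance : Module ℂ c.Space := inferInstanceAs (Module ℂ V)

instance : NormedAddCommGroup c.Space :=
  @InnerProductSpace.Core.toNormedAddCommGroup ℂ V _ _ _ c.form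

instance : InnerProductSpace ℂ c.Space :=
  @InnerProductSpace.ofCore ℂ V _ _ _ c.form.toCore

/-- The operator `ρ g` as a unitary operator of the pre-Hilbert space. -/
def act (g : G) : c.Space ≃ₗᵢ[ℂ] c.Space :=
  LinearEquiv.isometryOfInner
    (LinearEquiv.ofLinearMap (ρ g : V →ₗ[ℂ] V) (ρ g⁻¹ : V →ₗ[ℂ] V)
      (by ext x; simp [← Module.End.mul_apply, ← map_mul])
      (by ext x; simp [← Module.End.mul_apply, ← map_mul]) : V ≃ₗ[ℂ] V)
    (fun x y => c.invariant g x y)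

theorem act_one (x : c.Space) : c.act 1 x = x :=
  congrArg (fun f : Module.End ℂ V => f x) (map_one ρ)

theorem act_mul (g g' : G) (x : c.Space) : c.act (g * g') x = c.act g (c.act g' x) :=
  congrArg (fun f : Module.End ℂ V => f x) (map_mul ρ g g')

variable [TopologicalSpace G]

/-- The orbit maps of a smooth representation are locally constant. -/
theorem continuous_orbit_coe [IsTopologicalGroup G] (h : IsSmoothRep ρ) (x : c.Space) :
    Continuous fun g => completionUnitary (c.act g) (x : Completion c.Space) := by
  simp only [completionUnitary_coe]
  refine IsLocallyConstant.continuous ((IsLocallyConstant.iff_eventually_eq _).2 fun g => ?_)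
  obtain ⟨K, hK, -, hfix⟩ := h x
  have h1 : ∀ᶠ g' in nhds g, g⁻¹ * g' ∈ K :=
    (continuous_const_mul g⁻¹).continuousAt.eventually_mem
      (hK.mem_nhds (by simp [K.one_mem]))
  filter_upwards [h1] with g' hg'
  have h2 : c.act (g⁻¹ * g') x = x := hfix _ hg'
  have h3 : c.act g' x = c.act g x := by
    conv_rhs => rw [← h2, ← act_mul, mul_inv_cancel_left]
  rw [h3]

/-- The Hilbert space completion of a smooth pre-unitary representation, with the unitary operators
that extend the operators `ρ g` by continuity. -/
def completion [IsTopologicalGroup G] (h : IsSmoothRep ρ) : UnitaryRep.{u} G where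
  H := Completion c.Space
  π :=
    { toFun := fun g => completionUnitary (c.act g)
      map_one' := by
        ext x
        induction x using Completion.induction_on with
        | hp =>
          exact isClosed_eq (LinearIsometryEquiv.continuous _) (LinearIsometryEquiv.continuous _)
        | ih x => simp [act_one]
      map_mul' := fun g g' => by
        ext x
        induction x using Completion.induction_on with
        | hp =>
          exact isClosed_eq (LinearIsometryEquiv.continuous _) (LinearIsometryEquiv.continuous _)
        | ih x => simp [act_mul] }
  continuous_orbit := fun x => by
    refine continuous_of_uniform_approx_of_continuous fun s hs => ?_
    obtain ⟨ε, hε, hs⟩ := Metric.mem_uniformity_dist.1 hs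
    obtain ⟨y, hy⟩ := (Completion.denseRange_coe (α := c.Space)).exists_dist_lt x hε
    refine ⟨_, c.continuous_orbit_coe h y, fun g => ?_⟩
    exact hs (((completionUnitary (c.act g)).dist_map x y).trans_lt hy)

end InvariantForm

end Completion

end

set_option linter.unusedSectionVars false

noncomputable section

/-! ### Balls and smooth characters of `ℚ_p` -/

section PadicBall

variable {p : ℕ} [Fact p.Prime]

/-! The heart of the matter is admissibility: every smooth representation of `N` that is prime in
the sense of `IsPrimeRep` contains an irreducible subrepresentation in which each open subgroup has
a finite-dimensional space of fixed vectors (`CentralCoords.hasAdmissibleIrr`). Primeness is a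
common weakening of two situations. Irreducible smooth representations are prime because they have
only one nonzero subrepresentation; the smooth vectors of an irreducible unitary representation are
prime because nonzero subrepresentations are dense there (`IsIrreducible.isPrimeRep_smoothRep`).

Admissibility is proved by Kirillov's induction. If not everything acts by scalars, take a
one-parameter group `φ` in the last layer of a central series that does not act by scalars. Its
commutators with the group lie in the next layer and act by scalars `b g t`, and `b` is bilinear
along one-parameter groups. Its kernel is a proper closed subgroup of smaller rank, and a
complementary one-parameter group `x` forms a Heisenberg pair with `φ`. The representation then
behaves as if induced from that kernel acting on the `φ`-coinvariants: finite Fourier inversion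
(`HeisenbergPair.fourier`) recovers a vector from the classes of its `x`-translates. Primeness
descends to the coinvariants (`StabilizerData.prime_rep`), and irreducible admissible
subrepresentations lift back (`StabilizerData.hasAdmissibleIrr`).

Given admissibility, the fixed vectors of a compact open subgroup form a finite-dimensional, hence
closed, space, so passing to the completion adds none. An irreducible smooth representation is
therefore exactly the space of smooth vectors of its completion (`IsDenseModel.range_eq`), which
gives irreducibility of the completion and injectivity. Schur's lemma on a finite-dimensional space
of fixed vectors makes any two invariant forms proportional (`IsDenseModel.inner_proportional`), so
the form does not matter. For surjectivity, an irreducible subrepresentation of the smooth vectors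
is dense in the Hilbert space. Invariant forms exist because `N` is an increasing union of compact
open subgroups: averaged forms are invariant under larger and larger subgroups, and an ultralimit is
invariant under all of `N` (`exists_invariantForm`). -/

variable (p) in
/-- The fractional ideal `p ^ m ℤ_p` of `ℚ_p`. -/
def padicBall (m : ℤ) : AddSubgroup ℚ_[p] where
  carrier := {t | ‖t‖ ≤ (p : ℝ) ^ (-m)}
  zero_mem' := by
    simp only [Set.mem_ofPred_eq, norm_zero]
    positivity
  add_mem' {a b} ha hb := (Padic.nonarchimedean a b).trans (max_le ha hb)
  neg_mem' {a} ha := by simpa using ha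

theorem mem_padicBall {m : ℤ} {t : ℚ_[p]} : t ∈ padicBall p m ↔ ‖t‖ ≤ (p : ℝ) ^ (-m) := Iff.rfl

theorem one_lt_prime_cast : (1 : ℝ) < p := by exact_mod_cast (Fact.out : p.Prime).one_lt

theorem prime_cast_ne_zero : (p : ℚ_[p]) ≠ 0 := by
  exact_mod_cast (Fact.out : p.Prime).ne_zero

theorem padicBall_anti {m n : ℤ} (h : m ≤ n) {t : ℚ_[p]} (ht : t ∈ padicBall p n) :
    t ∈ padicBall p m :=
  (mem_padicBall.1 ht).trans (zpow_le_zpow_right₀ one_lt_prime_cast.le (by omega))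

theorem mul_mem_padicBall {m n : ℤ} {s t : ℚ_[p]} (hs : s ∈ padicBall p m)
    (ht : t ∈ padicBall p n) : s * t ∈ padicBall p (m + n) := by
  have h0 : (0 : ℝ) < p := zero_lt_one.trans one_lt_prime_cast
  rw [mem_padicBall, norm_mul, neg_add, zpow_add₀ h0.ne']
  exact mul_le_mul hs ht (norm_nonneg _) (by positivity)

theorem natCast_mem_padicBall (n : ℕ) : (n : ℚ_[p]) ∈ padicBall p 0 := by
  simpa [mem_padicBall] using Padic.norm_int_le_one (p := p) n

theorem zpow_mem_padicBall (m : ℤ) : (p : ℚ_[p]) ^ m ∈ padicBall p m := by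
  simp [mem_padicBall]

theorem padicInt_mem_padicBall (z : ℤ_[p]) : (z : ℚ_[p]) ∈ padicBall p 0 := by
  simpa [mem_padicBall] using z.2

theorem natCast_mul_zpow_mem_padicBall (n : ℕ) (m : ℤ) :
    (n : ℚ_[p]) * (p : ℚ_[p]) ^ m ∈ padicBall p m := by
  simpa using mul_mem_padicBall (natCast_mem_padicBall (p := p) n) (zpow_mem_padicBall m)

theorem inv_mem_padicBall {m : ℤ} {s : ℚ_[p]} (hs : s ∉ padicBall p m) :
    s⁻¹ ∈ padicBall p (1 - m) := by
  have h0 : (0 : ℝ) < p := zero_lt_one.trans one_lt_prime_cast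
  have hs0 : s ≠ 0 := fun h => hs (h ▸ zero_mem _)
  rw [mem_padicBall, not_le, Padic.norm_eq_zpow_neg_valuation hs0,
    zpow_lt_zpow_iff_right₀ one_lt_prime_cast] at hs
  rw [mem_padicBall, norm_inv, Padic.norm_eq_zpow_neg_valuation hs0, ← zpow_neg]
  exact zpow_le_zpow_right₀ one_lt_prime_cast.le (by omega)

theorem exists_mem_padicBall (t : ℚ_[p]) : ∃ m : ℕ, ∀ n : ℤ, n ≤ -m → t ∈ padicBall p n := by
  obtain ⟨m, hm⟩ := pow_unbounded_of_one_lt ‖t‖ (one_lt_prime_cast (p := p))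
  refine ⟨m, fun n hn => padicBall_anti hn ?_⟩
  rw [mem_padicBall]
  simpa using hm.le

theorem padicBall_mem_nhds (m : ℤ) : (padicBall p m : Set ℚ_[p]) ∈ nhds (0 : ℚ_[p]) := by
  have h0 : (0 : ℝ) < p := zero_lt_one.trans one_lt_prime_cast
  refine Filter.mem_of_superset (Metric.closedBall_mem_nhds (0 : ℚ_[p]) (zpow_pos h0 (-m))) ?_
  intro t ht
  simpa [mem_padicBall] using ht

theorem exists_padicBall_subset {U : Set ℚ_[p]} (hU : U ∈ nhds (0 : ℚ_[p])) :
    ∃ m : ℕ, (padicBall p m : Set ℚ_[p]) ⊆ U := by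
  obtain ⟨ε, hε, hU⟩ := Metric.nhds_basis_closedBall.mem_iff.1 hU
  obtain ⟨m, hm⟩ := exists_pow_lt_of_lt_one hε (inv_lt_one_of_one_lt₀ (one_lt_prime_cast (p := p)))
  refine ⟨m, fun t ht => hU ?_⟩
  have : ‖t‖ ≤ (p : ℝ) ^ (-(m : ℤ)) := ht
  simp only [zpow_neg, zpow_natCast, inv_pow] at this hm
  simpa using this.trans hm.le

/-- Rescale `t` into `ℤ_p` and truncate its expansion after `2 * m` digits. The resulting multiples
of `p ^ (-m)` represent the finite quotient over which all Fourier sums are taken. -/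
theorem exists_nat_approx (m : ℕ) {t : ℚ_[p]} (ht : t ∈ padicBall p (-m : ℤ)) :
    ∃ j < p ^ (2 * m), t - (j : ℚ_[p]) * (p : ℚ_[p]) ^ (-m : ℤ) ∈ padicBall p (m : ℤ) := by
  have hp := prime_cast_ne_zero (p := p)
  have h1 : t * (p : ℚ_[p]) ^ (m : ℤ) ∈ padicBall p 0 := by
    simpa using mul_mem_padicBall ht (zpow_mem_padicBall (p := p) (m : ℤ))
  let z : ℤ_[p] := ⟨t * (p : ℚ_[p]) ^ (m : ℤ), by simpa [mem_padicBall] using h1⟩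
  refine ⟨z.appr (2 * m), z.appr_lt _, ?_⟩
  have h2 := (PadicInt.norm_le_pow_iff_mem_span_pow _ _).2 (PadicInt.appr_spec (2 * m) z)
  have h3 : t * (p : ℚ_[p]) ^ (m : ℤ) - (z.appr (2 * m) : ℚ_[p]) ∈ padicBall p (2 * m : ℕ) := by
    rw [mem_padicBall]
    rw [PadicInt.norm_def, PadicInt.coe_sub, PadicInt.coe_natCast] at h2
    exact h2
  have h4 := mul_mem_padicBall h3 (zpow_mem_padicBall (p := p) (-m : ℤ))
  rw [sub_mul, mul_assoc, ← zpow_add₀ hp, add_neg_cancel, zpow_zero, mul_one] at h4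
  convert h4 using 1
  push_cast
  congr 1
  ring

/-- A normalized additive character: it is trivial on `ℤ_p`, but not at `p⁻¹`. -/
structure IsNormalizedChar (χ : AddChar ℚ_[p] ℂ) : Prop where
  trivial : ∀ t ∈ padicBall p 0, χ t = 1
  nontrivial : χ ((p : ℚ_[p]) ^ (-1 : ℤ)) ≠ 1

theorem AddChar.map_natCast_mul {M : Type*} [Monoid M] (χ : AddChar ℚ_[p] M) (n : ℕ)
    (t : ℚ_[p]) : χ (n * t) = χ t ^ n := by
  rw [← nsmul_eq_mul, AddChar.map_nsmul_eq_pow]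

/-- The `p ^ n`-th power is a value on `ℤ_p`, hence trivial, while for positive `n` the `p ^ (n -
1)`-th power is `χ (p⁻¹) ≠ 1`. -/
theorem IsNormalizedChar.isPrimitiveRoot {χ : AddChar ℚ_[p] ℂ} (h : IsNormalizedChar χ) (n : ℕ) :
    IsPrimitiveRoot (χ ((p : ℚ_[p]) ^ (-n : ℤ))) (p ^ n) := by
  have hp := prime_cast_ne_zero (p := p)
  have h1 : χ ((p : ℚ_[p]) ^ (-n : ℤ)) ^ p ^ n = 1 := by
    rw [← AddChar.map_natCast_mul]
    refine h.trivial _ ?_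
    push_cast
    rw [← zpow_natCast, ← zpow_add₀ hp]
    simp [mem_padicBall]
  rcases n with _ | n
  · simpa using h1
  · rw [← orderOf_eq_prime_pow (p := p) (n := n) (x := χ ((p : ℚ_[p]) ^ (-(n + 1 : ℕ) : ℤ))) ?_ h1]
    · exact IsPrimitiveRoot.orderOf _
    · rw [← AddChar.map_natCast_mul]
      convert h.nontrivial using 3
      push_cast
      rw [← zpow_natCast, ← zpow_add₀ hp]
      congr 1
      ring

theorem IsNormalizedChar.continuous_smul {χ : AddChar ℚ_[p] ℂ} (h : IsNormalizedChar χ)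
    (a : ℚ_[p]) : Continuous fun u : ℤ_[p] => χ (u * a) := by
  refine IsLocallyConstant.continuous ((IsLocallyConstant.iff_eventually_eq _).2 fun u => ?_)
  have h1 : Filter.Tendsto (fun w : ℤ_[p] => ((w : ℚ_[p]) - u) * a) (nhds u) (nhds 0) := by
    have : Continuous (fun w : ℤ_[p] => ((w : ℚ_[p]) - u) * a) := by fun_prop
    simpa using this.tendsto u
  filter_upwards [h1 (padicBall_mem_nhds 0)] with w hw
  have h2 : (w : ℚ_[p]) * a = u * a + (w - u) * a := by ring
  rw [h2, AddChar.map_add_eq_mul, h.trivial _ hw, mul_one]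

/-- Self-duality of `ℚ_p`. After rescaling, `θ` is trivial on `ℤ_p` and the multiplier is sought in
`ℤ_p` by compactness. -/
theorem IsNormalizedChar.exists_eq_mul {χ : AddChar ℚ_[p] ℂ} (h : IsNormalizedChar χ)
    {θ : AddChar ℚ_[p] ℂ} {M : ℤ} (hθ : ∀ t ∈ padicBall p M, θ t = 1) :
    ∃ u : ℚ_[p], ∀ t, θ t = χ (u * t) := by
  have hp := prime_cast_ne_zero (p := p)
  wlog hM : M = 0 generalizing M θ
  · let θ' : AddChar ℚ_[p] ℂ := θ.compAddMonoidHom (AddMonoidHom.mulLeft ((p : ℚ_[p]) ^ M))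
    have hθ' : ∀ t, θ' t = θ ((p : ℚ_[p]) ^ M * t) := fun t => rfl
    obtain ⟨u, hu⟩ := this (M := 0) (θ := θ') (fun t ht => by
      rw [hθ']
      exact hθ _ (by simpa using mul_mem_padicBall (zpow_mem_padicBall (p := p) M) ht)) rfl
    refine ⟨u * (p : ℚ_[p]) ^ (-M), fun t => ?_⟩
    rw [mul_assoc, ← hu, hθ', ← mul_assoc, ← zpow_add₀ hp]
    simp
  subst hM
  -- The multipliers that are correct on `p ^ (-n) ℤ_p`. They form a decreasing sequence of closed
  -- sets, nonempty because the values of `χ` at multiples of `p ^ (-n)` exhaust the `p ^ n`-th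
  -- roots of unity.
  let C : ℕ → Set ℤ_[p] := fun n =>
    {u | χ (u * (p : ℚ_[p]) ^ (-n : ℤ)) = θ ((p : ℚ_[p]) ^ (-n : ℤ))}
  have hclosed : ∀ n, IsClosed (C n) := fun n =>
    isClosed_eq (h.continuous_smul _) continuous_const
  have hstep : ∀ n : ℕ, (p : ℚ_[p]) ^ (-n : ℤ) = (p : ℕ) * (p : ℚ_[p]) ^ (-(n + 1 : ℕ) : ℤ) := by
    intro n
    rw [← zpow_one_add₀ hp]
    congr 1
    push_cast
    ring
  have hne : ∀ n, (C n).Nonempty := by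
    intro n
    have h1 : θ ((p : ℚ_[p]) ^ (-n : ℤ)) ^ p ^ n = 1 := by
      rw [← AddChar.map_natCast_mul]
      refine hθ _ ?_
      push_cast
      rw [← zpow_natCast, ← zpow_add₀ hp]
      simp [mem_padicBall]
    obtain ⟨i, -, hi⟩ := (h.isPrimitiveRoot n).eq_pow_of_pow_eq_one h1
    refine ⟨(i : ℤ_[p]), ?_⟩
    simp only [C, Set.mem_ofPred_eq, PadicInt.coe_natCast]
    rw [AddChar.map_natCast_mul, hi]
  obtain ⟨u, hu⟩ := IsCompact.nonempty_iInter_of_sequence_nonempty_isCompact_isClosed C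
    (fun n u hu => by
      simp only [C, Set.mem_ofPred_eq] at hu ⊢
      rw [hstep n, mul_left_comm, AddChar.map_natCast_mul, hu, AddChar.map_natCast_mul])
    hne (hclosed 0).isCompact hclosed
  refine ⟨((u : ℤ_[p]) : ℚ_[p]), fun t => ?_⟩
  obtain ⟨m, hm⟩ := exists_mem_padicBall t
  obtain ⟨j, -, hj⟩ := exists_nat_approx m (hm _ le_rfl)
  have hj0 := padicBall_anti (n := m) (m := 0) (by omega) hj
  have hum : χ (((u : ℤ_[p]) : ℚ_[p]) * (p : ℚ_[p]) ^ (-m : ℤ)) = θ ((p : ℚ_[p]) ^ (-m : ℤ)) :=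
    Set.mem_iInter.1 hu m
  have hur : χ (((u : ℤ_[p]) : ℚ_[p]) * (t - j * (p : ℚ_[p]) ^ (-m : ℤ))) = 1 :=
    h.trivial _ (by simpa only [zero_add] using mul_mem_padicBall (padicInt_mem_padicBall u) hj0)
  generalize ((u : ℤ_[p]) : ℚ_[p]) = w at *
  generalize hr : t - j * (p : ℚ_[p]) ^ (-m : ℤ) = r at *
  obtain rfl : t = j * (p : ℚ_[p]) ^ (-m : ℤ) + r := by rw [← hr]; ring
  rw [AddChar.map_add_eq_mul, mul_add, AddChar.map_add_eq_mul, hθ _ hj0, hur, mul_left_comm,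
    AddChar.map_natCast_mul, AddChar.map_natCast_mul, hum]

/-- Every nontrivial smooth character of `ℚ_p` is a dilate of a normalized one. -/
theorem exists_normalized {θ : AddChar ℚ_[p] ℂ} {M : ℤ} (hθ : ∀ t ∈ padicBall p M, θ t = 1)
    (hne : ∃ t, θ t ≠ 1) : ∃ u : ℚ_[p], u ≠ 0 ∧ 
      IsNormalizedChar (θ.compAddMonoidHom (AddMonoidHom.mulLeft u)) := by
  have hp := prime_cast_ne_zero (p := p)
  obtain ⟨t, ht⟩ := hne
  obtain ⟨n, hn⟩ := exists_mem_padicBall t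
  have hex : ∃ k : ℕ, ∀ t ∈ padicBall p (-n + k : ℤ), θ t = 1 :=
    ⟨(M + n).toNat, fun t ht => hθ t (padicBall_anti (by omega) ht)⟩
  classical
  have hk := Nat.find_spec hex
  set k := Nat.find hex with hkdef
  have hk0 : k ≠ 0 := by
    intro h0
    rw [h0] at hk
    exact ht (hk t (hn _ (by simp)))
  have hmin := Nat.find_min hex (m := k - 1) (by omega)
  push Not at hmin
  obtain ⟨s, hs, hs1⟩ := hmin
  have hs0 : s ≠ 0 := fun h => hs1 (by rw [h, AddChar.map_zero_eq_one])
  have hsk : s ∉ padicBall p (-n + k : ℤ) := fun h => hs1 (hk s h)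
  -- Here `s` lies in the last ball on which `θ` is nontrivial. Thus `p * s` lies in the ball where
  -- `θ` is trivial, and dilation by `p * s` sends `p⁻¹` to `s`.
  refine ⟨s * (p : ℚ_[p]) ^ (1 : ℤ), mul_ne_zero hs0 (zpow_ne_zero _ hp), ?_, ?_⟩
  · intro t ht
    change θ (s * (p : ℚ_[p]) ^ (1 : ℤ) * t) = 1
    refine hk _ ?_
    have := mul_mem_padicBall (mul_mem_padicBall hs (zpow_mem_padicBall (p := p) 1)) ht
    refine padicBall_anti ?_ this
    omega
  · change θ (s * (p : ℚ_[p]) ^ (1 : ℤ) * (p : ℚ_[p]) ^ (-1 : ℤ)) ≠ 1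
    rwa [mul_assoc, ← zpow_add₀ hp, add_neg_cancel, zpow_zero, mul_one]

end PadicBall

/-! ### The Heisenberg pair -/

section Heisenberg

variable {p : ℕ} [Fact p.Prime] {V : Type u} [AddCommGroup V] [Module ℂ V]

/-- The sum of the operators `φ t` over representatives `t` of `p ^ (-m) ℤ_p / p ^ m ℤ_p`. -/
def ballSum (φ : AddChar ℚ_[p] (Module.End ℂ V)) (m : ℕ) : Module.End ℂ V :=
  ∑ j ∈ Finset.range (p ^ (2 * m)), φ (j * (p : ℚ_[p]) ^ (-m : ℤ))

theorem ballSum_apply (φ : AddChar ℚ_[p] (Module.End ℂ V)) (m : ℕ) (v : V) :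
    ballSum φ m v = ∑ j ∈ Finset.range (p ^ (2 * m)), φ (j * (p : ℚ_[p]) ^ (-m : ℤ)) v := by
  simp [ballSum]

theorem AddChar.apply_comm {A M : Type*} [AddCommMonoid A] [Monoid M] (φ : AddChar A M) (s t : A) :
    φ s * φ t = φ t * φ s := by
  rw [← AddChar.map_add_eq_mul, add_comm, AddChar.map_add_eq_mul]

theorem AddChar.end_comm (φ : AddChar ℚ_[p] (Module.End ℂ V)) (s t : ℚ_[p]) (v : V) :
    φ s (φ t v) = φ t (φ s v) := by
  rw [← Module.End.mul_apply, AddChar.apply_comm, Module.End.mul_apply]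

theorem AddChar.end_add (φ : AddChar ℚ_[p] (Module.End ℂ V)) (s t : ℚ_[p]) (v : V) :
    φ (s + t) v = φ s (φ t v) := by
  rw [AddChar.map_add_eq_mul, Module.End.mul_apply]

theorem ballSum_comm (φ : AddChar ℚ_[p] (Module.End ℂ V)) (m : ℕ) {T : Module.End ℂ V}
    (hT : ∀ t v, T (φ t v) = φ t (T v)) (v : V) : T (ballSum φ m v) = ballSum φ m (T v) := by
  simp [ballSum_apply, hT]

/-- Translation by `p ^ (-m)` permutes the summands cyclically: the term that overflows is
translated by `p ^ (2 * m) * p ^ (-m) = p ^ m`, which fixes `v`. -/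
theorem ballSum_invariant (φ : AddChar ℚ_[p] (Module.End ℂ V)) {m : ℕ} {v : V}
    (hv : ∀ t ∈ padicBall p m, φ t v = v) {t : ℚ_[p]} (ht : t ∈ padicBall p (-m : ℤ)) :
    φ t (ballSum φ m v) = ballSum φ m v := by
  have hp := prime_cast_ne_zero (p := p)
  have h1 : φ ((p : ℚ_[p]) ^ (-m : ℤ)) (ballSum φ m v) = ballSum φ m v := by
    rw [ballSum_apply, map_sum]
    have : ∀ j : ℕ, φ ((p : ℚ_[p]) ^ (-m : ℤ)) (φ (j * (p : ℚ_[p]) ^ (-m : ℤ)) v) =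
        φ ((j + 1 : ℕ) * (p : ℚ_[p]) ^ (-m : ℤ)) v := by
      intro j
      rw [← AddChar.end_add]
      congr 2
      push_cast
      ring
    simp only [this]
    have h2 := Finset.sum_range_succ (fun j : ℕ => φ (j * (p : ℚ_[p]) ^ (-m : ℤ)) v) (p ^ (2 * m))
    rw [Finset.sum_range_succ'] at h2
    have h3 : φ (((p ^ (2 * m) : ℕ) : ℚ_[p]) * (p : ℚ_[p]) ^ (-m : ℤ)) v = v := by
      refine hv _ ?_
      push_cast
      rw [← zpow_natCast, ← zpow_add₀ hp]
      convert zpow_mem_padicBall (p := p) (m : ℤ) using 2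
      push_cast
      ring
    rw [h3] at h2
    simpa using h2
  have h2 : ∀ j : ℕ, φ (j * (p : ℚ_[p]) ^ (-m : ℤ)) (ballSum φ m v) = ballSum φ m v := by
    intro j
    induction j with
    | zero => simp
    | succ j ih =>
      rw [Nat.cast_succ, add_mul, one_mul, AddChar.end_add, h1, ih]
  obtain ⟨j, -, hj⟩ := exists_nat_approx m ht
  have ht' : t = j * (p : ℚ_[p]) ^ (-m : ℤ) + (t - j * (p : ℚ_[p]) ^ (-m : ℤ)) := by ring
  rw [ht', AddChar.end_add, ballSum_comm φ m (fun s w => AddChar.end_comm φ _ s w) v, hv _ hj, h2]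

/-- Smoothness of a representation of `ℚ_p`. -/
def SmoothChar (φ : AddChar ℚ_[p] (Module.End ℂ V)) : Prop :=
  ∀ v, ∃ M : ℕ, ∀ t ∈ padicBall p M, φ t v = v

/-- The vectors that vanish in the coinvariants of the smooth representation `φ` of `ℚ_p`. -/
def coinvKer (φ : AddChar ℚ_[p] (Module.End ℂ V)) : Submodule ℂ V where
  carrier := {v | ∀ᶠ m in Filter.atTop, ballSum φ m v = 0}
  zero_mem' := by simp
  add_mem' {a b} ha hb := by
    filter_upwards [ha, hb] with m h1 h2
    rw [map_add, h1, h2, add_zero]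
  smul_mem' c a ha := by
    filter_upwards [ha] with m h1
    rw [map_smul, h1, smul_zero]

theorem mem_coinvKer {φ : AddChar ℚ_[p] (Module.End ℂ V)} {v : V} :
    v ∈ coinvKer φ ↔ ∀ᶠ m in Filter.atTop, ballSum φ m v = 0 := Iff.rfl

theorem coinvKer_stable {φ : AddChar ℚ_[p] (Module.End ℂ V)} {T : Module.End ℂ V}
    (hT : ∀ t v, T (φ t v) = φ t (T v)) {v : V} (hv : v ∈ coinvKer φ) : T v ∈ coinvKer φ := by
  filter_upwards [mem_coinvKer.1 hv] with m h1
  rw [← ballSum_comm φ m hT, h1, map_zero]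

/-- The sum is invariant under `t`, yet `t` multiplies it by `c ≠ 1`. -/
theorem ballSum_eq_zero_of_eigen {φ : AddChar ℚ_[p] (Module.End ℂ V)} {m : ℕ} {w : V}
    (hw : ∀ t ∈ padicBall p m, φ t w = w) {t : ℚ_[p]} (ht : t ∈ padicBall p (-m : ℤ)) {c : ℂ}
    (hc : φ t w = c • w) (hc1 : c ≠ 1) : ballSum φ m w = 0 := by
  have h1 := ballSum_invariant φ hw ht
  rw [ballSum_comm φ m (fun s w => AddChar.end_comm φ _ s w), hc, map_smul] at h1
  have h2 : (c - 1) • ballSum φ m w = 0 := by rw [sub_smul, one_smul, h1, sub_self]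
  exact (smul_eq_zero.1 h2).resolve_left (sub_ne_zero.2 hc1)

theorem mem_coinvKer_of_eigen {φ : AddChar ℚ_[p] (Module.End ℂ V)} (hφ : SmoothChar φ) {w : V}
    {t : ℚ_[p]} {c : ℂ} (hc : φ t w = c • w) (hc1 : c ≠ 1) : w ∈ coinvKer φ := by
  obtain ⟨M, hM⟩ := hφ w
  obtain ⟨n, hn⟩ := exists_mem_padicBall t
  refine mem_coinvKer.2 (Filter.eventually_atTop.2 ⟨max M n, fun m hm => ?_⟩)
  exact ballSum_eq_zero_of_eigen (fun s hs => hM s (padicBall_anti (by omega) hs))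
    (hn (-m) (by omega)) hc hc1

/-- A pair of smooth representations `φ`, `x` of `ℚ_p` on `V` with
`x s ∘ φ t = χ (s t) • φ t ∘ x s`. -/
structure HeisenbergPair (χ : AddChar ℚ_[p] ℂ) (φ x : AddChar ℚ_[p] (Module.End ℂ V)) : Prop where
  char : IsNormalizedChar χ
  smooth_left : SmoothChar φ
  smooth_right : SmoothChar x
  comm : ∀ s t v, x s (φ t v) = χ (s * t) • φ t (x s v)

/-! ### Fourier inversion and reconstruction from coinvariants -/

namespace HeisenbergPair

variable {χ : AddChar ℚ_[p] ℂ} {φ x : AddChar ℚ_[p] (Module.End ℂ V)}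

theorem comm' (h : HeisenbergPair χ φ x) (s t : ℚ_[p]) (v : V) :
    φ t (x s v) = χ (-(s * t)) • x s (φ t v) := by
  rw [h.comm, smul_smul, ← AddChar.map_add_eq_mul, neg_add_cancel, AddChar.map_zero_eq_one,
    one_smul]

/-- Conjugation by `x (i p ^ (-m))` multiplies the `j`-th summand of the ball sum by `ζ ^ (i * j)`
with `ζ` a primitive `p ^ (2 * m)`-th root of unity. Orthogonality of characters leaves only `j =
0`. -/
theorem fourier (h : HeisenbergPair χ φ x) (m : ℕ) (v : V) :
    ∑ i ∈ Finset.range (p ^ (2 * m)), x (-(i * (p : ℚ_[p]) ^ (-m : ℤ)))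
      (ballSum φ m (x (i * (p : ℚ_[p]) ^ (-m : ℤ)) v)) = (p ^ (2 * m) : ℂ) • v := by
  have hp := prime_cast_ne_zero (p := p)
  set N := p ^ (2 * m) with hN
  have hNpos : 0 < N := pow_pos (Fact.out : p.Prime).pos _
  have hζ : IsPrimitiveRoot (χ (-(p : ℚ_[p]) ^ (-(2 * m : ℕ) : ℤ))) N := by
    rw [AddChar.map_neg_eq_inv]
    exact (h.char.isPrimitiveRoot (2 * m)).inv
  set ζ := χ (-(p : ℚ_[p]) ^ (-(2 * m : ℕ) : ℤ)) with hζdef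
  have h1 : ∀ i j : ℕ, x (-(i * (p : ℚ_[p]) ^ (-m : ℤ))) (φ (j * (p : ℚ_[p]) ^ (-m : ℤ))
      (x (i * (p : ℚ_[p]) ^ (-m : ℤ)) v)) = (ζ ^ j) ^ i • φ (j * (p : ℚ_[p]) ^ (-m : ℤ)) v := by
    intro i j
    rw [h.comm, ← AddChar.end_add, neg_add_cancel, AddChar.map_zero_eq_one, Module.End.one_apply,
      ← pow_mul, hζdef, ← AddChar.map_natCast_mul]
    congr 2
    have : (p : ℚ_[p]) ^ (-(2 * m : ℕ) : ℤ) = (p : ℚ_[p]) ^ (-m : ℤ) * (p : ℚ_[p]) ^ (-m : ℤ) := by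
      rw [← zpow_add₀ hp]
      congr 1
      push_cast
      ring
    rw [this]
    push_cast
    ring
  simp only [ballSum_apply, map_sum, h1]
  rw [← hN, Finset.sum_comm, Finset.sum_eq_single_of_mem 0 (Finset.mem_range.2 hNpos)]
  · simp [hN, ← Nat.cast_smul_eq_nsmul ℂ]
  · intro j hj hj0
    rw [← Finset.sum_smul]
    have h2 : ζ ^ j ≠ 1 := hζ.pow_ne_one_of_pos_of_lt hj0 (Finset.mem_range.1 hj)
    have h3 : (ζ ^ j) ^ N = 1 := by rw [← pow_mul, mul_comm, pow_mul, hζ.pow_eq_one, one_pow]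
    have h4 := mul_neg_geom_sum (ζ ^ j) N
    rw [h3, sub_self] at h4
    rw [(mul_eq_zero.1 h4).resolve_left (sub_ne_zero.2 h2.symm), zero_smul]

/-- A vector lies in the invariant subspace `U` as soon as finitely many translates do so modulo
the kernel of the coinvariants. -/
theorem mem_of_translates (h : HeisenbergPair χ φ x) {U : Submodule ℂ V}
    (hφ : ∀ t, ∀ w ∈ U, φ t w ∈ U) (hx : ∀ s, ∀ w ∈ U, x s w ∈ U) {v : V} {M : ℕ}
    (hM : ∀ t ∈ padicBall p M, φ t v = v) (hR : ∀ s ∈ padicBall p M, x s v = v)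
    (hs : ∀ i < p ^ (2 * (M + 1)), x (i * (p : ℚ_[p]) ^ (-(M + 1 : ℕ) : ℤ)) v ∈ U ⊔ coinvKer φ) :
    v ∈ U := by
  have hp := prime_cast_ne_zero (p := p)
  have hS : ∀ m, ∀ w ∈ U, ballSum φ m w ∈ U := fun m w hw => by
    rw [ballSum_apply]
    exact Submodule.sum_mem _ fun j _ => hφ _ _ hw
  have hev : ∀ᶠ m in Filter.atTop, ∀ i ∈ Finset.range (p ^ (2 * (M + 1))),
      ballSum φ m (x (i * (p : ℚ_[p]) ^ (-(M + 1 : ℕ) : ℤ)) v) ∈ U := by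
    rw [Filter.eventually_all_finset]
    intro i hi
    obtain ⟨a, ha, b, hb, hab⟩ := Submodule.mem_sup.1 (hs i (Finset.mem_range.1 hi))
    filter_upwards [mem_coinvKer.1 hb] with m hm
    rw [← hab, map_add, hm, add_zero]
    exact hS m a ha
  obtain ⟨m, hm, hmM⟩ := (hev.and (Filter.eventually_ge_atTop (M + 1))).exists
  -- Once `m` is fixed, every term of the Fourier inversion formula has to be placed in `U`. The
  -- terms with small `s` reduce to the finitely many given translates, because `v` is fixed by `x`
  -- on `p ^ M ℤ_p`; those with large `s` vanish.
  have key : ∀ i : ℕ, ballSum φ m (x (i * (p : ℚ_[p]) ^ (-m : ℤ)) v) ∈ U := by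
    intro i
    set s := (i : ℚ_[p]) * (p : ℚ_[p]) ^ (-m : ℤ) with hsdef
    have hsm : s ∈ padicBall p (-m : ℤ) := natCast_mul_zpow_mem_padicBall i _
    by_cases hsM : s ∈ padicBall p (-(M + 1 : ℕ) : ℤ)
    · obtain ⟨j, hj, hj'⟩ := exists_nat_approx (M + 1) hsM
      have : x s v = x (j * (p : ℚ_[p]) ^ (-(M + 1 : ℕ) : ℤ)) v := by
        conv_lhs => rw [← add_sub_cancel (j * (p : ℚ_[p]) ^ (-(M + 1 : ℕ) : ℤ)) s, AddChar.end_add]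
        rw [hR _ (padicBall_anti (by omega) hj')]
      rw [this]
      exact hm j (Finset.mem_range.2 hj)
    · have hs0 : s ≠ 0 := fun h0 => hsM (h0 ▸ zero_mem _)
      have hinv := inv_mem_padicBall hsM
      -- Chosen so that `s * t = p⁻¹`: then `φ t` multiplies `x s v` by `χ (-p⁻¹) ≠ 1`. Since `s` is
      -- large, `t` is small enough for `φ t` to fix `v`.
      set t := (p : ℚ_[p]) ^ (-1 : ℤ) * s⁻¹ with htdef
      have ht : t ∈ padicBall p M := by
        have := mul_mem_padicBall (zpow_mem_padicBall (p := p) (-1)) hinv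
        refine padicBall_anti ?_ this
        push_cast
        omega
      have hzero : ballSum φ m (x s v) = 0 := by
        refine ballSum_eq_zero_of_eigen (t := t) (c := χ (-(s * t))) ?_
          (padicBall_anti (by omega) ht) ?_ ?_
        · intro r hr
          rw [h.comm', hM r (padicBall_anti (by omega) hr), h.char.trivial, one_smul]
          have := mul_mem_padicBall hsm hr
          rw [neg_add_cancel] at this
          exact neg_mem this
        · rw [h.comm', hM t ht]
        · have : s * t = (p : ℚ_[p]) ^ (-1 : ℤ) := by
            rw [htdef]
            field_simp
          rw [this, AddChar.map_neg_eq_inv]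
          exact fun h' => h.char.nontrivial (inv_eq_one.1 h')
      rw [hzero]
      exact U.zero_mem
  have hN : (p ^ (2 * m) : ℂ) ≠ 0 := pow_ne_zero _ (by exact_mod_cast (Fact.out : p.Prime).ne_zero)
  have h5 : (p ^ (2 * m) : ℂ) • v ∈ U := by
    rw [← h.fourier m v]
    exact Submodule.sum_mem _ fun i _ => hx _ _ (key i)
  exact (Submodule.smul_mem_iff _ hN).1 h5

theorem mem_of_forall_translate (h : HeisenbergPair χ φ x) {U : Submodule ℂ V}
    (hφ : ∀ t, ∀ w ∈ U, φ t w ∈ U) (hx : ∀ s, ∀ w ∈ U, x s w ∈ U) {v : V}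
    (hs : ∀ s, x s v ∈ U ⊔ coinvKer φ) : v ∈ U := by
  obtain ⟨M, hM⟩ := h.smooth_left v
  obtain ⟨R, hR⟩ := h.smooth_right v
  exact h.mem_of_translates hφ hx (M := max M R)
    (fun t ht => hM t (padicBall_anti (by omega) ht))
    (fun t ht => hR t (padicBall_anti (by omega) ht)) fun i _ => hs _

/-- The translates of a large ball sum are, modulo the kernel of the coinvariants, either equal to
the ball sum of the vector or zero. -/
theorem translate_ballSum (h : HeisenbergPair χ φ x) {m : ℕ} {v : V}
    (hM : ∀ t ∈ padicBall p m, φ t v = v) (hR : ∀ s ∈ padicBall p m, x s v = v) (s : ℚ_[p]) :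
    x s (ballSum φ m v) = ballSum φ m v ∨ x s (ballSum φ m v) ∈ coinvKer φ := by
  by_cases hs : s ∈ padicBall p m
  · left
    rw [ballSum_apply, map_sum]
    refine Finset.sum_congr rfl fun j _ => ?_
    have := mul_mem_padicBall hs (natCast_mul_zpow_mem_padicBall (p := p) j (-m : ℤ))
    rw [add_neg_cancel] at this
    rw [h.comm, h.char.trivial _ this, one_smul, hR s hs]
  · right
    have hs0 : s ≠ 0 := fun h0 => hs (h0 ▸ zero_mem _)
    have ht : (p : ℚ_[p]) ^ (-1 : ℤ) * s⁻¹ ∈ padicBall p (-m : ℤ) := by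
      have := mul_mem_padicBall (zpow_mem_padicBall (p := p) (-1)) (inv_mem_padicBall hs)
      exact padicBall_anti (by omega) this
    refine mem_coinvKer_of_eigen h.smooth_left (t := (p : ℚ_[p]) ^ (-1 : ℤ) * s⁻¹)
      (c := χ (-(p : ℚ_[p]) ^ (-1 : ℤ))) ?_ ?_
    · rw [h.comm', ballSum_invariant φ hM ht]
      congr 3
      field_simp
    · rw [AddChar.map_neg_eq_inv]
      exact fun h' => h.char.nontrivial (inv_eq_one.1 h')

end HeisenbergPair

end Heisenberg

/-! ### Prime representations -/

section Prime

variable {G : Type v} [Group G] {V : Type u} [AddCommGroup V] [Module ℂ V]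

/-- A subspace is invariant under all operators of the representation. -/
def RepInvariant (ρ : Representation ℂ G V) (W : Submodule ℂ V) : Prop :=
  ∀ g, ∀ w ∈ W, ρ g w ∈ W

/-- The vectors fixed by a subgroup. -/
def fixedSubmodule (ρ : Representation ℂ G V) (K : Subgroup G) : Submodule ℂ V where
  carrier := {v | ∀ k ∈ K, ρ k v = v}
  zero_mem' := by simp
  add_mem' {a b} ha hb k hk := by rw [map_add, ha k hk, hb k hk]
  smul_mem' c a ha k hk := by rw [map_smul, ha k hk]

theorem rep_mul (ρ : Representation ℂ G V) (g h : G) (v : V) : ρ (g * h) v = ρ g (ρ h v) := by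
  rw [map_mul, Module.End.mul_apply]

theorem rep_inv_apply (ρ : Representation ℂ G V) (g : G) (v : V) : ρ g⁻¹ (ρ g v) = v := by
  rw [← rep_mul, inv_mul_cancel, map_one, Module.End.one_apply]

theorem rep_apply_inv (ρ : Representation ℂ G V) (g : G) (v : V) : ρ g (ρ g⁻¹ v) = v := by
  rw [← rep_mul, mul_inv_cancel, map_one, Module.End.one_apply]

theorem rep_mem_fixed_conj {ρ : Representation ℂ G V} {K : Subgroup G} {v : V}
    (hv : v ∈ fixedSubmodule ρ K) (g : G) :
    ρ g v ∈ fixedSubmodule ρ (K.comap (MulAut.conj g⁻¹).toMonoidHom) := by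
  intro k hk
  have h1 : g⁻¹ * k * g ∈ K := by simpa using hk
  have h2 := hv _ h1
  rw [rep_mul, rep_mul] at h2
  rw [← rep_apply_inv ρ g (ρ k (ρ g v)), h2]

theorem mul_mem_span_range (ρ : Representation ℂ G V) {S T : Module.End ℂ V}
    (hS : S ∈ Submodule.span ℂ (Set.range ρ)) (hT : T ∈ Submodule.span ℂ (Set.range ρ)) :
    S * T ∈ Submodule.span ℂ (Set.range ρ) := by
  have := Submodule.mul_mem_mul hS hT
  rw [Submodule.span_mul_span] at this
  refine Submodule.span_mono ?_ this
  rintro _ ⟨_, ⟨g, rfl⟩, _, ⟨h, rfl⟩, rfl⟩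
  exact ⟨g * h, map_mul ρ g h⟩

theorem span_range_mem_invariant {ρ : Representation ℂ G V} {W : Submodule ℂ V}
    (hW : RepInvariant ρ W) {T : Module.End ℂ V} (hT : T ∈ Submodule.span ℂ (Set.range ρ)) {w : V}
    (hw : w ∈ W) : T w ∈ W := by
  induction hT using Submodule.span_induction with
  | mem T h =>
    obtain ⟨g, rfl⟩ := h
    exact hW g w hw
  | zero => exact W.zero_mem
  | add S T _ _ hS hT => exact W.add_mem hS hT
  | smul c T _ hT => exact W.smul_mem c hT

variable [TopologicalSpace G]

/-- A representation is prime if every group algebra element that kills the `K`-fixed vectors of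
some nonzero subrepresentation kills all `K`-fixed vectors. -/
def IsPrimeRep (ρ : Representation ℂ G V) : Prop :=
  Nontrivial V ∧ ∀ T ∈ Submodule.span ℂ (Set.range ρ), ∀ W : Submodule ℂ V, RepInvariant ρ W →
    W ≠ ⊥ → ∀ K : Subgroup G, IsOpen (K : Set G) → IsCompact (K : Set G) →
    (∀ w ∈ W, w ∈ fixedSubmodule ρ K → T w = 0) → ∀ v ∈ fixedSubmodule ρ K, T v = 0

/-- The representation has an irreducible admissible subrepresentation. -/
def HasAdmissibleIrr (ρ : Representation ℂ G V) : Prop :=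
  ∃ W : Submodule ℂ V, RepInvariant ρ W ∧ W ≠ ⊥ ∧
    (∀ U ≤ W, RepInvariant ρ U → U ≠ ⊥ → U = W) ∧
    ∀ K : Subgroup G, IsOpen (K : Set G) →
      FiniteDimensional ℂ (W ⊓ fixedSubmodule ρ K : Submodule ℂ V)

theorem IsPrimeRep.eq_zero {ρ : Representation ℂ G V} (h : IsPrimeRep ρ) (hs : IsSmoothRep ρ)
    {T : Module.End ℂ V} (hT : T ∈ Submodule.span ℂ (Set.range ρ)) {W : Submodule ℂ V}
    (hW : RepInvariant ρ W) (hW0 : W ≠ ⊥) (hTW : ∀ w ∈ W, T w = 0) (v : V) : T v = 0 := by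
  obtain ⟨K, hK, hK', hv⟩ := hs v
  exact h.2 T hT W hW hW0 K hK hK' (fun w hw _ => hTW w hw) v hv

/-- A finite intersection of conjugates of `K` works. What matters is that one subgroup serves all
`K`-fixed vectors at once. -/
theorem exists_open_fixing_apply [IsTopologicalGroup G] {ρ : Representation ℂ G V} {K : Subgroup G}
    (hK : IsOpen (K : Set G)) {T : Module.End ℂ V} (hT : T ∈ Submodule.span ℂ (Set.range ρ)) :
    ∃ K' : Subgroup G, IsOpen (K' : Set G) ∧
      ∀ v ∈ fixedSubmodule ρ K, T v ∈ fixedSubmodule ρ K' := by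
  induction hT using Submodule.span_induction with
  | mem T h =>
    obtain ⟨g, rfl⟩ := h
    refine ⟨K.comap (MulAut.conj g⁻¹).toMonoidHom, ?_, fun v hv => rep_mem_fixed_conj hv g⟩
    have : Continuous fun k : G => g⁻¹ * k * g⁻¹⁻¹ := by fun_prop
    exact hK.preimage this
  | zero => exact ⟨⊤, isOpen_univ, fun v _ => Submodule.zero_mem _⟩
  | add S T _ _ hS hT =>
    obtain ⟨K1, h1, h1'⟩ := hS
    obtain ⟨K2, h2, h2'⟩ := hT
    refine ⟨K1 ⊓ K2, h1.inter h2, fun v hv => Submodule.add_mem _ ?_ ?_⟩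
    · exact fun k hk => h1' v hv k hk.1
    · exact fun k hk => h2' v hv k hk.2
  | smul c T _ hT =>
    obtain ⟨K1, h1, h1'⟩ := hT
    exact ⟨K1, h1, fun v hv => Submodule.smul_mem _ c (h1' v hv)⟩

/-- The sum over coset representatives in a compact subgroup `K` maps vectors fixed by an open
subgroup `L` to vectors fixed by `K`. -/
theorem exists_coset_sum [IsTopologicalGroup G] (ρ : Representation ℂ G V) {K L : Subgroup G}
    (hK : IsCompact (K : Set G)) (hL : IsOpen (L : Set G)) :
    ∃ (m : ℕ) (k : Fin m → G), 0 < m ∧ (∀ i, k i ∈ K) ∧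
      ∀ v ∈ fixedSubmodule ρ L, ∑ i, ρ (k i) v ∈ fixedSubmodule ρ K := by
  have : CompactSpace K := isCompact_iff_compactSpace.1 hK
  have hLo : IsOpen ((L.subgroupOf K : Subgroup K) : Set K) := hL.preimage continuous_subtype_val
  have : Finite (K ⧸ L.subgroupOf K) := Subgroup.quotient_finite_of_isOpen _ hLo
  have := Fintype.ofFinite (K ⧸ L.subgroupOf K)
  let e := Fintype.equivFin (K ⧸ L.subgroupOf K)
  refine ⟨_, fun i => ((e.symm i).out : K), Fintype.card_pos, fun i => ((e.symm i).out : K).2,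
    fun v hv => ?_⟩
  have hsum : ∑ i, ρ ((e.symm i).out : K) v = ∑ q : K ⧸ L.subgroupOf K, ρ (q.out : K) v :=
    Fintype.sum_equiv e.symm _ _ fun i => rfl
  rw [hsum]
  intro k hk
  rw [map_sum]
  refine Fintype.sum_equiv (MulAction.toPerm (⟨k, hk⟩ : K)) _ _ fun q => ?_
  rw [← rep_mul]
  -- The translated representative and the chosen representative of the same coset differ by an
  -- element of `L`, which fixes `v`.
  have h1 : (((⟨k, hk⟩ : K) * q.out : K) : K ⧸ L.subgroupOf K) =
      ((MulAction.toPerm (⟨k, hk⟩ : K) q).out : K) := by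
    rw [QuotientGroup.out_eq', MulAction.toPerm_apply]
    conv_rhs => rw [← QuotientGroup.out_eq' q]
    rfl
  have h2 := QuotientGroup.eq.1 h1
  rw [Subgroup.mem_subgroupOf] at h2
  have h3 := hv _ h2
  conv_lhs => rw [← h3]
  rw [← rep_mul]
  simp

/-- An unnormalized projector to the `K`-fixed vectors that lies in the group algebra image. It
depends on `L` and projects only on `L`-fixed vectors, which makes it a finite sum. -/
theorem exists_average [IsTopologicalGroup G] (ρ : Representation ℂ G V) {K L : Subgroup G}
    (hK : IsCompact (K : Set G)) (hL : IsOpen (L : Set G)) :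
    ∃ E ∈ Submodule.span ℂ (Set.range ρ), (∀ v ∈ fixedSubmodule ρ L, E v ∈ fixedSubmodule ρ K) ∧
      ∃ r : ℂ, r ≠ 0 ∧ ∀ v ∈ fixedSubmodule ρ K, E v = r • v := by
  obtain ⟨m, k, hm, hk, h⟩ := exists_coset_sum ρ hK hL
  refine ⟨∑ i, ρ (k i), Submodule.sum_mem _ fun i _ => Submodule.subset_span ⟨_, rfl⟩,
    fun v hv => ?_, m, by exact_mod_cast hm.ne', fun v hv => ?_⟩
  · rw [LinearMap.sum_apply]
    exact h v hv
  · rw [LinearMap.sum_apply, Finset.sum_congr rfl fun i _ => hv _ (hk i)]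
    simp [← Nat.cast_smul_eq_nsmul ℂ]

/-- The representation of a subgroup on a quotient. -/
def quotientRep (ρ : Representation ℂ G V) (N : Subgroup G) (J : Submodule ℂ V)
    (hJ : ∀ n ∈ N, ∀ v ∈ J, ρ n v ∈ J) : Representation ℂ N (V ⧸ J) where
  toFun n := J.mapQ J (ρ n) (hJ n n.2)
  map_one' := by ext; simp
  map_mul' a b := by ext; simp

@[simp]
theorem quotientRep_mkQ {ρ : Representation ℂ G V} {N : Subgroup G} {J : Submodule ℂ V}
    {hJ : ∀ n ∈ N, ∀ v ∈ J, ρ n v ∈ J} (n : N) (v : V) :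
    quotientRep ρ N J hJ n (J.mkQ v) = J.mkQ (ρ n v) := rfl

theorem exists_lift_span {ρ : Representation ℂ G V} {N : Subgroup G} {J : Submodule ℂ V}
    {hJ : ∀ n ∈ N, ∀ v ∈ J, ρ n v ∈ J} {T : Module.End ℂ (V ⧸ J)}
    (hT : T ∈ Submodule.span ℂ (Set.range (quotientRep ρ N J hJ))) :
    ∃ F ∈ Submodule.span ℂ (Set.range ρ), ∀ v, J.mkQ (F v) = T (J.mkQ v) := by
  induction hT using Submodule.span_induction with
  | mem T h =>
    obtain ⟨g, rfl⟩ := h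
    exact ⟨ρ g, Submodule.subset_span ⟨g, rfl⟩, fun v => rfl⟩
  | zero => exact ⟨0, Submodule.zero_mem _, fun v => by simp⟩
  | add S T _ _ hS hT =>
    obtain ⟨F, hF, hF'⟩ := hS
    obtain ⟨F', hF1, hF1'⟩ := hT
    exact ⟨F + F', Submodule.add_mem _ hF hF1, fun v => by
      rw [LinearMap.add_apply, map_add, hF', hF1', LinearMap.add_apply]⟩
  | smul c T _ hT =>
    obtain ⟨F, hF, hF'⟩ := hT
    exact ⟨c • F, Submodule.smul_mem _ c hF, fun v => by
      rw [LinearMap.smul_apply, map_smul, hF', LinearMap.smul_apply]⟩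

end Prime

/-! ### Reduction to the stabilizer of a character -/

section Reduction

variable {p : ℕ} [Fact p.Prime] {G : Type v} [Group G] [TopologicalSpace G] [IsTopologicalGroup G]
  {V : Type u} [AddCommGroup V] [Module ℂ V]

/-- The action of a one-parameter subgroup. -/
def oneParamRep (ρ : Representation ℂ G V) (φ : AddChar ℚ_[p] G) :
    AddChar ℚ_[p] (Module.End ℂ V) := ρ.compAddChar φ

@[simp]
theorem oneParamRep_apply (ρ : Representation ℂ G V) (φ : AddChar ℚ_[p] G) (t : ℚ_[p]) :
    oneParamRep ρ φ t = ρ (φ t) := rfl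

theorem exists_ball_oneParam {φ : AddChar ℚ_[p] G} (hφ : Continuous φ) {K : Subgroup G}
    (hK : IsOpen (K : Set G)) : ∃ M : ℕ, ∀ t ∈ padicBall p M, φ t ∈ K := by
  have h1 : φ ⁻¹' K ∈ nhds (0 : ℚ_[p]) := by
    refine (hK.preimage hφ).mem_nhds ?_
    simp [K.one_mem]
  exact exists_padicBall_subset h1

theorem smoothChar_oneParam {ρ : Representation ℂ G V} (hs : IsSmoothRep ρ) {φ : AddChar ℚ_[p] G}
    (hφ : Continuous φ) : SmoothChar (oneParamRep ρ φ) := by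
  intro v
  obtain ⟨K, hK, -, hv⟩ := hs v
  obtain ⟨M, hM⟩ := exists_ball_oneParam hφ hK
  exact ⟨M, fun t ht => hv _ (hM t ht)⟩

/-- A closed subgroup `N` that commutes with a one-parameter subgroup `φ` on `V`, and a
one-parameter subgroup `x` complementary to `N` that forms a Heisenberg pair with `φ` on `V`. -/
structure StabilizerData (ρ : Representation ℂ G V) (N : Subgroup G) (χ : AddChar ℚ_[p] ℂ)
    (φ x : AddChar ℚ_[p] G) : Prop where
  smooth : IsSmoothRep ρ
  closed : IsClosed (N : Set G)
  cont_left : Continuous φ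
  cont_right : Continuous x
  pair : HeisenbergPair χ (oneParamRep ρ φ) (oneParamRep ρ x)
  comm : ∀ n ∈ N, ∀ t v, ρ n (ρ (φ t) v) = ρ (φ t) (ρ n v)
  decomp : ∀ g, ∃ n ∈ N, ∃ s, g = n * x s

namespace StabilizerData

variable {ρ : Representation ℂ G V} {N : Subgroup G} {χ : AddChar ℚ_[p] ℂ} {φ x : AddChar ℚ_[p] G}

/-- The kernel of the projection to the coinvariants. -/
abbrev ker (_ : StabilizerData ρ N χ φ x) : Submodule ℂ V := coinvKer (oneParamRep ρ φ)

theorem ker_stable (D : StabilizerData ρ N χ φ x) : ∀ n ∈ N, ∀ v ∈ D.ker, ρ n v ∈ D.ker :=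
  fun n hn _ hv => coinvKer_stable (D.comm n hn) hv

/-- The representation of the stabilizer on the coinvariants. -/
abbrev rep (D : StabilizerData ρ N χ φ x) : Representation ℂ N (V ⧸ D.ker) :=
  quotientRep ρ N D.ker D.ker_stable

theorem smooth_rep (D : StabilizerData ρ N χ φ x) : IsSmoothRep D.rep := by
  intro v
  obtain ⟨v, rfl⟩ := D.ker.mkQ_surjective v
  obtain ⟨K, hK, hK', hv⟩ := D.smooth v
  refine ⟨K.subgroupOf N, hK.preimage continuous_subtype_val, ?_, fun n hn => ?_⟩
  · exact D.closed.isClosedEmbedding_subtypeVal.isCompact_preimage hK'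
  · exact congrArg D.ker.mkQ (hv _ hn)

/-- The case `U = ⊥` of the reconstruction: `V` embeds in the functions on the complement with
values in the coinvariants. -/
theorem eq_zero_of_translates (D : StabilizerData ρ N χ φ x) {v : V}
    (h : ∀ s, ρ (x s) v ∈ D.ker) : v = 0 := by
  have := D.pair.mem_of_forall_translate (U := ⊥) (v := v) (by simp) (by simp) (by simpa using h)
  simpa using this

theorem phi_sub_mem (D : StabilizerData ρ N χ φ x) (t : ℚ_[p]) (v : V) :
    ρ (φ t) v - v ∈ D.ker := by
  obtain ⟨M, hM⟩ := D.pair.smooth_left v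
  obtain ⟨n, hn⟩ := exists_mem_padicBall t
  refine mem_coinvKer.2 (Filter.eventually_atTop.2 ⟨max M n, fun m hm => ?_⟩)
  have h1 := ballSum_invariant (oneParamRep ρ φ) (m := m)
    (fun s hs => hM s (padicBall_anti (by omega) hs)) (hn (-m) (by omega))
  rw [ballSum_comm _ m (fun s w => AddChar.end_comm _ _ s w)] at h1
  rw [map_sub, sub_eq_zero]
  exact h1

theorem mkQ_ballSum (D : StabilizerData ρ N χ φ x) (m : ℕ) (v : V) :
    D.ker.mkQ (ballSum (oneParamRep ρ φ) m v) = (p ^ (2 * m) : ℂ) • D.ker.mkQ v := by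
  have h1 : ∀ t, D.ker.mkQ (ρ (φ t) v) = D.ker.mkQ v := fun t => by
    rw [← sub_eq_zero, ← map_sub]
    exact (Submodule.Quotient.mk_eq_zero _).2 (D.phi_sub_mem t v)
  simp only [ballSum_apply, map_sum, oneParamRep_apply, h1]
  simp [← Nat.cast_smul_eq_nsmul ℂ]

/-- The vectors of `V` all of whose translates lie in the subspace `W` of the coinvariants. -/
def induced (D : StabilizerData ρ N χ φ x) (W : Submodule ℂ (V ⧸ D.ker)) : Submodule ℂ V where
  carrier := {v | ∀ g, D.ker.mkQ (ρ g v) ∈ W}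
  zero_mem' := by simp
  add_mem' {a b} ha hb g := by
    rw [map_add, map_add]
    exact W.add_mem (ha g) (hb g)
  smul_mem' c a ha g := by
    rw [map_smul, map_smul]
    exact W.smul_mem c (ha g)

theorem mkQ_mem_of_mem_induced (D : StabilizerData ρ N χ φ x) {W : Submodule ℂ (V ⧸ D.ker)} {v : V}
    (hv : v ∈ D.induced W) : D.ker.mkQ v ∈ W := by
  simpa using hv 1

theorem induced_invariant (D : StabilizerData ρ N χ φ x) (W : Submodule ℂ (V ⧸ D.ker)) :
    RepInvariant ρ (D.induced W) := by
  intro g w hw g'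
  rw [← rep_mul]
  exact hw _

/-- A large ball sum of a lift of `w ∈ W` plays the role of an induced function supported near the
identity: each `x`-translate has class a multiple of `w` or zero, so all classes stay in `W`. -/
theorem induced_ne_bot (D : StabilizerData ρ N χ φ x) {W : Submodule ℂ (V ⧸ D.ker)}
    (hW : RepInvariant D.rep W) (hW0 : W ≠ ⊥) : D.induced W ≠ ⊥ := by
  obtain ⟨w, hw, hw0⟩ := Submodule.exists_mem_ne_zero_of_ne_bot hW0
  obtain ⟨w, rfl⟩ := D.ker.mkQ_surjective w
  obtain ⟨M, hM⟩ := D.pair.smooth_left w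
  obtain ⟨R, hR⟩ := D.pair.smooth_right w
  set m := max M R with hm
  have hS := D.mkQ_ballSum m w
  have hp : (p ^ (2 * m) : ℂ) ≠ 0 := pow_ne_zero _ (by exact_mod_cast (Fact.out : p.Prime).ne_zero)
  refine Submodule.ne_bot_iff _ |>.2 ⟨ballSum (oneParamRep ρ φ) m w, fun g => ?_, fun h0 => ?_⟩
  · obtain ⟨n, hn, s, rfl⟩ := D.decomp g
    rw [rep_mul]
    have h1 : D.ker.mkQ (ρ (x s) (ballSum (oneParamRep ρ φ) m w)) ∈ W := by
      rcases D.pair.translate_ballSum (m := m) (v := w)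
        (fun t ht => hM t (padicBall_anti (by omega) ht))
        (fun t ht => hR t (padicBall_anti (by omega) ht)) s with h | h
      · rw [oneParamRep_apply] at h
        rw [h, hS]
        exact W.smul_mem _ hw
      · have : D.ker.mkQ (ρ (x s) (ballSum (oneParamRep ρ φ) m w)) = 0 :=
          (Submodule.Quotient.mk_eq_zero _).2 h
        rw [this]
        exact W.zero_mem
    exact hW ⟨n, hn⟩ _ h1
  · rw [h0, map_zero] at hS
    exact hw0 ((smul_eq_zero.1 hS.symm).resolve_left hp)

theorem nontrivial_coinv (D : StabilizerData ρ N χ φ x) [Nontrivial V] :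
    Nontrivial (V ⧸ D.ker) := by
  rw [Submodule.Quotient.nontrivial_iff]
  intro h
  obtain ⟨v, hv⟩ := exists_ne (0 : V)
  exact hv (D.eq_zero_of_translates fun s => by rw [h]; trivial)

theorem ballSum_mem_span (ρ : Representation ℂ G V) (φ : AddChar ℚ_[p] G) (m : ℕ) :
    ballSum (oneParamRep ρ φ) m ∈ Submodule.span ℂ (Set.range ρ) :=
  Submodule.sum_mem _ fun _ _ => Submodule.subset_span ⟨_, rfl⟩

/-- If `T` kills the `K`-fixed part of `W`, a lift `F` of `T * E` sends the `L`-fixed vectors of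
`D.induced W` into the kernel. For large `m`, `ballSum m * F` then kills these vectors, hence all
`L`-fixed vectors of `V` by primeness, so `F v` vanishes in the coinvariants. Fixing the level `L`
gives a bound on `m` independent of the vector; this is why primeness is formulated with fixed
vectors. -/
theorem prime_rep (D : StabilizerData ρ N χ φ x) (h : IsPrimeRep ρ) : IsPrimeRep D.rep := by
  have := h.1
  refine ⟨D.nontrivial_coinv, fun T hT W hW hW0 K hK hK' hTW v hv => ?_⟩
  obtain ⟨v, rfl⟩ := D.ker.mkQ_surjective v
  obtain ⟨L, hL, hL', hvL⟩ := D.smooth v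
  have hLN : IsOpen ((L.subgroupOf N : Subgroup N) : Set N) := hL.preimage continuous_subtype_val
  obtain ⟨E, hE, hEL, r, hr, hEK⟩ := exists_average D.rep hK' hLN
  obtain ⟨F, hFρ, hFT⟩ := exists_lift_span (mul_mem_span_range _ hT hE)
  have hFker : ∀ w ∈ D.induced W, w ∈ fixedSubmodule ρ L → F w ∈ D.ker := by
    intro w hw hwL
    rw [← Submodule.ker_mkQ D.ker, LinearMap.mem_ker, hFT, Module.End.mul_apply]
    have hw1 := D.mkQ_mem_of_mem_induced hw
    refine hTW _ (span_range_mem_invariant hW hE hw1) (hEL _ fun k hk => ?_)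
    exact congrArg D.ker.mkQ (hwL _ hk)
  obtain ⟨L', hL', hLF⟩ := exists_open_fixing_apply hL hFρ
  obtain ⟨M, hM⟩ := exists_ball_oneParam D.cont_left hL'
  obtain ⟨R, hR⟩ := exists_ball_oneParam D.cont_right hL'
  have hFv : F v ∈ D.ker := by
    refine mem_coinvKer.2 (Filter.eventually_atTop.2 ⟨max M R, fun m hm => ?_⟩)
    have hkill := h.2 (ballSum (oneParamRep ρ φ) m * F)
      (mul_mem_span_range ρ (ballSum_mem_span ρ φ m) hFρ) (D.induced W) (D.induced_invariant W)
      (D.induced_ne_bot hW hW0) L hL ‹_› (fun w hw hwL => ?_) v hvL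
    · simpa using hkill
    · rw [Module.End.mul_apply]
      have hz := hLF w hwL
      -- The class of each translate is either zero or a multiple of the class of `F w`, which is
      -- zero as well.
      refine D.eq_zero_of_translates fun s => ?_
      rcases D.pair.translate_ballSum (m := m) (v := F w)
        (fun t ht => hz _ (hM t (padicBall_anti (by omega) ht)))
        (fun t ht => hz _ (hR t (padicBall_anti (by omega) ht))) s with h | h
      · rw [oneParamRep_apply] at h
        rw [h, ← Submodule.ker_mkQ D.ker, LinearMap.mem_ker, D.mkQ_ballSum]
        rw [show D.ker.mkQ (F w) = 0 from
          (Submodule.Quotient.mk_eq_zero _).2 (hFker w hw hwL), smul_zero]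
      · exact h
  have h2 := hFT v
  rw [show D.ker.mkQ (F v) = 0 from (Submodule.Quotient.mk_eq_zero _).2 hFv, Module.End.mul_apply,
    hEK _ hv, map_smul] at h2
  exact (smul_eq_zero.1 h2.symm).resolve_left hr

/-- A nonzero invariant `U ≤ D.induced W` has nonzero image in `W`, hence image `W`, and
reconstruction gives `U = D.induced W`. For admissibility, `K`-fixed vectors are determined by the
classes of finitely many translates, each fixed by a conjugate of `K`. -/
theorem hasAdmissibleIrr (D : StabilizerData ρ N χ φ x) (h : HasAdmissibleIrr D.rep) :
    HasAdmissibleIrr ρ := by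
  obtain ⟨W, hW, hW0, hmin, hadm⟩ := h
  refine ⟨D.induced W, D.induced_invariant W, D.induced_ne_bot hW hW0, fun U hU hUi hU0 => ?_,
    fun K hK => ?_⟩
  · have h1 : U.map D.ker.mkQ = W := by
      refine hmin _ ?_ ?_ ?_
      · rintro _ ⟨w, hw, rfl⟩
        exact D.mkQ_mem_of_mem_induced (hU hw)
      · rintro n _ ⟨w, hw, rfl⟩
        exact ⟨ρ n w, hUi _ _ hw, rfl⟩
      · intro h0
        refine hU0 ((Submodule.eq_bot_iff _).2 fun w hw => D.eq_zero_of_translates fun s => ?_)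
        have : D.ker.mkQ (ρ (x s) w) ∈ U.map D.ker.mkQ := ⟨_, hUi _ _ hw, rfl⟩
        rw [h0] at this
        exact (Submodule.Quotient.mk_eq_zero _).1 this
    refine le_antisymm hU fun v hv => ?_
    refine D.pair.mem_of_forall_translate (fun t w hw => hUi _ w hw) (fun t w hw => hUi _ w hw)
      fun s => ?_
    have h2 : D.ker.mkQ (ρ (x s) v) ∈ U.map D.ker.mkQ := by
      rw [h1]
      exact hv _
    have h3 : ρ (x s) v ∈ (U.map D.ker.mkQ).comap D.ker.mkQ := h2
    rw [Submodule.comap_map_mkQ, sup_comm] at h3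
    exact h3
  · obtain ⟨M, hM⟩ := exists_ball_oneParam D.cont_left hK
    obtain ⟨R, hR⟩ := exists_ball_oneParam D.cont_right hK
    let m := max M R
    let s : Fin (p ^ (2 * (m + 1))) → ℚ_[p] := fun i => i.1 * (p : ℚ_[p]) ^ (-(m + 1 : ℕ) : ℤ)
    let K' : Fin (p ^ (2 * (m + 1))) → Subgroup N := fun i =>
      (K.comap (MulAut.conj (x (s i))⁻¹).toMonoidHom).subgroupOf N
    have hK' : ∀ i, IsOpen (K' i : Set N) := fun i => by
      have : Continuous fun k : N => (x (s i))⁻¹ * k * (x (s i))⁻¹⁻¹ := by fun_prop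
      exact hK.preimage this
    have := fun i => hadm (K' i) (hK' i)
    let A : ∀ i, (D.induced W ⊓ fixedSubmodule ρ K : Submodule ℂ V) →ₗ[ℂ]
        (W ⊓ fixedSubmodule D.rep (K' i) : Submodule ℂ (V ⧸ D.ker)) := fun i =>
      (D.ker.mkQ ∘ₗ ρ (x (s i))).restrict fun v hv =>
        ⟨hv.1 _, fun k hk => by
          have := rep_mem_fixed_conj hv.2 (x (s i)) k hk
          rw [LinearMap.comp_apply, quotientRep_mkQ, this]⟩
    refine FiniteDimensional.of_injective (LinearMap.pi A) ?_
    rw [← LinearMap.ker_eq_bot, Submodule.eq_bot_iff]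
    rintro ⟨v, hv⟩ h0
    have h1 : ∀ i, ρ (x (s i)) v ∈ D.ker := fun i =>
      (Submodule.Quotient.mk_eq_zero _).1 (congrArg Subtype.val (congrFun h0 i))
    have h2 : v ∈ (⊥ : Submodule ℂ V) := D.pair.mem_of_translates (M := m) (by simp) (by simp)
      (fun t ht => hv.2 _ (hM t (padicBall_anti (by omega) ht)))
      (fun t ht => hv.2 _ (hR t (padicBall_anti (by omega) ht)))
      (fun i hi => by
        rw [bot_sup_eq]
        exact h1 ⟨i, hi⟩)
    exact Subtype.ext (by simpa using h2)

end StabilizerData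

end Reduction

/-! ### Groups with a central series by one-parameter groups -/

section CentralSeries

variable {p : ℕ} [Fact p.Prime] {G : Type v} [Group G] [TopologicalSpace G]

/-- The common zero set of the first `k` coordinates. -/
def layer (c : ℕ → G → ℚ_[p]) (k : ℕ) : Set G := {x | ∀ j < k, c j x = 0}

/-- A system of coordinates `c 0, …, c (d - 1)` on the topological group `G` such that `c k` is
additive and invariant under conjugation on the common zero set of the previous coordinates, in a
group all of whose elements lie on continuous one-parameter subgroups. -/
structure CentralCoords (c : ℕ → G → ℚ_[p]) (d : ℕ) : Prop where
  cont : ∀ k, Continuous (c k)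
  mul : ∀ k, ∀ x ∈ layer c k, ∀ y ∈ layer c k, c k (x * y) = c k x + c k y
  conj : ∀ k g, ∀ x ∈ layer c k, c k (g * x * g⁻¹) = c k x
  eq_one : ∀ x ∈ layer c d, x = 1
  oneParam : ∀ g : G, ∃ φ : AddChar ℚ_[p] G, Continuous φ ∧ φ 1 = g

theorem mem_layer_succ {c : ℕ → G → ℚ_[p]} {k : ℕ} {x : G} :
    x ∈ layer c (k + 1) ↔ x ∈ layer c k ∧ c k x = 0 := by
  constructor
  · exact fun h => ⟨fun j hj => h j (by omega), h k (by omega)⟩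
  · rintro ⟨h1, h2⟩ j hj
    rcases Nat.lt_succ_iff_lt_or_eq.1 hj with h | rfl
    exacts [h1 j h, h2]

theorem layer_anti {c : ℕ → G → ℚ_[p]} {k l : ℕ} (h : k ≤ l) : layer c l ⊆ layer c k :=
  fun _ hx j hj => hx j (by omega)

/-- A continuous additive endomorphism of `ℚ_p` is linear. -/
theorem padic_additive_linear {f : ℚ_[p] → ℚ_[p]} (hf : Continuous f)
    (hadd : ∀ s t, f (s + t) = f s + f t) (t : ℚ_[p]) : f t = t * f 1 := by
  have hp := prime_cast_ne_zero (p := p)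
  let F : ℚ_[p] →+ ℚ_[p] := AddMonoidHom.mk' f hadd
  have hnat : ∀ (n : ℕ) s, f (n * s) = n * f s := fun n s => by
    have := map_nsmul F n s
    rwa [nsmul_eq_mul, nsmul_eq_mul] at this
  have hint : ∀ z : ℤ_[p], f z = z * f 1 := by
    have h1 : (fun z : ℤ_[p] => f z) = fun z : ℤ_[p] => (z : ℚ_[p]) * f 1 := by
      refine PadicInt.denseRange_natCast.equalizer (by fun_prop) (by fun_prop) ?_
      funext n
      simpa using hnat n 1
    exact fun z => congrFun h1 z
  obtain ⟨m, hm⟩ := exists_mem_padicBall t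
  have h1 : t * (p : ℚ_[p]) ^ (m : ℤ) ∈ padicBall p 0 := by
    simpa using mul_mem_padicBall (hm (-m) le_rfl) (zpow_mem_padicBall (p := p) (m : ℤ))
  have h2 := hint ⟨t * (p : ℚ_[p]) ^ (m : ℤ), by simpa [mem_padicBall] using h1⟩
  have h3 := hnat (p ^ m) t
  simp only [zpow_natCast] at h2
  push_cast at h3
  rw [mul_comm t, h3] at h2
  have h4 : (p : ℚ_[p]) ^ m ≠ 0 := pow_ne_zero _ hp
  exact mul_left_cancel₀ h4 (by rw [h2, mul_assoc])

namespace CentralCoords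

variable {c : ℕ → G → ℚ_[p]} {d : ℕ}

theorem layer_mul (h : CentralCoords c d) {k : ℕ} {x y : G} (hx : x ∈ layer c k)
    (hy : y ∈ layer c k) : x * y ∈ layer c k := by
  intro j hj
  rw [h.mul j x (layer_anti hj.le hx) y (layer_anti hj.le hy), hx j hj, hy j hj, add_zero]

theorem layer_conj (h : CentralCoords c d) {k : ℕ} {x : G} (hx : x ∈ layer c k) (g : G) :
    g * x * g⁻¹ ∈ layer c k := by
  intro j hj
  rw [h.conj j g x (layer_anti hj.le hx), hx j hj]

theorem oneParam_linear (h : CentralCoords c d) {φ : AddChar ℚ_[p] G} (hφ : Continuous φ) {k : ℕ}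
    (hφk : ∀ t, φ t ∈ layer c k) (t : ℚ_[p]) : c k (φ t) = t * c k (φ 1) := by
  refine padic_additive_linear (f := fun t => c k (φ t)) ((h.cont k).comp hφ) (fun s t => ?_) t
  rw [AddChar.map_add_eq_mul, h.mul k _ (hφk s) _ (hφk t)]

/-- On a line in layer `k` the coordinate `c k` is additive and continuous, hence linear, so
vanishing at `1` forces vanishing everywhere. -/
theorem oneParam_mem_layer (h : CentralCoords c d) {φ : AddChar ℚ_[p] G} (hφ : Continuous φ)
    {k : ℕ} (h1 : φ 1 ∈ layer c k) (t : ℚ_[p]) : φ t ∈ layer c k := by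
  induction k generalizing t with
  | zero => exact fun j hj => absurd hj (by omega)
  | succ k ih =>
    rw [mem_layer_succ] at h1 ⊢
    have h2 := ih h1.1
    refine ⟨h2 t, ?_⟩
    rw [h.oneParam_linear hφ h2, h1.2, mul_zero]

theorem comm_mem_layer (h : CentralCoords c d) {φ : AddChar ℚ_[p] G} (hφ : Continuous φ)
    {k : ℕ} (h1 : φ 1 ∈ layer c k) (g : G) (t : ℚ_[p]) :
    g * φ t * g⁻¹ * φ (-t) ∈ layer c (k + 1) := by
  have h2 := fun t => h.oneParam_mem_layer hφ h1 t
  have h3 := h.layer_conj (h2 t) g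
  rw [mem_layer_succ]
  refine ⟨h.layer_mul h3 (h2 _), ?_⟩
  rw [h.mul k _ h3 _ (h2 _), h.conj k g _ (h2 t), h.oneParam_linear hφ h2,
    h.oneParam_linear hφ h2 (-t)]
  ring

/-- The number of coordinates that do not vanish on their layer. -/
def rank (c : ℕ → G → ℚ_[p]) (d : ℕ) : ℕ := by
  classical
  exact ((Finset.range d).filter fun k => ∃ x ∈ layer c k, c k x ≠ 0).card

/-- Restriction to a subgroup that contains one-parameter subgroups through its elements. -/
theorem restrict (h : CentralCoords c d) (N : Subgroup G)
    (hN : ∀ φ : AddChar ℚ_[p] G, Continuous φ → φ 1 ∈ N → ∀ t, φ t ∈ N) :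
    CentralCoords (fun k (x : N) => c k x) d where
  cont k := (h.cont k).comp continuous_subtype_val
  mul k x hx y hy := h.mul k x hx y hy
  conj k g x hx := h.conj k g x hx
  eq_one x hx := Subtype.ext (h.eq_one x hx)
  oneParam g := by
    obtain ⟨φ, hφ, hφ1⟩ := h.oneParam g
    have h1 := hN φ hφ (hφ1 ▸ g.2)
    exact ⟨⟨fun t => ⟨φ t, h1 t⟩, Subtype.ext φ.map_zero_eq_one,
      fun s t => Subtype.ext (φ.map_add_eq_mul s t)⟩, hφ.subtype_mk _, Subtype.ext hφ1⟩

/-- Take the first layer contained in `N` and the coordinate `c i` just before it. If `c i` were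
nonzero at some `n ∈ N` of layer `i`, any `x` of layer `i` could be moved into layer `i + 1 ⊆ N` by
a point of the line through `n`, so layer `i` would already lie in `N`. -/
theorem rank_lt (h : CentralCoords c d) {N : Subgroup G}
    (hN : ∀ φ : AddChar ℚ_[p] G, Continuous φ → φ 1 ∈ N → ∀ t, φ t ∈ N) (hN' : N ≠ ⊤) :
    rank (fun k (x : N) => c k x) d < rank c d := by
  classical
  have hex : ∃ k, layer c k ⊆ N := ⟨d, fun x hx => by
    rw [h.eq_one x hx]
    exact N.one_mem⟩
  have hk := Nat.find_spec hex
  set k := Nat.find hex with hkdef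
  have hkd : k ≤ d := Nat.find_min' hex fun x hx => by
    rw [h.eq_one x hx]
    exact N.one_mem
  have hk0 : k ≠ 0 := by
    intro h0
    rw [h0] at hk
    exact hN' (eq_top_iff.2 fun x _ => hk fun j hj => absurd hj (by omega))
  obtain ⟨i, hi⟩ := Nat.exists_eq_succ_of_ne_zero hk0
  have hmin := Nat.find_min hex (m := i) (by omega)
  rw [Set.not_subset] at hmin
  obtain ⟨x, hx, hxN⟩ := hmin
  rw [hi] at hk
  have hcx : c i x ≠ 0 := fun h0 => hxN (hk (mem_layer_succ.2 ⟨hx, h0⟩))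
  unfold rank
  refine Finset.card_lt_card ⟨fun j hj => ?_, fun hsub => ?_⟩
  · simp only [Finset.mem_filter] at hj ⊢
    obtain ⟨hj, y, hy, hy0⟩ := hj
    exact ⟨hj, y, hy, hy0⟩
  · have h1 : i ∈ (Finset.range d).filter fun k => ∃ x ∈ layer c k, c k x ≠ 0 := by
      simp only [Finset.mem_filter, Finset.mem_range]
      exact ⟨by omega, x, hx, hcx⟩
    have h2 := hsub h1
    simp only [Finset.mem_filter] at h2
    obtain ⟨-, n, hn, hn0⟩ := h2
    obtain ⟨φ, hφ, hφ1⟩ := h.oneParam n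
    have h3 := hN φ hφ (hφ1 ▸ n.2)
    have h4 := h.oneParam_mem_layer hφ (k := i) (hφ1 ▸ hn)
    refine hxN ?_
    have h5 : x * φ (-(c i x / c i n)) ∈ N := by
      refine hk (mem_layer_succ.2 ⟨h.layer_mul hx (h4 _), ?_⟩)
      rw [h.mul i x hx _ (h4 _), h.oneParam_linear hφ h4, hφ1]
      have hn0' : c i n ≠ 0 := hn0
      field_simp
      ring
    exact (Subgroup.mul_mem_cancel_right N (h3 _)).1 h5

end CentralCoords

/-! ### The structure theorem for prime representations -/

section Structure

variable [IsTopologicalGroup G] {V : Type u} [AddCommGroup V] [Module ℂ V]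

theorem exists_eigenvector_of_pow {T : Module.End ℂ V} {v : V} (hv : v ≠ 0) {n : ℕ} (hn : 0 < n)
    (h : (T ^ n) v = v) : ∃ μ : ℂ, ∃ w ≠ 0, T w = μ • w := by
  let U : Submodule ℂ V := Submodule.span ℂ ((fun i => (T ^ i) v) '' (Finset.range n : Set ℕ))
  have hmem : ∀ i < n, (T ^ i) v ∈ U := fun i hi =>
    Submodule.subset_span ⟨i, by simpa using hi, rfl⟩
  have hU : ∀ u ∈ U, T u ∈ U := by
    intro u hu
    induction hu using Submodule.span_induction with
    | mem u h' =>
      obtain ⟨i, hi, rfl⟩ := h'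
      have hi : i < n := by simpa using hi
      have h2 : T ((T ^ i) v) = (T ^ (i + 1)) v := by rw [pow_succ', Module.End.mul_apply]
      change T ((T ^ i) v) ∈ U
      rw [h2]
      rcases Nat.lt_or_ge (i + 1) n with h3 | h3
      · exact hmem _ h3
      · rw [show i + 1 = n by omega, h]
        simpa using hmem 0 hn
    | zero => simp
    | add x y _ _ hx hy =>
      rw [map_add]
      exact U.add_mem hx hy
    | smul a x _ hx =>
      rw [map_smul]
      exact U.smul_mem a hx
  have : FiniteDimensional ℂ U := FiniteDimensional.span_of_finite ℂ (Set.toFinite _)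
  have : Nontrivial U := ⟨⟨v, by simpa using hmem 0 hn⟩, 0, fun h0 => hv (congrArg Subtype.val h0)⟩
  obtain ⟨μ, hμ⟩ := Module.End.exists_eigenvalue (T.restrict hU)
  obtain ⟨w, hw⟩ := hμ.exists_hasEigenvector
  exact ⟨μ, w, fun h0 => hw.2 (Subtype.ext h0), congrArg Subtype.val hw.apply_eq_smul⟩

/-- Schur's lemma. -/
theorem IsPrimeRep.exists_scalar {ρ : Representation ℂ G V} (h : IsPrimeRep ρ)
    (hs : IsSmoothRep ρ) {φ : AddChar ℚ_[p] G} (hφ : Continuous φ)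
    (hc : ∀ g v, ρ g (ρ (φ 1) v) = ρ (φ 1) (ρ g v)) : ∃ μ : ℂ, ∀ v, ρ (φ 1) v = μ • v := by
  have := h.1
  obtain ⟨v, hv⟩ := exists_ne (0 : V)
  obtain ⟨M, hM⟩ := smoothChar_oneParam hs hφ v
  -- Smoothness along `φ` makes the operator of finite order on `v`. This yields an eigenvector
  -- without any countability or finiteness assumption; primeness spreads the eigenvalue to all of
  -- `V`.
  have h1 : (ρ (φ 1) ^ p ^ M) v = v := by
    have := hM ((p ^ M : ℕ) : ℚ_[p]) (by
      push_cast
      exact_mod_cast zpow_mem_padicBall (p := p) (M : ℤ))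
    rwa [← mul_one ((p ^ M : ℕ) : ℚ_[p]), AddChar.map_natCast_mul] at this
  obtain ⟨μ, w, hw, hw'⟩ := exists_eigenvector_of_pow hv (pow_pos (Fact.out : p.Prime).pos M) h1
  refine ⟨μ, fun v => ?_⟩
  let W : Submodule ℂ V := LinearMap.ker (ρ (φ 1) - μ • ρ 1)
  have hW : ∀ v, v ∈ W ↔ ρ (φ 1) v = μ • v := fun v => by
    simp [W, LinearMap.mem_ker, sub_eq_zero]
  have hT : ρ (φ 1) - μ • ρ 1 ∈ Submodule.span ℂ (Set.range ρ) :=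
    Submodule.sub_mem _ (Submodule.subset_span ⟨_, rfl⟩)
      (Submodule.smul_mem _ _ (Submodule.subset_span ⟨_, rfl⟩))
  refine (hW v).1 (LinearMap.mem_ker.2 (h.eq_zero hs hT (W := W) ?_ ?_ (fun w hw => hw) v))
  · intro g u hu
    rw [hW] at hu ⊢
    rw [← hc, hu, map_smul]
  · exact (Submodule.ne_bot_iff _).2 ⟨w, (hW w).2 hw', hw⟩

variable {c : ℕ → G → ℚ_[p]} {d : ℕ}

/-- A prime representation by scalars contains an invariant line. -/
theorem hasAdmissibleIrr_of_scalar {ρ : Representation ℂ G V} [Nontrivial V]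
    (h : ∀ g, ∃ μ : ℂ, ∀ v, ρ g v = μ • v) : HasAdmissibleIrr ρ := by
  obtain ⟨v, hv⟩ := exists_ne (0 : V)
  refine ⟨Submodule.span ℂ {v}, fun g w hw => ?_, ?_, fun U hU _ hU0 => ?_, fun K _ => ?_⟩
  · obtain ⟨μ, hμ⟩ := h g
    rw [hμ]
    exact Submodule.smul_mem _ _ hw
  · simpa using hv
  · refine le_antisymm hU ?_
    obtain ⟨u, hu, hu0⟩ := Submodule.exists_mem_ne_zero_of_ne_bot hU0
    obtain ⟨a, rfl⟩ := Submodule.mem_span_singleton.1 (hU hu)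
    rw [Submodule.span_singleton_le_iff_mem]
    have ha : a ≠ 0 := fun h0 => hu0 (by rw [h0, zero_smul])
    exact (Submodule.smul_mem_iff _ ha).1 hu
  · exact Submodule.finiteDimensional_of_le inf_le_left

/-- The commutator pairing of `G` with a one-parameter subgroup that is central up to scalars. -/
structure CommPairing (ρ : Representation ℂ G V) (φ : AddChar ℚ_[p] G) (b : G → ℚ_[p] → ℂ) :
    Prop where
  smooth : IsSmoothRep ρ
  nontrivial : Nontrivial V
  cont : Continuous φ
  comm : ∀ g t v, ρ g (ρ (φ t) v) = b g t • ρ (φ t) (ρ g v)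

namespace CommPairing

variable {ρ : Representation ℂ G V} {φ : AddChar ℚ_[p] G} {b : G → ℚ_[p] → ℂ}

theorem eq_of_apply (P : CommPairing ρ φ b) {g : G} {t : ℚ_[p]} {a : ℂ}
    {v : V} (hv : v ≠ 0) (h : ρ g (ρ (φ t) v) = a • ρ (φ t) (ρ g v)) : b g t = a := by
  rw [P.comm] at h
  have h1 : ρ (φ t) (ρ g v) ≠ 0 := by
    intro h0
    have h2 := congrArg (fun w => ρ g⁻¹ (ρ (φ t)⁻¹ w)) h0
    simp only [rep_inv_apply, map_zero] at h2
    exact hv h2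
  exact smul_left_injective ℂ h1 h

theorem mul_left (P : CommPairing ρ φ b) (g h : G) (t : ℚ_[p]) :
    b (g * h) t = b g t * b h t := by
  have := P.nontrivial
  obtain ⟨v, hv⟩ := exists_ne (0 : V)
  refine P.eq_of_apply hv ?_
  rw [rep_mul, P.comm h, map_smul, P.comm g, rep_mul, smul_smul, mul_comm]

theorem one_left (P : CommPairing ρ φ b) (t : ℚ_[p]) : b 1 t = 1 := by
  have := P.nontrivial
  obtain ⟨v, hv⟩ := exists_ne (0 : V)
  exact P.eq_of_apply hv (by simp)

theorem add_right (P : CommPairing ρ φ b) (g : G) (s t : ℚ_[p]) :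
    b g (s + t) = b g s * b g t := by
  have := P.nontrivial
  obtain ⟨v, hv⟩ := exists_ne (0 : V)
  refine P.eq_of_apply hv ?_
  rw [AddChar.map_add_eq_mul, rep_mul, P.comm, P.comm g t, map_smul, smul_smul, rep_mul]

theorem zero_right (P : CommPairing ρ φ b) (g : G) : b g 0 = 1 := by
  have := P.nontrivial
  obtain ⟨v, hv⟩ := exists_ne (0 : V)
  exact P.eq_of_apply hv (by simp)

/-- The pairing with a fixed group element, as a character. -/
def right (P : CommPairing ρ φ b) (g : G) : AddChar ℚ_[p] ℂ where
  toFun := b g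
  map_zero_eq_one' := P.zero_right g
  map_add_eq_mul' := P.add_right g

/-- The pairing with a fixed parameter, along a one-parameter subgroup, as a character. -/
def left (P : CommPairing ρ φ b) (x : AddChar ℚ_[p] G) (t : ℚ_[p]) : AddChar ℚ_[p] ℂ where
  toFun s := b (x s) t
  map_zero_eq_one' := by rw [AddChar.map_zero_eq_one, P.one_left]
  map_add_eq_mul' r s := by rw [AddChar.map_add_eq_mul, P.mul_left]

theorem smooth_right (P : CommPairing ρ φ b) (g : G) :
    ∃ M : ℕ, ∀ t ∈ padicBall p M, b g t = 1 := by
  have := P.nontrivial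
  obtain ⟨v, hv⟩ := exists_ne (0 : V)
  obtain ⟨M, hM⟩ := smoothChar_oneParam P.smooth P.cont v
  obtain ⟨R, hR⟩ := smoothChar_oneParam P.smooth P.cont (ρ g v)
  refine ⟨max M R, fun t ht => P.eq_of_apply hv ?_⟩
  have h1 := hM t (padicBall_anti (by omega) ht)
  have h2 := hR t (padicBall_anti (by omega) ht)
  rw [oneParamRep_apply] at h1 h2
  rw [h1, h2, one_smul]

theorem smooth_left (P : CommPairing ρ φ b) (t : ℚ_[p]) :
    ∃ K : Subgroup G, IsOpen (K : Set G) ∧ ∀ g ∈ K, b g t = 1 := by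
  have := P.nontrivial
  obtain ⟨v, hv⟩ := exists_ne (0 : V)
  obtain ⟨K, hK, -, hKv⟩ := P.smooth v
  obtain ⟨L, hL, -, hLv⟩ := P.smooth (ρ (φ t) v)
  refine ⟨K ⊓ L, hK.inter hL, fun g hg => P.eq_of_apply hv ?_⟩
  rw [hKv g hg.1, hLv g hg.2, one_smul]

/-- The pairing is bilinear over `ℚ_p` along one-parameter subgroups. -/
theorem bilinear (P : CommPairing ρ φ b) {x : AddChar ℚ_[p] G} (hx : Continuous x) (s t : ℚ_[p]) :
    b (x s) t = b (x 1) (s * t) := by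
  have hp := prime_cast_ne_zero (p := p)
  obtain ⟨K, hK, hKt⟩ := P.smooth_left t
  obtain ⟨M, hM⟩ := exists_ball_oneParam hx hK
  obtain ⟨R, hR⟩ := P.smooth_right (x 1)
  obtain ⟨a, ha⟩ := exists_mem_padicBall s
  obtain ⟨e, he⟩ := exists_mem_padicBall t
  -- Large enough that `s` is a multiple of `q = p ^ (-m)` up to an error `r` with both `b (x r) t`
  -- and `b (x 1) (r * t)` trivial.
  set m := max (max M (R + e)) a with hm
  obtain ⟨j, -, hj⟩ := exists_nat_approx m (ha (-m) (by omega))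
  set q := (p : ℚ_[p]) ^ (-m : ℤ) with hq
  obtain ⟨r, hr⟩ : ∃ r, s = j * q + r := ⟨s - j * q, by ring⟩
  rw [hr, add_sub_cancel_left] at hj
  subst hr
  have h1 : b (x r) t = 1 := hKt _ (hM r (padicBall_anti (by omega) hj))
  have h2 : b (x 1) (r * t) = 1 := by
    refine hR _ ?_
    exact padicBall_anti (by omega) (mul_mem_padicBall hj (he (-e) le_rfl))
  have hqt : t = (p ^ m : ℕ) * (q * t) := by
    rw [hq]
    push_cast
    rw [← mul_assoc, ← zpow_natCast, ← zpow_add₀ hp]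
    simp
  -- Integers move freely between the two arguments. Writing `t = p ^ m * (q * t)` and moving `p ^
  -- m` to the left turns `q` into `1`, with no need to divide.
  have h3 : b (x q) t = b (x 1) (q * t) := by
    have h4 : b (x q) ((p ^ m : ℕ) * (q * t)) = b (x q) (q * t) ^ p ^ m :=
      (P.right (x q)).map_natCast_mul (p ^ m) (q * t)
    have h5 : b (x ((p ^ m : ℕ) * q)) (q * t) = b (x q) (q * t) ^ p ^ m :=
      (P.left x (q * t)).map_natCast_mul (p ^ m) q
    rw [hqt, h4, ← h5, ← hqt]
    congr 2
    rw [hq]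
    push_cast
    rw [← zpow_natCast, ← zpow_add₀ hp]
    simp
  have h6 : b (x (j * q)) t = b (x q) t ^ j := (P.left x t).map_natCast_mul j q
  have h7 : b (x 1) (j * (q * t)) = b (x 1) (q * t) ^ j :=
    (P.right (x 1)).map_natCast_mul j (q * t)
  rw [AddChar.map_add_eq_mul, P.mul_left, h1, add_mul, P.add_right, h2, h6, h3, mul_assoc, h7]

/-- The group elements that commute with the one-parameter subgroup. -/
def stabilizer (P : CommPairing ρ φ b) : Subgroup G where
  carrier := {g | ∀ t, b g t = 1}
  one_mem' := P.one_left
  mul_mem' {g h} hg hh t := by rw [P.mul_left, hg t, hh t, one_mul]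
  inv_mem' {g} hg t := by
    have := P.mul_left g⁻¹ g t
    rwa [inv_mul_cancel, P.one_left, hg t, mul_one, eq_comm] at this

theorem mem_stabilizer (P : CommPairing ρ φ b) {g : G} :
    g ∈ P.stabilizer ↔ ∀ t, b g t = 1 := Iff.rfl

/-- For each `t` the condition defines an open, hence closed, subgroup. -/
theorem isClosed_stabilizer (P : CommPairing ρ φ b) : IsClosed (P.stabilizer : Set G) := by
  have h1 : (P.stabilizer : Set G) = ⋂ t, {g | b g t = 1} := by
    ext g
    simp [mem_stabilizer]
  rw [h1]
  refine isClosed_iInter fun t => ?_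
  let N : Subgroup G :=
    { carrier := {g | b g t = 1}
      one_mem' := P.one_left t
      mul_mem' := fun {g h} (hg : b g t = 1) (hh : b h t = 1) => by
        change b (g * h) t = 1
        rw [P.mul_left, hg, hh, one_mul]
      inv_mem' := fun {g} (hg : b g t = 1) => by
        have := P.mul_left g⁻¹ g t
        rwa [inv_mul_cancel, P.one_left, hg, mul_one, eq_comm] at this }
  obtain ⟨K, hK, hKt⟩ := P.smooth_left t
  have hN : IsOpen (N : Set G) := Subgroup.isOpen_mono (H₁ := K) (H₂ := N) hKt hK
  exact Subgroup.isClosed_of_isOpen N hN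

theorem oneParam_mem_stabilizer (P : CommPairing ρ φ b) {x : AddChar ℚ_[p] G} (hx : Continuous x)
    (h1 : x 1 ∈ P.stabilizer) (s : ℚ_[p]) : x s ∈ P.stabilizer := by
  intro t
  rw [P.bilinear hx]
  exact h1 _

/-- Rescaling `x` makes its pairing with `φ` a normalized character `χ (s * t)`. By self-duality
every `b g` is `χ (w * ·)`, so `g * x' (-w)` lies in the stabilizer: the line `x'` is a complement.
-/
theorem exists_stabilizerData (P : CommPairing ρ φ b) {x : AddChar ℚ_[p] G} (hx : Continuous x)
    (h1 : x 1 ∉ P.stabilizer) :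
    ∃ χ x', StabilizerData ρ P.stabilizer χ φ x' := by
  obtain ⟨M, hM⟩ := P.smooth_right (x 1)
  obtain ⟨u, hu, hχ⟩ := exists_normalized (θ := P.right (x 1)) (M := M) hM
    (not_forall.1 h1)
  have hχ' : ∀ t, (P.right (x 1)).compAddMonoidHom (AddMonoidHom.mulLeft u) t = b (x 1) (u * t) :=
    fun t => rfl
  set χ := (P.right (x 1)).compAddMonoidHom (AddMonoidHom.mulLeft u) with hχdef
  let x' : AddChar ℚ_[p] G := x.compAddMonoidHom (AddMonoidHom.mulLeft u)
  have hx' : Continuous x' := hx.comp (continuous_const_mul u)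
  have hbx : ∀ s t, b (x' s) t = χ (s * t) := fun s t => by
    rw [hχ', ← mul_assoc, ← P.bilinear hx]
    rfl
  refine ⟨χ, x', P.smooth, P.isClosed_stabilizer, P.cont, hx', ⟨hχ, smoothChar_oneParam P.smooth
    P.cont, smoothChar_oneParam P.smooth hx', fun s t v => ?_⟩, fun n hn t v => ?_, fun g => ?_⟩
  · rw [oneParamRep_apply, oneParamRep_apply, P.comm, hbx]
  · rw [P.comm, hn t, one_smul]
  · obtain ⟨R, hR⟩ := P.smooth_right g
    obtain ⟨w, hw⟩ := hχ.exists_eq_mul (θ := P.right g) (M := R) hR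
    refine ⟨g * x' (-w), fun t => ?_, w, ?_⟩
    · have h2 : b g t = χ (w * t) := hw t
      rw [P.mul_left, hbx, h2, ← AddChar.map_add_eq_mul]
      rw [neg_mul, add_neg_cancel, AddChar.map_zero_eq_one]
    · rw [mul_assoc, ← AddChar.map_add_eq_mul, neg_add_cancel, AddChar.map_zero_eq_one, mul_one]

end CommPairing

/-- Layer `i` is the last one not acting by scalars, and `φ` passes through a nonscalar element of
it. Commutators with `φ` drop to layer `i + 1`; if all were trivial, Schur's lemma would make `φ 1`
scalar. -/
theorem CentralCoords.exists_commPairing (h : CentralCoords c d) {ρ : Representation ℂ G V}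
    (hs : IsSmoothRep ρ) (hρ : IsPrimeRep ρ) (hsc : ¬ ∀ g, ∃ μ : ℂ, ∀ v, ρ g v = μ • v) :
    ∃ (φ : AddChar ℚ_[p] G) (b : G → ℚ_[p] → ℂ) (P : CommPairing ρ φ b), P.stabilizer ≠ ⊤ := by
  classical
  have hex : ∃ k, ∀ g ∈ layer c k, ∃ μ : ℂ, ∀ v, ρ g v = μ • v := ⟨d, fun x hx => by
    rw [h.eq_one x hx]
    exact ⟨1, by simp⟩⟩
  have hk := Nat.find_spec hex
  set k := Nat.find hex with hkdef
  have hk0 : k ≠ 0 := by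
    intro h0
    rw [h0] at hk
    exact hsc fun g => hk g fun j hj => absurd hj (by omega)
  obtain ⟨i, hi⟩ := Nat.exists_eq_succ_of_ne_zero hk0
  have hmin := Nat.find_min hex (m := i) (by omega)
  push Not at hmin
  obtain ⟨y, hy, hy'⟩ := hmin
  rw [hi] at hk
  obtain ⟨φ, hφ, rfl⟩ := h.oneParam y
  choose b hb using fun g t => hk _ (h.comm_mem_layer hφ hy g t)
  have P : CommPairing ρ φ b := ⟨hs, hρ.1, hφ, fun g t v => by
    rw [← hb g t, ← rep_mul, ← rep_mul, ← rep_mul, AddChar.map_neg_eq_inv]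
    congr 2
    group⟩
  refine ⟨φ, b, P, fun htop => ?_⟩
  obtain ⟨μ, hμ⟩ := hρ.exists_scalar hs hφ fun g v => by
    have : g ∈ P.stabilizer := htop ▸ Subgroup.mem_top g
    rw [P.comm, this 1, one_smul]
  obtain ⟨v, hv⟩ := hy' μ
  exact hv (hμ v)

end Structure

/-- A prime smooth representation of a group with central coordinates contains an irreducible
admissible subrepresentation. -/
theorem CentralCoords.hasAdmissibleIrr (n : ℕ) : ∀ {G : Type v} [Group G] [TopologicalSpace G]
    [IsTopologicalGroup G] {c : ℕ → G → ℚ_[p]} {d : ℕ}, CentralCoords c d → rank c d = n →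
    ∀ {V : Type u} [AddCommGroup V] [Module ℂ V] {ρ : Representation ℂ G V},
    IsSmoothRep ρ → IsPrimeRep ρ → HasAdmissibleIrr ρ := by
  induction n using Nat.strong_induction_on with
  | _ n ih =>
    intro G _ _ _ c d h hn V _ _ ρ hs hρ
    have := hρ.1
    by_cases hsc : ∀ g, ∃ μ : ℂ, ∀ v, ρ g v = μ • v
    · exact hasAdmissibleIrr_of_scalar hsc
    · obtain ⟨φ, b, P, hP⟩ := h.exists_commPairing hs hρ hsc
      obtain ⟨g, hg⟩ : ∃ g, g ∉ P.stabilizer := by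
        by_contra! h'
        exact hP (eq_top_iff.2 fun g _ => h' g)
      obtain ⟨x, hx, rfl⟩ := h.oneParam g
      obtain ⟨χ, x', D⟩ := P.exists_stabilizerData hx hg
      have hN : ∀ φ : AddChar ℚ_[p] G, Continuous φ → φ 1 ∈ P.stabilizer → ∀ t, φ t ∈ P.stabilizer :=
        fun φ hφ h1 t => P.oneParam_mem_stabilizer hφ h1 t
      refine D.hasAdmissibleIrr ?_
      exact ih _ (hn ▸ h.rank_lt hN hP) (h.restrict _ hN) rfl D.smooth_rep (D.prime_rep hρ)

end CentralSeries

/-! ### Points of unipotent groups -/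

/-- A neighbourhood basis of the identity and exhaustion by compact open subgroups. -/
structure CompactOpenFiltration {G : Type v} [Group G] [TopologicalSpace G]
    (K : ℤ → Subgroup G) : Prop where
  isOpen : ∀ r, IsOpen (K r : Set G)
  isCompact : ∀ r, IsCompact (K r : Set G)
  mono : Monotone K
  exhaust : ∀ x, ∃ r, x ∈ K r
  basis : ∀ U ∈ nhds (1 : G), ∃ r, (K r : Set G) ⊆ U

section Unipotent

open Polynomial

variable {p : ℕ} [Fact p.Prime] {A : Type v} [CommRing A] [HopfAlgebra ℚ A] {n : ℕ}

/-- The matrix `M` is a closed embedding of the group scheme into the unitriangular group. -/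
structure IsUnitriangularEmbedding (M : Matrix (Fin n) (Fin n) A) : Prop where
  diag : ∀ i, M i i = 1
  lower : ∀ i j, j < i → M i j = 0
  comul : ∀ i j, Coalgebra.comul (R := ℚ) (M i j) = ∑ l, M i l ⊗ₜ[ℚ] M l j
  counit : ∀ i j, Coalgebra.counit (R := ℚ) (M i j) = if i = j then 1 else 0
  adjoin : Algebra.adjoin ℚ (Set.range fun ij : Fin n × Fin n => M ij.1 ij.2) = ⊤

variable {M : Matrix (Fin n) (Fin n) A}

/-- The unitriangular matrix of a point. -/
def pointMatrix (M : Matrix (Fin n) (Fin n) A) (x : QpPoints p A) : Matrix (Fin n) (Fin n) ℚ_[p] :=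
  fun i j => x.ofConv (M i j)

namespace IsUnitriangularEmbedding

theorem induction (hM : IsUnitriangularEmbedding M) {P : A → Prop} (mem : ∀ i j, P (M i j))
    (algebraMap : ∀ r : ℚ, P (algebraMap ℚ A r)) (add : ∀ a b, P a → P b → P (a + b))
    (mul : ∀ a b, P a → P b → P (a * b)) (a : A) : P a := by
  have ha : a ∈ Algebra.adjoin ℚ (Set.range fun ij : Fin n × Fin n => M ij.1 ij.2) :=
    hM.adjoin ▸ Algebra.mem_top
  induction ha using Algebra.adjoin_induction with
  | mem x hx =>
    obtain ⟨ij, rfl⟩ := hx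
    exact mem _ _
  | algebraMap r => exact algebraMap r
  | add x y _ _ hx hy => exact add x y hx hy
  | mul x y _ _ hx hy => exact mul x y hx hy

theorem matrix_mul (hM : IsUnitriangularEmbedding M) (x y : QpPoints p A) :
    pointMatrix M (x * y) = pointMatrix M x * pointMatrix M y := by
  ext i j
  have h1 := AlgHom.convMul_apply x y (M i j)
  rw [hM.comul, map_sum] at h1
  simpa [Matrix.mul_apply, pointMatrix] using h1

theorem matrix_one (hM : IsUnitriangularEmbedding M) :
    pointMatrix M (1 : QpPoints p A) = 1 := by
  ext i j
  have h1 : (1 : QpPoints p A).ofConv (M i j) = algebraMap ℚ ℚ_[p] (Coalgebra.counit (M i j)) := rfl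
  rw [hM.counit] at h1
  rw [pointMatrix, h1, Matrix.one_apply]
  split_ifs <;> simp

theorem matrix_pow (hM : IsUnitriangularEmbedding M) (x : QpPoints p A) (m : ℕ) :
    pointMatrix M (x ^ m) = pointMatrix M x ^ m := by
  induction m with
  | zero => rw [pow_zero, pow_zero, hM.matrix_one]
  | succ m ih => rw [pow_succ, pow_succ, hM.matrix_mul, ih]

theorem matrix_injective (hM : IsUnitriangularEmbedding M) {x y : QpPoints p A}
    (h : pointMatrix M x = pointMatrix M y) : x = y := by
  refine WithConv.ext (AlgHom.ext_of_adjoin_eq_top hM.adjoin ?_)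
  rintro _ ⟨ij, rfl⟩
  exact congrFun (congrFun h ij.1) ij.2

theorem matrix_diag (hM : IsUnitriangularEmbedding M) (x : QpPoints p A) (i : Fin n) :
    pointMatrix M x i i = 1 := by
  rw [pointMatrix, hM.diag, map_one]

theorem matrix_lower (hM : IsUnitriangularEmbedding M) (x : QpPoints p A) {i j : Fin n}
    (h : j < i) : pointMatrix M x i j = 0 := by
  rw [pointMatrix, hM.lower i j h, map_zero]

theorem continuous_matrix (i j : Fin n) :
    Continuous fun x : QpPoints p A => pointMatrix M x i j :=
  QpPoints.continuous_eval _

/-- The entries of a point, ordered by superdiagonals. -/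
def coord (M : Matrix (Fin n) (Fin n) A) (k : ℕ) (x : QpPoints p A) : ℚ_[p] :=
  -- The index `k = e * n + i` encodes the entry `(i, i + e)`. Indices that encode no entry above
  -- the diagonal get the coordinate zero, which imposes no condition on the layers.
  if h : 0 < k / n ∧ k % n + k / n < n then
    pointMatrix M x ⟨k % n, by omega⟩ ⟨k % n + k / n, h.2⟩ else 0

theorem continuous_coord (k : ℕ) : Continuous (coord (p := p) M k) := by
  unfold coord
  split_ifs with h
  · exact continuous_matrix _ _
  · exact continuous_const

theorem entry_eq_zero {k : ℕ} {x : QpPoints p A} (hx : x ∈ layer (coord M) k) {i j : Fin n}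
    (hij : i < j) (hk : (j.1 - i.1) * n + i.1 < k) : pointMatrix M x i j = 0 := by
  have h1 := hx _ hk
  have hn : 0 < n := i.pos
  have hdiv : ((j.1 - i.1) * n + i.1) / n = j.1 - i.1 := by
    rw [add_comm, Nat.add_mul_div_right _ _ hn, Nat.div_eq_of_lt i.2, zero_add]
  have hmod : ((j.1 - i.1) * n + i.1) % n = i.1 := by
    rw [add_comm, Nat.add_mul_mod_self_right, Nat.mod_eq_of_lt i.2]
  have hij' : i.1 < j.1 := hij
  have hj := j.2
  unfold coord at h1
  rw [dif_pos (by rw [hdiv, hmod]; omega)] at h1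
  convert h1 using 2
  · ext; simp [hmod]
  · ext; simp only [hdiv, hmod]; omega

/-- The intermediate terms of the matrix product are products of entries on shorter superdiagonals,
so they vanish as soon as one factor lies in the layer. The one-sided hypothesis is what yields
conjugation invariance. -/
theorem coord_mul_of (hM : IsUnitriangularEmbedding M) {k : ℕ} {x y : QpPoints p A}
    (h : x ∈ layer (coord M) k ∨ y ∈ layer (coord M) k) :
    coord M k (x * y) = coord M k x + coord M k y := by
  unfold coord
  split_ifs with hk
  · set i : Fin n := ⟨k % n, by omega⟩ with hi
    set j : Fin n := ⟨k % n + k / n, hk.2⟩ with hj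
    have hij : i < j := by
      rw [Fin.lt_def]
      simp only [hi, hj]
      omega
    have hkn : k = (k / n) * n + k % n := by
      rw [mul_comm]
      exact (Nat.div_add_mod k n).symm
    rw [hM.matrix_mul, Matrix.mul_apply, Finset.sum_eq_add i j hij.ne]
    · rw [hM.matrix_diag, hM.matrix_diag]
      ring
    · rintro l - ⟨hli, hlj⟩
      rcases lt_or_gt_of_ne hli with h1 | h1
      · rw [hM.matrix_lower x h1, zero_mul]
      rcases lt_or_gt_of_ne hlj with h2 | h2
      · have h1' : i.1 < l.1 := h1
        have h2' : l.1 < j.1 := h2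
        have hln := l.2
        simp only [hi, hj] at h1' h2'
        rcases h with h | h
        · rw [entry_eq_zero h h1, zero_mul]
          have h3 : (l.1 - i.1) + 1 ≤ k / n := by simp only [hi]; omega
          have h4 := Nat.mul_le_mul_right n h3
          simp only [hi] at h4 ⊢
          rw [add_mul, one_mul] at h4
          omega
        · rw [entry_eq_zero h h2, mul_zero]
          have h3 : (j.1 - l.1) + 1 ≤ k / n := by simp only [hj]; omega
          have h4 := Nat.mul_le_mul_right n h3
          simp only [hj] at h4 ⊢
          rw [add_mul, one_mul] at h4
          omega
      · rw [hM.matrix_lower y h2, mul_zero]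
    · simp
    · simp
  · simp

/-- Compare the coordinates of `(g * x * g⁻¹) * g = g * x`, where in each product one factor lies in
the layer. -/
theorem coord_conj (hM : IsUnitriangularEmbedding M) (g : QpPoints p A) (k : ℕ) :
    ∀ x ∈ layer (coord M) k, coord M k (g * x * g⁻¹) = coord M k x := by
  induction k using Nat.strong_induction_on with
  | _ k ih =>
    intro x hx
    have h1 : g * x * g⁻¹ ∈ layer (coord M) k := fun j hj => by
      rw [ih j hj x (layer_anti hj.le hx), hx j hj]
    have h2 := hM.coord_mul_of (x := g * x * g⁻¹) (y := g) (Or.inl h1)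
    rw [inv_mul_cancel_right, hM.coord_mul_of (x := g) (y := x) (Or.inr hx), add_comm] at h2
    exact (add_right_cancel h2).symm

theorem eq_one_of_layer (hM : IsUnitriangularEmbedding M) {x : QpPoints p A}
    (hx : x ∈ layer (coord M) (n * n)) : x = 1 := by
  refine hM.matrix_injective ?_
  rw [hM.matrix_one]
  ext i j
  rcases lt_trichotomy i j with h | rfl | h
  · rw [Matrix.one_apply_ne h.ne]
    refine entry_eq_zero hx h ?_
    have h1 : j.1 - i.1 + 1 ≤ n := by have := j.2; omega
    have h2 := Nat.mul_le_mul_right n h1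
    have h3 := i.2
    rw [add_mul, one_mul] at h2
    omega
  · rw [hM.matrix_diag, Matrix.one_apply_eq]
  · rw [hM.matrix_lower x h, Matrix.one_apply_ne h.ne']

theorem nilpotent_pow (hM : IsUnitriangularEmbedding M) (x : QpPoints p A) (k : ℕ) (i j : Fin n)
    (h : j.1 < i.1 + k) : ((pointMatrix M x - 1) ^ k) i j = 0 := by
  induction k generalizing j with
  | zero => rw [pow_zero, Matrix.one_apply_ne (by rintro rfl; omega)]
  | succ k ih =>
    rw [pow_succ, Matrix.mul_apply]
    refine Finset.sum_eq_zero fun l _ => ?_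
    rcases lt_or_ge l.1 (i.1 + k) with h1 | h1
    · rw [ih l h1, zero_mul]
    · have h2 : (pointMatrix M x - 1) l j = 0 := by
        rw [Matrix.sub_apply]
        rcases lt_or_eq_of_le (show j ≤ l by rw [Fin.le_def]; omega) with h3 | rfl
        · rw [hM.matrix_lower x h3, Matrix.one_apply_ne h3.ne', sub_zero]
        · rw [hM.matrix_diag, Matrix.one_apply_eq, sub_self]
      rw [h2, mul_zero]

/-- The binomial expansion, cut off by nilpotency at a length independent of `m`: the entries of `x
^ m` are polynomials in `m`. -/
theorem pow_entry (hM : IsUnitriangularEmbedding M) (x : QpPoints p A) (m : ℕ) (i j : Fin n) :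
    pointMatrix M (x ^ m) i j =
      ∑ k ∈ Finset.range n, ((pointMatrix M x - 1) ^ k) i j * (m.choose k : ℚ_[p]) := by
  have hz : ∀ k, n ≤ k → ((pointMatrix M x - 1) ^ k) i j = 0 := fun k hk =>
    hM.nilpotent_pow x k i j (by omega)
  have h1 : pointMatrix M x ^ m = (pointMatrix M x - 1 + 1) ^ m := by rw [sub_add_cancel]
  rw [hM.matrix_pow, h1, (Commute.one_right _).add_pow, Matrix.sum_apply]
  have h2 : ∀ k, ((pointMatrix M x - 1) ^ k * 1 ^ (m - k) * (m.choose k : Matrix (Fin n) (Fin n)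
      ℚ_[p])) i j = ((pointMatrix M x - 1) ^ k) i j * (m.choose k : ℚ_[p]) := fun k => by
    rw [one_pow, mul_one, ← nsmul_eq_mul', Matrix.smul_apply, nsmul_eq_mul, mul_comm]
  simp only [h2]
  refine (Finset.sum_subset (Finset.range_mono (Nat.le_add_right (m + 1) n)) ?_).trans
    (Finset.sum_subset (Finset.range_mono (Nat.le_add_left n (m + 1))) ?_).symm
  · intro k _ hk
    have hk' : m < k := by simpa using hk
    rw [Nat.choose_eq_zero_of_lt hk', Nat.cast_zero, mul_zero]
  · intro k _ hk
    have hk' : n ≤ k := by simpa using hk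
    rw [hz k hk', zero_mul]

theorem polynomial_ext {P Q : ℚ_[p][X]} (h : ∀ m : ℕ, P.eval (m : ℚ_[p]) = Q.eval (m : ℚ_[p])) :
    P = Q := by
  refine Polynomial.eq_of_infinite_eval_eq P Q ?_
  exact (Set.infinite_range_of_injective (Nat.cast_injective (R := ℚ_[p]))).mono
    (by rintro _ ⟨m, rfl⟩; exact h m)

theorem exists_polynomial (hM : IsUnitriangularEmbedding M) (x : QpPoints p A) (a : A) :
    ∃ P : ℚ_[p][X], ∀ m : ℕ, P.eval (m : ℚ_[p]) = (x ^ m).ofConv a := by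
  refine hM.induction (P := fun a => ∃ P : ℚ_[p][X], ∀ m : ℕ, P.eval (m : ℚ_[p]) =
    (x ^ m).ofConv a) (fun i j => ?_) (fun r => ?_) (fun a b => ?_) (fun a b => ?_) a
  · refine ⟨∑ k ∈ Finset.range n, C (((pointMatrix M x - 1) ^ k) i j * (k.factorial : ℚ_[p])⁻¹) *
      descPochhammer ℚ_[p] k, fun m => ?_⟩
    rw [show (x ^ m).ofConv (M i j) = pointMatrix M (x ^ m) i j from rfl, hM.pow_entry,
      eval_finsetSum]
    refine Finset.sum_congr rfl fun k _ => ?_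
    rw [eval_mul, eval_C, descPochhammer_eval_eq_descFactorial, Nat.descFactorial_eq_factorial_mul_choose]
    have : (k.factorial : ℚ_[p]) ≠ 0 := by exact_mod_cast k.factorial_ne_zero
    push_cast
    field_simp
  · exact ⟨C (algebraMap ℚ ℚ_[p] r), fun m => by rw [eval_C, AlgHom.commutes]⟩
  · rintro ⟨P, hP⟩ ⟨Q, hQ⟩
    exact ⟨P + Q, fun m => by rw [eval_add, hP, hQ, map_add]⟩
  · rintro ⟨P, hP⟩ ⟨Q, hQ⟩
    exact ⟨P * Q, fun m => by rw [eval_mul, hP, hQ, map_mul]⟩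

theorem exists_polynomial_hom (hM : IsUnitriangularEmbedding M) (x : QpPoints p A) :
    ∃ F : A →ₐ[ℚ] ℚ_[p][X], ∀ a, ∀ m : ℕ, (F a).eval (m : ℚ_[p]) = (x ^ m).ofConv a := by
  choose F hF using hM.exists_polynomial x
  refine ⟨AlgHom.mk' ⟨⟨⟨F, ?_⟩, ?_⟩, ?_, ?_⟩ ?_, hF⟩
  · exact polynomial_ext fun m => by rw [hF, map_one, eval_one]
  · exact fun a b => polynomial_ext fun m => by
      change (F (a * b)).eval _ = (F a * F b).eval _
      rw [hF, map_mul, eval_mul, hF, hF]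
  · exact polynomial_ext fun m => by
      change (F 0).eval _ = _
      rw [hF, map_zero, eval_zero]
  · exact fun a b => polynomial_ext fun m => by
      change (F (a + b)).eval _ = (F a + F b).eval _
      rw [hF, map_add, eval_add, hF, hF]
  · exact fun r a => polynomial_ext fun m => by
      change (F (r • a)).eval _ = (r • F a).eval _
      rw [hF, map_smul, eval_smul, hF]

/-- The line through `x` interpolates `m ↦ x ^ m` polynomially, so it stays in the group and avoids
logarithms. The homomorphism law holds at natural numbers and extends to one variable at a time,
since polynomials that agree on `ℕ` are equal. -/
theorem exists_oneParam (hM : IsUnitriangularEmbedding M) (x : QpPoints p A) :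
    ∃ φ : AddChar ℚ_[p] (QpPoints p A), Continuous φ ∧ φ 1 = x := by
  obtain ⟨F, hF⟩ := hM.exists_polynomial_hom x
  let f : ℚ_[p] → QpPoints p A := fun t =>
    WithConv.toConv (((aeval t : ℚ_[p][X] →ₐ[ℚ_[p]] ℚ_[p]).restrictScalars ℚ).comp F)
  have hf : ∀ t a, (f t).ofConv a = (F a).eval t := fun t a => by
    simp [f]
  have hnat : ∀ m : ℕ, f m = x ^ m := fun m => WithConv.ext (AlgHom.ext fun a => by rw [hf, hF])
  have hleft : ∀ (s : ℚ_[p]) (τ : A ⊗[ℚ] A), ∃ Q : ℚ_[p][X], ∀ t, Q.eval t =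
      Algebra.TensorProduct.lift (f s).ofConv (f t).ofConv (fun _ _ => .all _ _) τ := by
    intro s τ
    induction τ with
    | zero => exact ⟨0, by simp⟩
    | tmul a b => exact ⟨C ((f s).ofConv a) * F b, fun t => by simp [hf]⟩
    | add σ τ hσ hτ =>
      obtain ⟨P, hP⟩ := hσ
      obtain ⟨Q, hQ⟩ := hτ
      exact ⟨P + Q, fun t => by rw [eval_add, hP, hQ, map_add]⟩
  have hright : ∀ (t : ℚ_[p]) (τ : A ⊗[ℚ] A), ∃ Q : ℚ_[p][X], ∀ s, Q.eval s =
      Algebra.TensorProduct.lift (f s).ofConv (f t).ofConv (fun _ _ => .all _ _) τ := by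
    intro t τ
    induction τ with
    | zero => exact ⟨0, by simp⟩
    | tmul a b => exact ⟨C ((f t).ofConv b) * F a, fun t => by simp [hf, mul_comm]⟩
    | add σ τ hσ hτ =>
      obtain ⟨P, hP⟩ := hσ
      obtain ⟨Q, hQ⟩ := hτ
      exact ⟨P + Q, fun t => by rw [eval_add, hP, hQ, map_add]⟩
  have hmul : ∀ s t a, (f s * f t).ofConv a = Algebra.TensorProduct.lift (f s).ofConv (f t).ofConv
      (fun _ _ => .all _ _) (Coalgebra.comul a) := fun s t a => AlgHom.convMul_apply (f s) (f t) a
  have h1 : ∀ (m : ℕ) (t : ℚ_[p]), f (m + t) = f m * f t := by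
    intro m t
    refine WithConv.ext (AlgHom.ext fun a => ?_)
    obtain ⟨Q, hQ⟩ := hleft m (Coalgebra.comul a)
    have h2 : (F a).comp (C (m : ℚ_[p]) + X) = Q := polynomial_ext fun m' => by
      rw [hQ, ← hmul, hnat, hnat, ← pow_add, eval_comp, eval_add, eval_C, eval_X, ← Nat.cast_add, hF]
    rw [hmul, ← hQ, ← h2, hf, eval_comp, eval_add, eval_C, eval_X]
  have h2 : ∀ s t : ℚ_[p], f (s + t) = f s * f t := by
    intro s t
    refine WithConv.ext (AlgHom.ext fun a => ?_)
    obtain ⟨Q, hQ⟩ := hright t (Coalgebra.comul a)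
    have h2 : (F a).comp (X + C t) = Q := polynomial_ext fun m => by
      rw [hQ, ← hmul, ← h1, hf, eval_comp, eval_add, eval_C, eval_X]
    rw [hmul, ← hQ, ← h2, hf, eval_comp, eval_add, eval_C, eval_X]
  refine ⟨⟨f, by simpa using hnat 0, h2⟩, ?_, by simpa using hnat 1⟩
  refine continuous_induced_rng.2 (continuous_pi fun a => ?_)
  change Continuous fun t => (f t).ofConv a
  simp only [hf]
  exact (F a).continuous

theorem centralCoords (hM : IsUnitriangularEmbedding M) :
    CentralCoords (G := QpPoints p A) (coord M) (n * n) where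
  cont := continuous_coord
  mul _ _ hx _ _ := hM.coord_mul_of (Or.inl hx)
  conj k g := hM.coord_conj g k
  eq_one _ hx := hM.eq_one_of_layer hx
  oneParam := hM.exists_oneParam

/-- The points whose entries `x i j` have norm at most `p ^ (r * (j - i))`. -/
def compactOpen (hM : IsUnitriangularEmbedding M) (r : ℤ) : Subgroup (QpPoints p A) := by
  have h0 : (0 : ℝ) < p := zero_lt_one.trans one_lt_prime_cast
  let S : Submonoid (QpPoints p A) :=
    { carrier := {x | ∀ i j : Fin n, ‖pointMatrix M x i j‖ ≤ (p : ℝ) ^ (r * ((j.1 : ℤ) - i.1))}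
      one_mem' := fun i j => by
        rw [hM.matrix_one]
        rcases eq_or_ne i j with rfl | h
        · simp
        · rw [Matrix.one_apply_ne h, norm_zero]
          positivity
      mul_mem' := fun {x y} hx hy i j => by
        rw [hM.matrix_mul, Matrix.mul_apply]
        refine IsUltrametricDist.norm_sum_le_of_forall_le_of_nonneg (by positivity) fun l _ => ?_
        rw [norm_mul, show r * ((j.1 : ℤ) - i.1) = r * ((l.1 : ℤ) - i.1) + r * ((j.1 : ℤ) - l.1) by
          ring, zpow_add₀ h0.ne']
        exact mul_le_mul (hx i l) (hy l j) (norm_nonneg _) (by positivity) }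
  refine { S with inv_mem' := fun {x} hx => ?_ }
  have hx' : x ∈ S := hx
  obtain ⟨φ, hφ, rfl⟩ := hM.exists_oneParam x
  have hclosed : IsClosed (S : Set (QpPoints p A)) := by
    have : (S : Set (QpPoints p A)) = ⋂ i, ⋂ j,
        {x | ‖pointMatrix M x i j‖ ≤ (p : ℝ) ^ (r * ((j.1 : ℤ) - i.1))} := by
      ext
      simp [S]
    rw [this]
    exact isClosed_iInter fun i => isClosed_iInter fun j =>
      isClosed_le (continuous_matrix i j).norm continuous_const
  -- The inverse of `x` is the limit of the positive powers `x ^ (p ^ k - 1)`, which lie in the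
  -- closed submonoid.
  have hlim : Filter.Tendsto (fun k : ℕ => φ ((p : ℚ_[p]) ^ k - 1)) Filter.atTop
      (nhds (φ (0 - 1))) := by
    refine (hφ.tendsto _).comp (Filter.Tendsto.sub_const ?_ _)
    exact tendsto_pow_atTop_nhds_zero_of_norm_lt_one Padic.norm_p_lt_one
  rw [zero_sub, AddChar.map_neg_eq_inv] at hlim
  refine hclosed.mem_of_tendsto hlim (Filter.Eventually.of_forall fun k => ?_)
  have h1 : (p : ℚ_[p]) ^ k - 1 = ((p ^ k - 1 : ℕ) : ℚ_[p]) * 1 := by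
    rw [Nat.cast_sub (Nat.one_le_pow _ _ (Fact.out : p.Prime).pos)]
    push_cast
    ring
  rw [h1, AddChar.map_natCast_mul]
  exact pow_mem hx' _

theorem mem_compactOpen (hM : IsUnitriangularEmbedding M) {r : ℤ} {x : QpPoints p A} :
    x ∈ hM.compactOpen r ↔
      ∀ i j : Fin n, ‖pointMatrix M x i j‖ ≤ (p : ℝ) ^ (r * ((j.1 : ℤ) - i.1)) := Iff.rfl

theorem mem_compactOpen_iff (hM : IsUnitriangularEmbedding M) {r : ℤ} {x : QpPoints p A} :
    x ∈ hM.compactOpen r ↔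
      ∀ i j : Fin n, i < j → ‖pointMatrix M x i j‖ ≤ (p : ℝ) ^ (r * ((j.1 : ℤ) - i.1)) := by
  have h0 : (0 : ℝ) < p := zero_lt_one.trans one_lt_prime_cast
  refine ⟨fun h i j _ => h i j, fun h i j => ?_⟩
  rcases lt_trichotomy i j with h1 | rfl | h1
  · exact h i j h1
  · simp [hM.matrix_diag]
  · rw [hM.matrix_lower x h1, norm_zero]
    positivity

/-- Being an algebra homomorphism is a family of closed conditions on a function. Compactness of
sets of points thereby reduces to Tychonoff's theorem. -/
theorem isClosedEmbedding_eval :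
    Topology.IsClosedEmbedding fun (x : QpPoints p A) (a : A) => x.ofConv a := by
  refine ⟨⟨⟨rfl⟩, fun x y h => WithConv.ext (AlgHom.ext fun a => congrFun h a)⟩, ?_⟩
  have : (Set.range fun (x : QpPoints p A) (a : A) => x.ofConv a) =
      (⋂ a, ⋂ b, {f : A → ℚ_[p] | f (a * b) = f a * f b}) ∩
      (⋂ a, ⋂ b, {f : A → ℚ_[p] | f (a + b) = f a + f b}) ∩
      ⋂ r : ℚ, {f : A → ℚ_[p] | f (algebraMap ℚ A r) = algebraMap ℚ ℚ_[p] r} := by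
    ext f
    simp only [Set.mem_range, Set.mem_inter_iff, Set.mem_iInter, Set.mem_ofPred_eq]
    constructor
    · rintro ⟨x, rfl⟩
      exact ⟨⟨fun a b => map_mul _ a b, fun a b => map_add _ a b⟩, fun r => x.ofConv.commutes r⟩
    · rintro ⟨⟨h1, h2⟩, h3⟩
      have h4 : f 0 = 0 := by simpa using h3 0
      have h5 : f 1 = 1 := by simpa using h3 1
      exact ⟨WithConv.toConv ⟨⟨⟨⟨f, h5⟩, h1⟩, h4, h2⟩, h3⟩, rfl⟩
  rw [this]
  refine IsClosed.inter (IsClosed.inter ?_ ?_) ?_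
  · exact isClosed_iInter fun a => isClosed_iInter fun b => isClosed_eq (by fun_prop) (by fun_prop)
  · exact isClosed_iInter fun a => isClosed_iInter fun b => isClosed_eq (by fun_prop) (by fun_prop)
  · exact isClosed_iInter fun r => isClosed_eq (by fun_prop) (by fun_prop)

theorem exists_bound (hM : IsUnitriangularEmbedding M) (r : ℤ) (a : A) :
    ∃ B : ℝ, ∀ x ∈ hM.compactOpen (p := p) r, ‖x.ofConv a‖ ≤ B := by
  refine hM.induction (P := fun a => ∃ B : ℝ, ∀ x ∈ hM.compactOpen (p := p) r, ‖x.ofConv a‖ ≤ B)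
    (fun i j => ⟨_, fun x hx => hx i j⟩) (fun q => ⟨_, fun x _ => by rw [AlgHom.commutes]⟩)
    (fun a b => ?_) (fun a b => ?_) a
  · rintro ⟨B, hB⟩ ⟨B', hB'⟩
    exact ⟨B + B', fun x hx => by
      rw [map_add]
      exact (norm_add_le _ _).trans (add_le_add (hB x hx) (hB' x hx))⟩
  · rintro ⟨B, hB⟩ ⟨B', hB'⟩
    exact ⟨B * B', fun x hx => by
      rw [map_mul, norm_mul]
      exact mul_le_mul (hB x hx) (hB' x hx) (norm_nonneg _) ((norm_nonneg _).trans (hB x hx))⟩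

theorem isOpen_compactOpen (hM : IsUnitriangularEmbedding M) (r : ℤ) :
    IsOpen (hM.compactOpen (p := p) r : Set (QpPoints p A)) := by
  have h0 : (0 : ℝ) < p := zero_lt_one.trans one_lt_prime_cast
  have : (hM.compactOpen (p := p) r : Set (QpPoints p A)) = ⋂ i, ⋂ j,
      {x | pointMatrix M x i j ∈ Metric.closedBall (0 : ℚ_[p]) ((p : ℝ) ^ (r * ((j.1 : ℤ) - i.1)))} := by
    ext
    simp [mem_compactOpen]
  rw [this]
  refine isOpen_iInter_of_finite fun i => isOpen_iInter_of_finite fun j => ?_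
  exact (IsUltrametricDist.isOpen_closedBall _ (zpow_pos h0 _).ne').preimage (continuous_matrix i j)

theorem isCompact_compactOpen (hM : IsUnitriangularEmbedding M) (r : ℤ) :
    IsCompact (hM.compactOpen (p := p) r : Set (QpPoints p A)) := by
  choose B hB using hM.exists_bound (p := p) r
  have h1 : IsCompact (Set.pi Set.univ fun a => Metric.closedBall (0 : ℚ_[p]) (B a)) :=
    isCompact_univ_pi fun a => isCompact_closedBall _ _
  refine (isClosedEmbedding_eval.isCompact_preimage h1).of_isClosed_subset ?_ fun x hx a _ => ?_
  · exact Subgroup.isClosed_of_isOpen _ (hM.isOpen_compactOpen r)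
  · simpa using hB a x hx

theorem compactOpenFiltration (hM : IsUnitriangularEmbedding M) :
    CompactOpenFiltration (hM.compactOpen (p := p)) := by
  have h1p := one_lt_prime_cast (p := p)
  have hmono : Monotone (hM.compactOpen (p := p)) := by
    intro r s hrs x hx
    rw [mem_compactOpen_iff] at hx ⊢
    intro i j hij
    have : i.1 < j.1 := hij
    refine (hx i j hij).trans (zpow_le_zpow_right₀ h1p.le ?_)
    exact mul_le_mul_of_nonneg_right hrs (by omega)
  refine ⟨hM.isOpen_compactOpen, hM.isCompact_compactOpen, hmono, fun x => ?_, fun U hU => ?_⟩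
  · choose m hm using fun ij : Fin n × Fin n =>
      pow_unbounded_of_one_lt ‖pointMatrix M x ij.1 ij.2‖ h1p
    obtain ⟨R, hR⟩ := (Set.finite_range m).bddAbove
    refine ⟨R, (hM.mem_compactOpen_iff).2 fun i j hij => ?_⟩
    have : i.1 < j.1 := hij
    have h2 : m (i, j) ≤ R := hR ⟨_, rfl⟩
    have h3 := hm (i, j)
    rw [← zpow_natCast] at h3
    refine h3.le.trans (zpow_le_zpow_right₀ h1p.le ?_)
    have h4 : (R : ℤ) * 1 ≤ R * ((j.1 : ℤ) - i.1) := mul_le_mul_of_nonneg_left (by omega) (by omega)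
    omega
  · have hU' : ∀ x ∈ ⋂ k : ℕ, (hM.compactOpen (p := p) (-k) : Set (QpPoints p A)), U ∈ nhds x := by
      intro x hx
      have hx1 : x = 1 := by
        refine hM.matrix_injective ?_
        rw [hM.matrix_one]
        ext i j
        rcases lt_trichotomy i j with h | rfl | h
        · rw [Matrix.one_apply_ne h.ne, ← norm_le_zero_iff]
          have h' : i.1 < j.1 := h
          refine ge_of_tendsto' (tendsto_pow_atTop_nhds_zero_of_lt_one (r := (p : ℝ)⁻¹)
            (by positivity) (inv_lt_one_of_one_lt₀ h1p)) fun k => ?_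
          have h2 := (Set.mem_iInter.1 hx k : x ∈ hM.compactOpen (-k)) i j
          refine h2.trans ?_
          rw [inv_pow, ← zpow_natCast, ← zpow_neg]
          refine zpow_le_zpow_right₀ h1p.le ?_
          have h4 : (k : ℤ) * 1 ≤ k * ((j.1 : ℤ) - i.1) :=
            mul_le_mul_of_nonneg_left (by omega) (by omega)
          rw [neg_mul]
          omega
        · rw [hM.matrix_diag, Matrix.one_apply_eq]
        · rw [hM.matrix_lower x h, Matrix.one_apply_ne h.ne']
      rw [hx1]
      exact hU
    -- The subgroups `K (-k)` are compact and decrease to `{1}`, so one of them is contained in `U`.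
    obtain ⟨k, hk⟩ := exists_subset_nhds_of_isCompact'
      (directed_of_isDirected_le fun i j hij => hmono (by omega))
      (fun k : ℕ => hM.isCompact_compactOpen _)
      (fun k => Subgroup.isClosed_of_isOpen _ (hM.isOpen_compactOpen _)) hU'
    exact ⟨-k, hk⟩

end IsUnitriangularEmbedding

end Unipotent

/-! ### Irreducible representations -/

section Irreducible

variable {G : Type v} [Group G] {V : Type u} [AddCommGroup V] [Module ℂ V]

theorem rep_irreducible_iff {ρ : Representation ℂ G V} :
    ρ.IsIrreducible ↔ Nontrivial V ∧ ∀ W : Submodule ℂ V, RepInvariant ρ W → W = ⊥ ∨ W = ⊤ := by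
  constructor
  · intro h
    have h0 : Nontrivial V := by
      rw [← not_subsingleton_iff_nontrivial]
      intro hsub
      refine h.toNontrivial.exists_pair_ne.elim fun a ⟨b, hab⟩ => hab ?_
      exact Subrepresentation.toSubmodule_injective (Subsingleton.elim _ _)
    refine ⟨h0, fun W hW => ?_⟩
    rcases h.eq_bot_or_eq_top ⟨W, fun g w hw => hW g w hw⟩ with h1 | h1
    · exact Or.inl (congrArg Subrepresentation.toSubmodule h1)
    · exact Or.inr (congrArg Subrepresentation.toSubmodule h1)
  · rintro ⟨h0, h⟩
    have : Nontrivial (Subrepresentation ρ) := by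
      refine ⟨⊥, ⊤, fun h1 => ?_⟩
      have h2 : (⊥ : Submodule ℂ V) = ⊤ := congrArg Subrepresentation.toSubmodule h1
      exact bot_ne_top h2
    refine ⟨fun W => ?_⟩
    rcases h W.toSubmodule (fun g w hw => W.apply_mem_toSubmodule g hw) with h1 | h1
    · exact Or.inl (Subrepresentation.toSubmodule_injective h1)
    · exact Or.inr (Subrepresentation.toSubmodule_injective h1)

theorem irreducible_isPrimeRep [TopologicalSpace G] {ρ : Representation ℂ G V}
    (h : ρ.IsIrreducible) : IsPrimeRep ρ := by
  obtain ⟨h0, h⟩ := rep_irreducible_iff.1 h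
  refine ⟨h0, fun T _ W hW hW0 K _ _ hTW v hv => hTW v ?_ hv⟩
  rw [(h W hW).resolve_left hW0]
  trivial

theorem HasAdmissibleIrr.finiteDimensional [TopologicalSpace G] {ρ : Representation ℂ G V}
    (ha : HasAdmissibleIrr ρ) (h : ρ.IsIrreducible) {K : Subgroup G} (hK : IsOpen (K : Set G)) :
    FiniteDimensional ℂ (fixedSubmodule ρ K) := by
  obtain ⟨W, hW, hW0, -, hadm⟩ := ha
  have := hadm K hK
  rwa [((rep_irreducible_iff.1 h).2 W hW).resolve_left hW0, top_inf_eq] at this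

end Irreducible

/-! ### Averaging over compact open subgroups -/

section Haar

open MeasureTheory

variable {G : Type v} [Group G] [TopologicalSpace G] [IsTopologicalGroup G] [MeasurableSpace G]
  [BorelSpace G]

/-- The invariant probability measure of a compact open subgroup, as a measure on the group. -/
def subgroupMeasure (K : Subgroup G) (ho : IsOpen (K : Set G)) (hc : IsCompact (K : Set G)) :
    Measure G :=
  (Measure.haarMeasure ⟨⟨K, hc⟩, by
    rw [show (TopologicalSpace.Compacts.mk (K : Set G) hc).carrier = K from rfl, ho.interior_eq]
    exact ⟨1, K.one_mem⟩⟩).restrict K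

variable {K : Subgroup G} (ho : IsOpen (K : Set G)) (hc : IsCompact (K : Set G))

instance isProbabilityMeasure_subgroupMeasure : IsProbabilityMeasure (subgroupMeasure K ho hc) := by
  constructor
  rw [subgroupMeasure, Measure.restrict_apply_univ]
  exact Measure.haarMeasure_self

theorem subgroupMeasure_ae : ∀ᵐ g ∂subgroupMeasure K ho hc, g ∈ K :=
  ae_restrict_mem ho.measurableSet

variable {E : Type*} [NormedAddCommGroup E]

theorem subgroupMeasure_integrable {f : G → E} (hf : Continuous f) :
    Integrable f (subgroupMeasure K ho hc) :=
  hf.continuousOn.integrableOn_compact' hc ho.measurableSet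

theorem subgroupMeasure_translate [NormedSpace ℝ E] (f : G → E) {h : G} (hh : h ∈ K) :
    ∫ g, f (h * g) ∂subgroupMeasure K ho hc = ∫ g, f g ∂subgroupMeasure K ho hc := by
  unfold subgroupMeasure
  rw [← integral_indicator ho.measurableSet, ← integral_indicator ho.measurableSet]
  refine Eq.trans ?_ (integral_mul_left_eq_self _ h)
  congr 1
  funext g
  by_cases hg : g ∈ K
  · rw [Set.indicator_of_mem (show g ∈ (K : Set G) from hg),
      Set.indicator_of_mem (show h * g ∈ (K : Set G) from K.mul_mem hh hg)]
  · rw [Set.indicator_of_notMem (show g ∉ (K : Set G) from hg),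
      Set.indicator_of_notMem (show h * g ∉ (K : Set G) from
        fun h' => hg ((K.mul_mem_cancel_left hh).1 h'))]

theorem subgroupMeasure_integral_pos {f : G → ℝ} (hf : Continuous f) (h0 : ∀ g, 0 ≤ f g)
    (h1 : f 1 ≠ 0) : 0 < ∫ g, f g ∂subgroupMeasure K ho hc := by
  rw [integral_pos_iff_support_of_nonneg h0 (subgroupMeasure_integrable ho hc hf)]
  have hopen : IsOpen (Function.support f) := hf.isOpen_support
  rw [subgroupMeasure, Measure.restrict_apply hopen.measurableSet]
  exact (hopen.inter ho).measure_pos _ ⟨1, h1, K.one_mem⟩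

end Haar

/-! ### Unitarizability -/

section Unitarizable

open MeasureTheory Filter Topology ComplexConjugate

variable {G : Type v} [Group G] [TopologicalSpace G] [IsTopologicalGroup G]
  {V : Type u} [AddCommGroup V] [Module ℂ V]

theorem continuous_orbit_inv {ρ : Representation ℂ G V} (hs : IsSmoothRep ρ) (ℓ : V →ₗ[ℂ] ℂ)
    (x : V) : Continuous fun g => ℓ (ρ g⁻¹ x) := by
  refine IsLocallyConstant.continuous ((IsLocallyConstant.iff_eventually_eq _).2 fun g => ?_)
  obtain ⟨K, hK, -, hfix⟩ := hs (ρ g⁻¹ x)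
  have h1 : ∀ᶠ g' in nhds g, g⁻¹ * g' ∈ K :=
    (continuous_const_mul g⁻¹).continuousAt.eventually_mem (hK.mem_nhds (by simp [K.one_mem]))
  filter_upwards [h1] with g' hg'
  have h2 := hfix _ (K.inv_mem hg')
  rw [← rep_mul] at h2
  rw [← h2]
  congr 3
  group

/-- A limit of invariant forms: the data of approximately invariant positive semidefinite forms on
an irreducible representation that are normalized at a vector. -/
theorem exists_form_of_approx {ρ : Representation ℂ G V} (hρ : ρ.IsIrreducible)
    (B : ℕ → V → V → ℂ) (q : ℕ → V → ℝ) (v : V)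
    (hsymm : ∀ n x y, conj (B n y x) = B n x y) (hself : ∀ n x, B n x x = q n x)
    (hadd : ∀ n x y z, B n (x + y) z = B n x z + B n y z)
    (hsmul : ∀ n x y (r : ℂ), B n (r • x) y = conj r * B n x y)
    (hq0 : ∀ n x, 0 ≤ q n x) (hqadd : ∀ n x y, q n (x + y) ≤ 2 * q n x + 2 * q n y)
    (hqsmul : ∀ n (r : ℂ) x, q n (r • x) = ‖r‖ ^ 2 * q n x)
    (hBq : ∀ n x y, ‖B n x y‖ ≤ q n x + q n y) (hqv : ∀ n, q n v = 1)
    (hinv : ∀ g, ∀ᶠ n in atTop, ∀ x y, B n (ρ g x) (ρ g y) = B n x y) :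
    Nonempty (InvariantForm ρ) := by
  obtain ⟨-, hirr⟩ := rep_irreducible_iff.1 hρ
  have hqinv : ∀ g, ∀ᶠ n in atTop, ∀ x, q n (ρ g x) = q n x := fun g => by
    filter_upwards [hinv g] with n hn x
    have := hn x x
    rw [hself, hself] at this
    exact_mod_cast this
  have hq00 : ∀ n, q n 0 = 0 := fun n => by
    have := hqsmul n 0 0
    rwa [zero_smul, norm_zero, zero_pow two_ne_zero, zero_mul] at this
  have hv0 : v ≠ 0 := by
    rintro rfl
    exact one_ne_zero ((hqv 0).symm.trans (hq00 0))
  -- The vectors on which the forms stay bounded. They form a subrepresentation containing `v`,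
  -- hence everything.
  let U : Submodule ℂ V :=
    { carrier := {x | ∃ C, ∀ᶠ n in atTop, q n x ≤ C}
      zero_mem' := ⟨0, .of_forall fun n => (hq00 n).le⟩
      add_mem' := by
        rintro x y ⟨C, hC⟩ ⟨D, hD⟩
        refine ⟨2 * C + 2 * D, ?_⟩
        filter_upwards [hC, hD] with n h1 h2
        linarith [hqadd n x y]
      smul_mem' := by
        rintro r x ⟨C, hC⟩
        refine ⟨‖r‖ ^ 2 * C, ?_⟩
        filter_upwards [hC] with n h1
        rw [hqsmul]
        exact mul_le_mul_of_nonneg_left h1 (by positivity) }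
  have hU : U = ⊤ := by
    refine (hirr U ?_).resolve_left ((Submodule.ne_bot_iff _).2
      ⟨v, ⟨1, .of_forall fun n => (hqv n).le⟩, hv0⟩)
    rintro g x ⟨C, hC⟩
    refine ⟨C, ?_⟩
    filter_upwards [hC, hqinv g] with n h1 h2
    rwa [h2]
  -- Bounded sequences converge along an ultrafilter, so the limits exist simultaneously for all
  -- pairs of vectors.
  let ul : Ultrafilter ℕ := hyperfilter ℕ
  have hul : (ul : Filter ℕ) ≤ atTop := Nat.hyperfilter_le_atTop
  have hlim : ∀ x y, ∃ z, Tendsto (fun n => B n x y) ul (𝓝 z) := by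
    intro x y
    obtain ⟨C, hC⟩ : x ∈ U := hU ▸ Submodule.mem_top
    obtain ⟨D, hD⟩ : y ∈ U := hU ▸ Submodule.mem_top
    have h1 : ∀ᶠ n in (ul : Filter ℕ), B n x y ∈ Metric.closedBall (0 : ℂ) (C + D) := by
      filter_upwards [hul hC, hul hD] with n h1 h2
      rw [mem_closedBall_zero_iff]
      linarith [hBq n x y]
    obtain ⟨z, -, hz⟩ := (isCompact_closedBall (0 : ℂ) (C + D)).ultrafilter_le_nhds
      (ul.map fun n => B n x y) (le_principal_iff.2 h1)
    exact ⟨z, hz⟩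
  choose F hF using hlim
  -- The radical of the limit form. It is a subrepresentation that misses `v` by the normalization,
  -- so it is zero and the limit is definite.
  let N : Submodule ℂ V :=
    { carrier := {x | Tendsto (fun n => q n x) ul (𝓝 0)}
      zero_mem' := by simp [hq00]
      add_mem' := by
        intro x y hx hy
        have h1 : Tendsto (fun n => 2 * q n x + 2 * q n y) ul (𝓝 (2 * 0 + 2 * 0)) :=
          (hx.const_mul 2).add (hy.const_mul 2)
        simp only [mul_zero, add_zero] at h1
        exact squeeze_zero (fun n => hq0 n _) (fun n => hqadd n x y) h1
      smul_mem' := by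
        intro r x hx
        have h1 : Tendsto (fun n => ‖r‖ ^ 2 * q n x) ul (𝓝 (‖r‖ ^ 2 * 0)) := hx.const_mul _
        rw [mul_zero] at h1
        exact h1.congr fun n => (hqsmul n r x).symm }
  have hN : N = ⊥ := by
    refine (hirr N ?_).resolve_right fun htop => ?_
    · intro g x hx
      refine Tendsto.congr' ?_ hx
      filter_upwards [hul (hqinv g)] with n hn
      exact (hn x).symm
    · have h1 : Tendsto (fun n => q n v) ul (𝓝 0) := by
        have : v ∈ N := htop ▸ Submodule.mem_top
        exact this
      simp only [hqv] at h1
      exact one_ne_zero (tendsto_nhds_unique tendsto_const_nhds h1)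
  have hFre : ∀ x, Tendsto (fun n => q n x) ul (𝓝 (F x x).re) := fun x => by
    have h1 := (Complex.continuous_re.tendsto _).comp (hF x x)
    refine h1.congr fun n => ?_
    simp [hself]
  refine ⟨⟨⟨⟨⟨F⟩, ?_, ?_, ?_, ?_⟩, ?_⟩, ?_⟩⟩
  · intro x y
    refine tendsto_nhds_unique (((Complex.continuous_conj.tendsto _).comp (hF y x)).congr
      fun n => ?_) (hF x y)
    exact hsymm n x y
  · exact fun x => ge_of_tendsto' (hFre x) fun n => hq0 n x
  · intro x y z
    refine tendsto_nhds_unique (hF (x + y) z) (((hF x z).add (hF y z)).congr fun n => ?_)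
    exact (hadd n x y z).symm
  · intro x y r
    refine tendsto_nhds_unique (hF (r • x) y) (((hF x y).const_mul (conj r)).congr fun n => ?_)
    exact (hsmul n x y r).symm
  · intro x hx
    have h1 : x ∈ N := by
      have := hFre x
      rw [show F x x = 0 from hx] at this
      exact this
    rw [hN] at h1
    exact h1
  · intro g x y
    refine tendsto_nhds_unique (hF (ρ g x) (ρ g y)) ((hF x y).congr' ?_)
    filter_upwards [hul (hinv g)] with n hn
    exact (hn x y).symm

/-- Irreducible smooth representations of a union of compact open subgroups are unitarizable. -/
theorem exists_invariantForm {K : ℤ → Subgroup G} (hK : CompactOpenFiltration K)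
    {ρ : Representation ℂ G V} (hs : IsSmoothRep ρ) (hρ : ρ.IsIrreducible) :
    Nonempty (InvariantForm ρ) := by
  borelize G
  have := (rep_irreducible_iff.1 hρ).1
  obtain ⟨v, hv⟩ := exists_ne (0 : V)
  obtain ⟨ℓ, hℓ⟩ : ∃ ℓ : V →ₗ[ℂ] ℂ, ℓ v ≠ 0 := by
    by_contra! h
    exact hv ((Module.forall_dual_apply_eq_zero_iff ℂ v).1 h)
  -- Matrix coefficients: acting on `x` becomes left translation of `f x`, so the `L²` form over `K
  -- n` is invariant under `K n`.
  let f : V → G → ℂ := fun x g => ℓ (ρ g⁻¹ x)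
  have hf : ∀ x, Continuous (f x) := continuous_orbit_inv hs ℓ
  have hfadd : ∀ x y g, f (x + y) g = f x g + f y g := fun x y g => by simp [f]
  have hfsmul : ∀ (r : ℂ) x g, f (r • x) g = r * f x g := fun r x g => by simp [f]
  let ν : ℕ → Measure G := fun n => subgroupMeasure (K n) (hK.isOpen n) (hK.isCompact n)
  have hint : ∀ n x y, Integrable (fun g => conj (f x g) * f y g) (ν n) := fun n x y =>
    subgroupMeasure_integrable _ _ ((Complex.continuous_conj.comp (hf x)).mul (hf y))
  have hint2 : ∀ n x, Integrable (fun g => ‖f x g‖ ^ 2) (ν n) := fun n x =>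
    subgroupMeasure_integrable _ _ ((hf x).norm.pow 2)
  let a : ℕ → ℝ := fun n => ∫ g, ‖f v g‖ ^ 2 ∂ν n
  have ha : ∀ n, 0 < a n := fun n =>
    subgroupMeasure_integral_pos _ _ ((hf v).norm.pow 2) (fun g => by positivity)
      (by simpa [f] using hℓ)
  refine exists_form_of_approx hρ (fun n x y => (∫ g, conj (f x g) * f y g ∂ν n) / a n)
    (fun n x => (∫ g, ‖f x g‖ ^ 2 ∂ν n) / a n) v ?_ ?_ ?_ ?_ ?_ ?_ ?_ ?_ ?_ ?_
  · intro n x y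
    rw [map_div₀, Complex.conj_ofReal, ← integral_conj]
    congr 2
    funext g
    rw [map_mul, Complex.conj_conj, mul_comm]
  · intro n x
    rw [Complex.ofReal_div]
    congr 1
    refine Eq.trans ?_ integral_complex_ofReal
    congr 1
    funext g
    rw [mul_comm, Complex.mul_conj, Complex.normSq_eq_norm_sq]
  · intro n x y z
    rw [← add_div, ← integral_add (hint n x z) (hint n y z)]
    congr 2
    funext g
    rw [hfadd, map_add, add_mul]
  · intro n x y r
    rw [← mul_div_assoc, ← integral_const_mul]
    congr 2
    funext g
    rw [hfsmul, map_mul, mul_assoc]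
  · exact fun n x => div_nonneg (integral_nonneg fun g => by positivity) (ha n).le
  · intro n x y
    rw [← mul_div_assoc, ← mul_div_assoc, ← add_div, ← integral_const_mul, ← integral_const_mul,
      ← integral_add ((hint2 n x).const_mul 2) ((hint2 n y).const_mul 2)]
    refine div_le_div_of_nonneg_right (integral_mono (hint2 n _)
      (((hint2 n x).const_mul 2).add ((hint2 n y).const_mul 2)) fun g => ?_) (ha n).le
    rw [hfadd]
    have := norm_add_le (f x g) (f y g)
    nlinarith [sq_nonneg (‖f x g‖ - ‖f y g‖), norm_nonneg (f x g + f y g)]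
  · intro n r x
    rw [← mul_div_assoc, ← integral_const_mul]
    congr 2
    funext g
    rw [hfsmul, norm_mul, mul_pow]
  · intro n x y
    rw [norm_div, Complex.norm_real, Real.norm_of_nonneg (ha n).le, ← add_div,
      ← integral_add (hint2 n x) (hint2 n y)]
    refine div_le_div_of_nonneg_right ((norm_integral_le_integral_norm _).trans
      (integral_mono (hint n x y).norm ((hint2 n x).add (hint2 n y)) fun g => ?_)) (ha n).le
    simp only [norm_mul, RCLike.norm_conj]
    nlinarith [sq_nonneg (‖f x g‖ - ‖f y g‖), norm_nonneg (f x g), norm_nonneg (f y g)]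
  · exact fun n => div_self (ha n).ne'
  · intro g
    obtain ⟨r, hr⟩ := hK.exhaust g
    filter_upwards [eventually_ge_atTop r.toNat] with n hn x y
    have hg : g⁻¹ ∈ K n := (K n).inv_mem (hK.mono (by omega) hr)
    have h1 := subgroupMeasure_translate (hK.isOpen n) (hK.isCompact n)
      (fun g' => conj (f x g') * f y g') hg
    change _ / _ = _ / _
    rw [← h1]
    congr 2
    funext g'
    simp only [f, mul_inv_rev, inv_inv, rep_mul]

end Unitarizable

/-! ### Smooth vectors of unitary representations -/

section SmoothVectors

open MeasureTheory

variable {G : Type v} [Group G] [TopologicalSpace G]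

namespace UnitaryRep

/-- The underlying linear representation of a unitary representation. -/
def rep (π : UnitaryRep.{u} G) : Representation ℂ G π.H where
  toFun g := (π.π g).toLinearEquiv.toLinearMap
  map_one' := by
    ext x
    simp
  map_mul' g h := by
    ext x
    simp

theorem norm_rep (π : UnitaryRep.{u} G) (g : G) (x : π.H) : ‖π.rep g x‖ = ‖x‖ :=
  (π.π g).norm_map x

theorem inner_rep (π : UnitaryRep.{u} G) (g : G) (x y : π.H) :
    inner ℂ (π.rep g x) (π.rep g y) = inner ℂ x y :=
  (π.π g).inner_map_map x y

theorem continuous_rep (π : UnitaryRep.{u} G) (g : G) : Continuous (π.rep g) :=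
  (π.π g).continuous

variable [IsTopologicalGroup G]

/-- The vectors fixed by some open subgroup. -/
def smoothVectors (π : UnitaryRep.{u} G) : Submodule ℂ π.H where
  carrier := {x | ∃ K : Subgroup G, IsOpen (K : Set G) ∧ x ∈ fixedSubmodule π.rep K}
  zero_mem' := ⟨⊤, isOpen_univ, Submodule.zero_mem _⟩
  add_mem' := by
    rintro x y ⟨K, hK, hx⟩ ⟨L, hL, hy⟩
    exact ⟨K ⊓ L, hK.inter hL, Submodule.add_mem _ (fun k hk => hx k hk.1) fun k hk => hy k hk.2⟩
  smul_mem' := by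
    rintro r x ⟨K, hK, hx⟩
    exact ⟨K, hK, Submodule.smul_mem _ r hx⟩

theorem smoothVectors_invariant (π : UnitaryRep.{u} G) : RepInvariant π.rep π.smoothVectors := by
  rintro g x ⟨K, hK, hx⟩
  refine ⟨K.comap (MulAut.conj g⁻¹).toMonoidHom, ?_, rep_mem_fixed_conj hx g⟩
  have : Continuous fun k : G => g⁻¹ * k * g⁻¹⁻¹ := by fun_prop
  exact hK.preimage this

/-- The closure of an invariant subspace is invariant. -/
theorem closure_invariant (π : UnitaryRep.{u} G) {W : Submodule ℂ π.H}
    (hW : RepInvariant π.rep W) : RepInvariant π.rep W.topologicalClosure := by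
  intro g x hx
  exact map_mem_closure (π.continuous_rep g) hx fun w hw => hW g w hw

/-- Closed invariant subspaces are approximated by their smooth vectors. -/
theorem exists_fixed_approx (π : UnitaryRep.{u} G) {K : ℤ → Subgroup G}
    (hK : CompactOpenFiltration K) {W : Submodule ℂ π.H} (hcl : IsClosed (W : Set π.H))
    (hW : RepInvariant π.rep W) {x : π.H} (hx : x ∈ W) {ε : ℝ} (hε : 0 < ε) :
    ∃ r, ∃ y ∈ W, y ∈ fixedSubmodule π.rep (K r) ∧ ‖y - x‖ ≤ ε := by
  borelize G
  have hcont : Continuous fun g => π.rep g x := π.continuous_orbit x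
  have h1 : {g | π.rep g x ∈ Metric.closedBall x ε} ∈ nhds (1 : G) := by
    refine hcont.continuousAt.preimage_mem_nhds ?_
    rw [map_one]
    exact Metric.closedBall_mem_nhds _ hε
  obtain ⟨r, hr⟩ := hK.basis _ h1
  let μ := subgroupMeasure (K r) (hK.isOpen r) (hK.isCompact r)
  have hint : Integrable (fun g => π.rep g x) μ := subgroupMeasure_integrable _ _ hcont
  -- The average over a small compact open subgroup of an orbit in a closed convex set remains in
  -- that set.
  have hmem : ∫ g, π.rep g x ∂μ ∈ (W : Set π.H) ∩ Metric.closedBall x ε := by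
    refine Convex.integral_mem ((W.restrictScalars ℝ).convex.inter (convex_closedBall x ε))
      (hcl.inter Metric.isClosed_closedBall) ?_ hint
    filter_upwards [subgroupMeasure_ae (hK.isOpen r) (hK.isCompact r)] with g hg
    exact ⟨hW g x hx, hr hg⟩
  refine ⟨r, _, hmem.1, fun h hh => ?_, mem_closedBall_iff_norm.1 hmem.2⟩
  have h2 := (π.π h).toLinearIsometry.toContinuousLinearMap.integral_comp_comm hint
  have h3 := subgroupMeasure_translate (hK.isOpen r) (hK.isCompact r) (fun g => π.rep g x) hh
  refine Eq.trans (Eq.trans h2.symm ?_) h3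
  congr 1
  funext g
  exact (rep_mul π.rep h g x).symm

/-- Averaging over elements that fix a vector does not increase the distance to that vector. -/
theorem norm_sub_average_le (π : UnitaryRep.{u} G) {K : Subgroup G} {x : π.H}
    (hx : x ∈ fixedSubmodule π.rep K) (y : π.H) {m : ℕ} (hm : 0 < m) {k : Fin m → G}
    (hk : ∀ i, k i ∈ K) : ‖x - (m : ℂ)⁻¹ • ∑ i, π.rep (k i) y‖ ≤ ‖x - y‖ := by
  have hm' : (m : ℂ) ≠ 0 := by exact_mod_cast hm.ne'
  have h1 : x - (m : ℂ)⁻¹ • ∑ i, π.rep (k i) y = (m : ℂ)⁻¹ • ∑ i, π.rep (k i) (x - y) := by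
    simp only [map_sub, Finset.sum_sub_distrib, smul_sub]
    rw [Finset.sum_congr rfl fun i _ => hx _ (hk i), Finset.sum_const, Finset.card_univ,
      Fintype.card_fin, ← Nat.cast_smul_eq_nsmul ℂ, inv_smul_smul₀ hm']
  rw [h1, norm_smul, norm_inv, Complex.norm_natCast, inv_mul_le_iff₀ (by exact_mod_cast hm)]
  refine (norm_sum_le _ _).trans_eq ?_
  simp only [norm_rep, Finset.sum_const, Finset.card_univ, Fintype.card_fin, nsmul_eq_mul]

end UnitaryRep

end SmoothVectors

/-! ### Dense models of unitary representations -/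

section DenseModel

variable {G : Type v} [Group G] [TopologicalSpace G] {V : Type u} [AddCommGroup V] [Module ℂ V]
  {V' : Type u} [AddCommGroup V'] [Module ℂ V']

/-- The representation `ρ` is a dense invariant subspace of the unitary representation `π`. -/
structure IsDenseModel (ρ : Representation ℂ G V) (π : UnitaryRep.{u} G) (j : V →ₗ[ℂ] π.H) :
    Prop where
  injective : Function.Injective j
  dense : DenseRange j
  map_rep : ∀ g x, j (ρ g x) = π.rep g (j x)

namespace IsDenseModel

variable {ρ : Representation ℂ G V} {π π' : UnitaryRep.{u} G} {j : V →ₗ[ℂ] π.H}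
  {j' : V →ₗ[ℂ] π'.H}

theorem comp_equiv (h : IsDenseModel ρ π j) {ρ' : Representation ℂ G V'} (T : V' ≃ₗ[ℂ] V)
    (hT : ∀ g x, T (ρ' g x) = ρ g (T x)) : IsDenseModel ρ' π (j ∘ₗ T.toLinearMap) where
  injective := h.injective.comp T.injective
  dense := by
    have h1 : Set.range (j ∘ₗ T.toLinearMap) = Set.range j := T.surjective.range_comp j
    rw [DenseRange, h1]
    exact h.dense
  map_rep g x := by simp [hT, h.map_rep]

theorem map (h : IsDenseModel ρ π j) (U : π.H ≃ₗᵢ[ℂ] π'.H)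
    (hU : ∀ g x, U (π.π g x) = π'.π g (U x)) :
    IsDenseModel ρ π' (U.toLinearEquiv.toLinearMap ∘ₗ j) where
  injective := U.injective.comp h.injective
  dense := U.surjective.denseRange.comp h.dense U.continuous
  map_rep g x := by
    simp only [LinearMap.comp_apply, h.map_rep]
    exact hU g (j x)

variable [IsTopologicalGroup G]

/-- In a dense model by an admissible representation, the vectors fixed by a compact open subgroup
belong to the model. -/
theorem exists_of_fixed (h : IsDenseModel ρ π j) (hs : IsSmoothRep ρ) {K : Subgroup G}
    (hc : IsCompact (K : Set G)) (hfin : FiniteDimensional ℂ (fixedSubmodule ρ K)) {x : π.H}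
    (hx : x ∈ fixedSubmodule π.rep K) : ∃ v ∈ fixedSubmodule ρ K, j v = x := by
  have hcl : IsClosed ((fixedSubmodule ρ K).map j : Set π.H) :=
    Submodule.closed_of_finiteDimensional _
  suffices hx' : x ∈ closure ((fixedSubmodule ρ K).map j : Set π.H) by
    rw [hcl.closure_eq] at hx'
    exact hx'
  rw [Metric.mem_closure_iff]
  intro ε hε
  obtain ⟨v, hv⟩ := h.dense.exists_dist_lt x hε
  obtain ⟨L, hL, -, hvL⟩ := hs v
  -- Averaging a nearby vector of the model over `K` makes it `K`-fixed and keeps it as close to the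
  -- `K`-fixed vector `x`.
  obtain ⟨m, k, hm, hk, hsum⟩ := exists_coset_sum ρ hc hL
  refine ⟨_, ⟨(m : ℂ)⁻¹ • ∑ i, ρ (k i) v, Submodule.smul_mem _ _ (hsum v hvL), rfl⟩, ?_⟩
  rw [dist_eq_norm] at hv ⊢
  refine lt_of_le_of_lt ?_ hv
  rw [map_smul, map_sum]
  simp only [h.map_rep]
  exact π.norm_sub_average_le hx (j v) hm hk

/-- The model is the space of smooth vectors. -/
theorem range_eq (h : IsDenseModel ρ π j) (hs : IsSmoothRep ρ) {K : ℤ → Subgroup G}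
    (hK : CompactOpenFiltration K)
    (hfin : ∀ L : Subgroup G, IsOpen (L : Set G) → FiniteDimensional ℂ (fixedSubmodule ρ L)) :
    LinearMap.range j = π.smoothVectors := by
  ext x
  constructor
  · rintro ⟨v, rfl⟩
    obtain ⟨L, hL, -, hv⟩ := hs v
    exact ⟨L, hL, fun k hk => by rw [← h.map_rep, hv k hk]⟩
  · rintro ⟨L, hL, hx⟩
    obtain ⟨r, hr⟩ := hK.basis L (hL.mem_nhds L.one_mem)
    obtain ⟨v, -, hv⟩ := h.exists_of_fixed hs (hK.isCompact r) (hfin _ (hK.isOpen r))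
      (fun k hk => hx k (hr hk))
    exact ⟨v, hv⟩

/-- A unitary representation with an irreducible admissible dense model is irreducible. -/
theorem isIrreducible (h : IsDenseModel ρ π j) (hs : IsSmoothRep ρ) (hρ : ρ.IsIrreducible)
    {K : ℤ → Subgroup G} (hK : CompactOpenFiltration K)
    (hfin : ∀ L : Subgroup G, IsOpen (L : Set G) → FiniteDimensional ℂ (fixedSubmodule ρ L)) :
    π.IsIrreducible := by
  obtain ⟨hn, hirr⟩ := rep_irreducible_iff.1 hρ
  refine ⟨h.injective.nontrivial, fun W hcl hW => or_iff_not_imp_left.2 fun hW0 => ?_⟩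
  obtain ⟨x, hx, hx0⟩ := (Submodule.ne_bot_iff _).1 hW0
  -- Distance at most half the norm of `x` guarantees that the fixed approximation is nonzero.
  obtain ⟨r, y, hyW, hy, hyx⟩ := π.exists_fixed_approx hK hcl hW hx
    (half_pos (norm_pos_iff.2 hx0))
  obtain ⟨v, -, rfl⟩ := h.exists_of_fixed hs (hK.isCompact r) (hfin _ (hK.isOpen r)) hy
  have hv0 : v ≠ 0 := by
    rintro rfl
    rw [map_zero, zero_sub, norm_neg] at hyx
    linarith [norm_pos_iff.2 hx0]
  have hcomap : W.comap j = ⊤ := by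
    refine (hirr _ fun g w hw => ?_).resolve_left ((Submodule.ne_bot_iff _).2 ⟨v, hyW, hv0⟩)
    rw [Submodule.mem_comap, h.map_rep]
    exact hW g _ hw
  rw [eq_top_iff]
  intro z _
  have hz : z ∈ closure (Set.range j) := h.dense z
  refine closure_minimal ?_ hcl hz
  rintro _ ⟨w, rfl⟩
  have : w ∈ W.comap j := hcomap ▸ Submodule.mem_top
  exact this

/-- Two models of the same unitary representation are isomorphic. -/
theorem exists_linearEquiv (h : IsDenseModel ρ π j) {ρ' : Representation ℂ G V'}
    {i : V' →ₗ[ℂ] π.H} (h' : IsDenseModel ρ' π i) (hr : LinearMap.range j = LinearMap.range i) :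
    ∃ T : V ≃ₗ[ℂ] V', ∀ g x, T (ρ g x) = ρ' g (T x) := by
  let T : V ≃ₗ[ℂ] V' := (LinearEquiv.ofInjective j h.injective).trans
    ((LinearEquiv.ofEq _ _ hr).trans (LinearEquiv.ofInjective i h'.injective).symm)
  have hT : ∀ x, i (T x) = j x := fun x => by
    have := congrArg Subtype.val ((LinearEquiv.ofInjective i h'.injective).apply_symm_apply
      (LinearEquiv.ofEq _ _ hr (LinearEquiv.ofInjective j h.injective x)))
    exact this
  refine ⟨T, fun g x => h'.injective ?_⟩
  rw [hT, h.map_rep, h'.map_rep, hT]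

theorem inner_map_rep (h : IsDenseModel ρ π j) (g : G) (x y : V) :
    inner ℂ (j (ρ g x)) (j (ρ g y)) = inner ℂ (j x) (j y) := by
  rw [h.map_rep, h.map_rep, π.inner_rep]

/-- Schur's lemma on the vectors fixed by a compact open subgroup, for two invariant forms. -/
theorem exists_eigenvector (h : IsDenseModel ρ π j) (j' : V →ₗ[ℂ] π'.H) {E : Submodule ℂ V}
    [FiniteDimensional ℂ E] (hE : E ≠ ⊥) :
    ∃ (r : ℂ) (y : V), y ∈ E ∧ y ≠ 0 ∧
      ∀ x ∈ E, inner ℂ (j' x) (j' y) = r * inner ℂ (j x) (j y) := by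
  have : Nontrivial E := Submodule.nontrivial_iff_ne_bot.2 hE
  let b := Module.finBasis ℂ E
  let Φ : ∀ (π₁ : UnitaryRep.{u} G) (i : V →ₗ[ℂ] π₁.H),
      E →ₗ[ℂ] (Fin (Module.finrank ℂ E) → ℂ) := fun π₁ i =>
    LinearMap.pi fun s => (innerₛₗ ℂ (i (b s))) ∘ₗ i ∘ₗ E.subtype
  have hΦ : ∀ (π₁ : UnitaryRep.{u} G) (i : V →ₗ[ℂ] π₁.H), Function.Injective i →
      Function.Injective (Φ π₁ i) := by
    intro π₁ i hi
    rw [injective_iff_map_eq_zero]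
    intro y hy
    have h1 : ∀ x : E, inner ℂ (i x) (i y) = 0 := by
      intro x
      rw [← b.sum_repr x]
      simp only [Submodule.coe_sum, Submodule.coe_smul, map_sum, map_smul, sum_inner, inner_smul_left]
      refine Finset.sum_eq_zero fun s _ => ?_
      rw [show inner ℂ (i (b s)) (i y) = 0 from congrFun hy s, mul_zero]
    have h2 := hi ((inner_self_eq_zero.1 (h1 y)).trans (map_zero i).symm)
    exact Subtype.ext h2
  -- The first form identifies `E` with a space of functionals, so composing its inverse with the
  -- second form gives an endomorphism of `E`. An eigenvector of it is the required `y`.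
  let e := LinearMap.linearEquivOfInjective (Φ π j) (hΦ π j h.injective) (by simp)
  obtain ⟨r, hr⟩ := Module.End.exists_eigenvalue (e.symm.toLinearMap ∘ₗ Φ π' j' : Module.End ℂ E)
  obtain ⟨y, hy⟩ := hr.exists_hasEigenvector
  have h1 : Φ π' j' y = r • Φ π j y := by
    have h2 := congrArg e hy.apply_eq_smul
    rw [LinearMap.comp_apply, LinearEquiv.coe_coe, LinearEquiv.apply_symm_apply, map_smul] at h2
    exact h2
  refine ⟨r, y, y.2, fun h0 => hy.2 (Subtype.ext h0), fun x hx => ?_⟩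
  have hx' : x = ((⟨x, hx⟩ : E) : V) := rfl
  rw [hx', ← b.sum_repr ⟨x, hx⟩]
  simp only [Submodule.coe_sum, Submodule.coe_smul, map_sum, map_smul, sum_inner, inner_smul_left,
    Finset.mul_sum]
  refine Finset.sum_congr rfl fun s _ => ?_
  have h2 : inner ℂ (j' (b s)) (j' y) = r * inner ℂ (j (b s)) (j y) := congrFun h1 s
  rw [h2]
  ring

/-- Invariant forms on an irreducible admissible representation are proportional. -/
theorem inner_proportional (h : IsDenseModel ρ π j) (h' : IsDenseModel ρ π' j')
    (hs : IsSmoothRep ρ) (hρ : ρ.IsIrreducible)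
    (hfin : ∀ L : Subgroup G, IsOpen (L : Set G) → FiniteDimensional ℂ (fixedSubmodule ρ L)) :
    ∃ r : ℝ, 0 < r ∧ ∀ x y, inner ℂ (j' x) (j' y) = r * inner ℂ (j x) (j y) := by
  obtain ⟨hn, hirr⟩ := rep_irreducible_iff.1 hρ
  obtain ⟨v, hv⟩ := exists_ne (0 : V)
  obtain ⟨K, hK, hKc, hvK⟩ := hs v
  have := hfin K hK
  obtain ⟨r, y, hyK, hy0, hy⟩ := h.exists_eigenvector j' (E := fixedSubmodule ρ K)
    ((Submodule.ne_bot_iff _).2 ⟨v, hvK, hv⟩)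
  let S : Submodule ℂ V :=
    { carrier := {y | ∀ x, inner ℂ (j' x) (j' y) = r * inner ℂ (j x) (j y)}
      zero_mem' := fun x => by simp
      add_mem' := fun {a b} ha hb x => by
        rw [map_add, map_add, inner_add_right, inner_add_right, ha, hb, mul_add]
      smul_mem' := fun s a ha x => by
        rw [map_smul, map_smul, inner_smul_right, inner_smul_right, ha]
        ring }
  -- Since `y` is `K`-fixed, pairing with it does not see the difference between `x` and its
  -- `K`-average, and the average lies in the space where proportionality is known.
  have hyS : y ∈ S := by
    intro x
    obtain ⟨L, hL, -, hxL⟩ := hs x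
    obtain ⟨m, k, hm, hk, hsum⟩ := exists_coset_sum ρ hKc hL
    have key : ∀ (π₁ : UnitaryRep.{u} G) (i : V →ₗ[ℂ] π₁.H), IsDenseModel ρ π₁ i →
        inner ℂ (i (∑ s, ρ (k s) x)) (i y) = m * inner ℂ (i x) (i y) := by
      intro π₁ i hi
      rw [map_sum, sum_inner, Finset.sum_congr rfl fun s _ =>
        (congrArg (fun z => inner ℂ (i (ρ (k s) x)) (i z)) (hyK (k s) (hk s)).symm).trans
          (hi.inner_map_rep (k s) x y)]
      simp
    have h1 := hy _ (hsum x hxL)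
    rw [key π j h, key π' j' h'] at h1
    have hm' : (m : ℂ) ≠ 0 := by exact_mod_cast hm.ne'
    refine mul_left_cancel₀ hm' ?_
    rw [h1]
    ring
  have hS : S = ⊤ := by
    refine (hirr S fun g z hz x => ?_).resolve_left ((Submodule.ne_bot_iff _).2 ⟨y, hyS, hy0⟩)
    have h1 := hz (ρ g⁻¹ x)
    rwa [← h.inner_map_rep g, ← h'.inner_map_rep g, rep_apply_inv] at h1
  have hall : ∀ x y, inner ℂ (j' x) (j' y) = r * inner ℂ (j x) (j y) := fun x y => by
    have : y ∈ S := hS ▸ Submodule.mem_top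
    exact this x
  have h1 := hall v v
  rw [inner_self_eq_norm_sq_to_K, inner_self_eq_norm_sq_to_K] at h1
  have hpos : 0 < ‖j v‖ := norm_pos_iff.2 fun h0 => hv (h.injective (h0.trans (map_zero j).symm))
  have hpos' : 0 < ‖j' v‖ :=
    norm_pos_iff.2 fun h0 => hv (h'.injective (h0.trans (map_zero j').symm))
  have hr : r = ((‖j' v‖ ^ 2 / ‖j v‖ ^ 2 : ℝ) : ℂ) := by
    have h2 : ((‖j v‖ : ℂ) ^ 2) ≠ 0 := pow_ne_zero _ (by exact_mod_cast hpos.ne')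
    push_cast
    rw [eq_div_iff h2]
    exact h1.symm
  exact ⟨_, by positivity, fun x y => hr ▸ hall x y⟩

/-- Unitary representations with a common irreducible admissible dense model are equivalent. -/
theorem exists_unitaryEquiv (h : IsDenseModel ρ π j) (h' : IsDenseModel ρ π' j')
    (hs : IsSmoothRep ρ) (hρ : ρ.IsIrreducible)
    (hfin : ∀ L : Subgroup G, IsOpen (L : Set G) → FiniteDimensional ℂ (fixedSubmodule ρ L)) :
    ∃ U : π.H ≃ₗᵢ[ℂ] π'.H, ∀ g x, U (π.π g x) = π'.π g (U x) := by
  obtain ⟨r, hr, hinner⟩ := h.inner_proportional h' hs hρ hfin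
  have hsq : (0 : ℝ) < √r := Real.sqrt_pos.2 hr
  have hne : (((√r)⁻¹ : ℝ) : ℂ) ≠ 0 := by exact_mod_cast (inv_pos.2 hsq).ne'
  have hnorm : ∀ x, ‖j' x‖ = √r * ‖j x‖ := fun x => by
    have h1 := hinner x x
    rw [inner_self_eq_norm_sq_to_K, inner_self_eq_norm_sq_to_K] at h1
    have h2 : ‖j' x‖ ^ 2 = r * ‖j x‖ ^ 2 := Complex.ofReal_injective (by push_cast; exact h1)
    rw [← Real.sqrt_sq (norm_nonneg (j' x)), h2, Real.sqrt_mul hr.le, Real.sqrt_sq (norm_nonneg _)]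
  -- Rescaling by the inverse square root of the ratio of the forms turns the identity of `V` into
  -- an isometry that extends to the completions.
  let f : V ≃ₗ[ℂ] V := LinearEquiv.smulOfNeZero ℂ V _ hne
  have hf : ∀ x, ‖j' (f x)‖ = ‖j x‖ := fun x => by
    rw [LinearEquiv.smulOfNeZero_apply, hnorm, map_smul, norm_smul, Complex.norm_real, norm_inv,
      Real.norm_of_nonneg hsq.le, mul_inv_cancel_left₀ hsq.ne']
  let U := f.extendOfIsometry j j' h.dense h'.dense hf
  have hU : ∀ x, U (j x) = j' (f x) := fun x => f.extendOfIsometry_eq j j' h.dense h'.dense hf x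
  refine ⟨U, fun g x => ?_⟩
  refine h.dense.induction_on (p := fun x => U (π.π g x) = π'.π g (U x)) x ?_ fun v => ?_
  · exact isClosed_eq (U.continuous.comp (π.π g).continuous) ((π'.π g).continuous.comp U.continuous)
  · have h1 : π.π g (j v) = j (ρ g v) := (h.map_rep g v).symm
    have h2 : π'.π g (j' (f v)) = j' (ρ g (f v)) := (h'.map_rep g (f v)).symm
    rw [h1, hU, hU, h2]
    congr 1
    simp [f]

end IsDenseModel

end DenseModel

/-! ### Existence of dense models -/

section Models

variable {G : Type v} [Group G] [TopologicalSpace G] [IsTopologicalGroup G]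

/-- The inclusion of a pre-Hilbert space in its completion. -/
def completionInclusion (E : Type u) [NormedAddCommGroup E] [InnerProductSpace ℂ E] :
    E →ₗ[ℂ] UniformSpace.Completion E :=
  (UniformSpace.Completion.toComplₗᵢ (𝕜 := ℂ) (E := E)).toLinearMap

/-- The inclusion of a pre-unitary representation in its completion. -/
def InvariantForm.toCompletion {V : Type u} [AddCommGroup V] [Module ℂ V]
    {ρ : Representation ℂ G V} (c : InvariantForm ρ) (hs : IsSmoothRep ρ) :
    V →ₗ[ℂ] (c.completion hs).H where
  toFun x := completionInclusion c.Space x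
  map_add' x y := (completionInclusion c.Space).map_add x y
  map_smul' r x := (completionInclusion c.Space).map_smul r x

/-- The completion of a pre-unitary representation contains it as a dense model. -/
theorem InvariantForm.isDenseModel {V : Type u} [AddCommGroup V] [Module ℂ V]
    {ρ : Representation ℂ G V} (c : InvariantForm ρ) (hs : IsSmoothRep ρ) :
    IsDenseModel ρ (c.completion hs) (c.toCompletion hs) where
  injective := UniformSpace.Completion.coe_injective c.Space
  dense := UniformSpace.Completion.denseRange_coe (α := c.Space)
  map_rep g x := (completionUnitary_coe (c.act g) x).symm

/-- The restriction of a representation to an invariant subspace. -/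
def subRep {V : Type u} [AddCommGroup V] [Module ℂ V] {ρ : Representation ℂ G V}
    {W : Submodule ℂ V} (hW : RepInvariant ρ W) : Representation ℂ G W :=
  (Subrepresentation.mk W fun g w hw => hW g w hw : Subrepresentation ρ).toRepresentation

theorem coe_subRep {V : Type u} [AddCommGroup V] [Module ℂ V] {ρ : Representation ℂ G V}
    {W : Submodule ℂ V} (hW : RepInvariant ρ W) (g : G) (w : W) :
    (subRep hW g w : V) = ρ g w := rfl

theorem map_subtype_eq_bot {V : Type u} [AddCommGroup V] [Module ℂ V] {W : Submodule ℂ V}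
    {U : Submodule ℂ W} (h : U.map W.subtype = ⊥) : U = ⊥ :=
  Submodule.map_injective_of_injective W.injective_subtype (h.trans (Submodule.map_bot _).symm)

theorem map_subtype_invariant {V : Type u} [AddCommGroup V] [Module ℂ V]
    {ρ : Representation ℂ G V} {W : Submodule ℂ V} (hW : RepInvariant ρ W) {U : Submodule ℂ W}
    (hU : RepInvariant (subRep hW) U) : RepInvariant ρ (U.map W.subtype) := by
  rintro g _ ⟨w, hw, rfl⟩
  exact ⟨_, hU g w hw, coe_subRep hW g w⟩

theorem subRep_irreducible {V : Type u} [AddCommGroup V] [Module ℂ V] {ρ : Representation ℂ G V}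
    {W : Submodule ℂ V} (hW : RepInvariant ρ W) (hW0 : W ≠ ⊥)
    (hmin : ∀ U ≤ W, RepInvariant ρ U → U ≠ ⊥ → U = W) : (subRep hW).IsIrreducible := by
  refine rep_irreducible_iff.2 ⟨Submodule.nontrivial_iff_ne_bot.2 hW0, fun U hU => ?_⟩
  refine or_iff_not_imp_left.2 fun hU0 => ?_
  have h1 : U.map W.subtype = W := by
    exact hmin _ (Submodule.map_subtype_le W U) (map_subtype_invariant hW hU) fun h0 =>
      hU0 (map_subtype_eq_bot h0)
  rw [eq_top_iff]
  intro w _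
  have h2 : (w : V) ∈ U.map W.subtype := h1.symm ▸ w.2
  obtain ⟨w', hw', h3⟩ := h2
  rwa [← Subtype.ext h3]

namespace UnitaryRep

/-- The representation on the space of smooth vectors. -/
def smoothRep (π : UnitaryRep.{u} G) : Representation ℂ G π.smoothVectors :=
  subRep π.smoothVectors_invariant

theorem isSmoothRep_smoothRep (π : UnitaryRep.{u} G) {K : ℤ → Subgroup G}
    (hK : CompactOpenFiltration K) : IsSmoothRep π.smoothRep := by
  rintro ⟨x, L, hL, hx⟩
  obtain ⟨r, hr⟩ := hK.basis L (hL.mem_nhds L.one_mem)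
  exact ⟨K r, hK.isOpen r, hK.isCompact r, fun g hg => Subtype.ext (hx g (hr hg))⟩

/-- A finite combination of isometries is bounded. Continuity of the group algebra operators is what
lets density imply primeness. -/
theorem exists_bound_of_mem_span {V : Type u} [AddCommGroup V] [Module ℂ V]
    {ρ : Representation ℂ G V} (p : V → ℝ) (hp : ∀ x y, p (x + y) ≤ p x + p y)
    (hp' : ∀ (r : ℂ) x, p (r • x) = ‖r‖ * p x) (hinv : ∀ g x, p (ρ g x) = p x)
    {T : Module.End ℂ V} (hT : T ∈ Submodule.span ℂ (Set.range ρ)) :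
    ∃ C, ∀ x, p (T x) ≤ C * p x := by
  induction hT using Submodule.span_induction with
  | mem T h =>
    obtain ⟨g, rfl⟩ := h
    exact ⟨1, fun x => by rw [hinv, one_mul]⟩
  | zero =>
    refine ⟨0, fun x => ?_⟩
    have := hp' 0 x
    rw [zero_smul, norm_zero, zero_mul] at this
    rw [LinearMap.zero_apply, this, zero_mul]
  | add S T _ _ hS hT =>
    obtain ⟨C, hC⟩ := hS
    obtain ⟨D, hD⟩ := hT
    refine ⟨C + D, fun x => ?_⟩
    rw [LinearMap.add_apply, add_mul]
    exact (hp _ _).trans (add_le_add (hC x) (hD x))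
  | smul c T _ hT =>
    obtain ⟨C, hC⟩ := hT
    refine ⟨‖c‖ * C, fun x => ?_⟩
    rw [LinearMap.smul_apply, hp', mul_assoc]
    exact mul_le_mul_of_nonneg_left (hC x) (norm_nonneg c)

/-- Nonzero invariant subspaces of an irreducible unitary representation are dense. -/
theorem IsIrreducible.dense {π : UnitaryRep.{u} G} (hπ : π.IsIrreducible) {W : Submodule ℂ π.H}
    (hW : RepInvariant π.rep W) (hW0 : W ≠ ⊥) : Dense (W : Set π.H) := by
  rw [Submodule.dense_iff_topologicalClosure_eq_top]
  refine (hπ.2 _ W.isClosed_topologicalClosure (π.closure_invariant hW)).resolve_left fun h0 => ?_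
  exact hW0 (eq_bot_iff.2 (h0 ▸ W.le_topologicalClosure))

theorem IsIrreducible.smoothVectors_nontrivial {π : UnitaryRep.{u} G} (hπ : π.IsIrreducible)
    {K : ℤ → Subgroup G} (hK : CompactOpenFiltration K) : Nontrivial π.smoothVectors := by
  have := hπ.1
  obtain ⟨x, hx⟩ := exists_ne (0 : π.H)
  obtain ⟨r, y, -, hy, hyx⟩ := π.exists_fixed_approx hK (W := ⊤) isClosed_univ
    (fun _ _ _ => Submodule.mem_top) (x := x) Submodule.mem_top (half_pos (norm_pos_iff.2 hx))
  refine Submodule.nontrivial_iff_ne_bot.2 ((Submodule.ne_bot_iff _).2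
    ⟨y, ⟨K r, hK.isOpen r, hy⟩, ?_⟩)
  rintro rfl
  rw [zero_sub, norm_neg] at hyx
  linarith [norm_pos_iff.2 hx]

/-- The smooth vectors of an irreducible unitary representation form a prime representation. -/
theorem IsIrreducible.isPrimeRep_smoothRep {π : UnitaryRep.{u} G} (hπ : π.IsIrreducible)
    {K : ℤ → Subgroup G} (hK : CompactOpenFiltration K) : IsPrimeRep π.smoothRep := by
  refine ⟨hπ.smoothVectors_nontrivial hK, fun T hT W hW hW0 L hL hLc hTW v hv => ?_⟩
  have hdense := hπ.dense (map_subtype_invariant π.smoothVectors_invariant hW) fun h0 =>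
      hW0 (map_subtype_eq_bot h0)
  obtain ⟨C, hC⟩ := exists_bound_of_mem_span (ρ := π.smoothRep) (fun x => ‖x‖) norm_add_le
    norm_smul (fun g x => π.norm_rep g x) hT
  by_contra hTv
  have hpos : 0 < ‖T v‖ := norm_pos_iff.2 hTv
  have hC0 : 0 < |C| + 1 := by positivity
  obtain ⟨_, hwv, w, hw, rfl⟩ := Metric.dense_iff.1 hdense (v : π.H) (‖T v‖ / (|C| + 1))
    (div_pos hpos hC0)
  obtain ⟨L', hL', -, hwL'⟩ := π.isSmoothRep_smoothRep hK w
  obtain ⟨m, k, hm, hk, hsum⟩ := exists_coset_sum π.smoothRep hLc hL'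
  -- An `L`-fixed vector of `W` no farther from `v` than `w`. As `T` kills it, `‖T v‖` is bounded by
  -- a multiple of `‖v - w‖`, which was chosen too small for that.
  let w' : π.smoothVectors := (m : ℂ)⁻¹ • ∑ i, π.smoothRep (k i) w
  have hw'L : w' ∈ fixedSubmodule π.smoothRep L := Submodule.smul_mem _ _ (hsum w hwL')
  have hw'W : w' ∈ W := Submodule.smul_mem _ _ (Submodule.sum_mem _ fun i _ => hW _ _ hw)
  have h1 : ‖v - w'‖ ≤ ‖(v : π.H) - w‖ := by
    have h2 := π.norm_sub_average_le (x := (v : π.H)) (K := L)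
      (fun g hg => congrArg Subtype.val (hv g hg)) (w : π.H) hm hk
    have h3 : ((v - w' : π.smoothVectors) : π.H) = v - (m : ℂ)⁻¹ • ∑ i, π.rep (k i) w := by
      simp only [w', Submodule.coe_sub, Submodule.coe_smul, Submodule.coe_sum]
      rfl
    rw [← h3] at h2
    exact h2
  have h4 : T v = T (v - w') := by rw [map_sub, hTW w' hw'W hw'L, sub_zero]
  have h5 : ‖(v : π.H) - w‖ < ‖T v‖ / (|C| + 1) := by
    rw [← dist_eq_norm, dist_comm]
    exact hwv
  have h6 : ‖T v‖ ≤ (|C| + 1) * ‖(v : π.H) - w‖ := by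
    conv_lhs => rw [h4]
    refine (hC _).trans (mul_le_mul ?_ h1 (norm_nonneg _) hC0.le)
    linarith [le_abs_self C]
  rw [lt_div_iff₀ hC0] at h5
  linarith

/-- An irreducible unitary representation has an irreducible smooth dense model, if its space of
smooth vectors has an irreducible subrepresentation. -/
theorem IsIrreducible.exists_isDenseModel {π : UnitaryRep.{u} G} (hπ : π.IsIrreducible)
    {K : ℤ → Subgroup G} (hK : CompactOpenFiltration K) (h : HasAdmissibleIrr π.smoothRep) :
    ∃ (σ : IrrSmoothRep.{u} G) (j : σ.V →ₗ[ℂ] π.H), IsDenseModel σ.ρ π j := by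
  obtain ⟨W, hW, hW0, hmin, -⟩ := h
  have hs := π.isSmoothRep_smoothRep hK
  refine ⟨⟨W, subRep hW, fun w => ?_, subRep_irreducible hW hW0 hmin⟩,
    π.smoothVectors.subtype ∘ₗ W.subtype, ?_, ?_, fun g x => rfl⟩
  · obtain ⟨L, hL, hLc, hw⟩ := hs w
    exact ⟨L, hL, hLc, fun g hg => Subtype.ext (hw g hg)⟩
  · exact (Submodule.injective_subtype _).comp (Submodule.injective_subtype _)
  · have hdense := hπ.dense (map_subtype_invariant π.smoothVectors_invariant hW) fun h0 =>
      hW0 (map_subtype_eq_bot h0)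
    refine hdense.mono ?_
    rintro _ ⟨w, hw, rfl⟩
    exact ⟨⟨w, hw⟩, rfl⟩

end UnitaryRep

end Models

/-! ### The bijection of the smooth dual onto the unitary dual -/

section Dual

variable {G : Type v} [Group G] [TopologicalSpace G] [IsTopologicalGroup G]

/-- Completion induces a bijection of the smooth dual onto the unitary dual, for a union of compact
open subgroups all of whose smooth prime representations have irreducible admissible
subrepresentations. -/
theorem exists_bijective_completion {K : ℤ → Subgroup G} (hK : CompactOpenFiltration K)
    (hadm : ∀ {V : Type u} [AddCommGroup V] [Module ℂ V] {ρ : Representation ℂ G V},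
      IsSmoothRep ρ → IsPrimeRep ρ → HasAdmissibleIrr ρ) :
    ∃ Φ : SmoothDual.{u} G → UnitaryDual.{u} G,
      (∀ (σ : IrrSmoothRep.{u} G) (c : InvariantForm σ.ρ),
        ∃ h : (c.completion σ.smooth).IsIrreducible,
          Φ (Quotient.mk _ σ) = Quotient.mk _ ⟨c.completion σ.smooth, h⟩) ∧
      Function.Bijective Φ := by
  have hfin : ∀ (σ : IrrSmoothRep.{u} G) (L : Subgroup G), IsOpen (L : Set G) →
      FiniteDimensional ℂ (fixedSubmodule σ.ρ L) := fun σ L hL =>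
    (hadm σ.smooth (irreducible_isPrimeRep σ.irreducible)).finiteDimensional σ.irreducible hL
  have hirr : ∀ (σ : IrrSmoothRep.{u} G) (c : InvariantForm σ.ρ),
      (c.completion σ.smooth).IsIrreducible := fun σ c =>
    (c.isDenseModel σ.smooth).isIrreducible σ.smooth σ.irreducible hK (hfin σ)
  have hform : ∀ σ : IrrSmoothRep.{u} G, Nonempty (InvariantForm σ.ρ) := fun σ =>
    exists_invariantForm hK σ.smooth σ.irreducible
  let form : ∀ σ : IrrSmoothRep.{u} G, InvariantForm σ.ρ := fun σ => (hform σ).some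
  let Ψ : IrrSmoothRep.{u} G → {π : UnitaryRep.{u} G // π.IsIrreducible} := fun σ =>
    ⟨(form σ).completion σ.smooth, hirr σ (form σ)⟩
  have hΨ : ∀ (σ : IrrSmoothRep.{u} G), ∃ j : σ.V →ₗ[ℂ] (Ψ σ).1.H, IsDenseModel σ.ρ (Ψ σ).1 j :=
    fun σ => ⟨_, (form σ).isDenseModel σ.smooth⟩
  have huniq : ∀ (σ : IrrSmoothRep.{u} G) (π π' : {π : UnitaryRep.{u} G // π.IsIrreducible})
      (j : σ.V →ₗ[ℂ] π.1.H) (j' : σ.V →ₗ[ℂ] π'.1.H), IsDenseModel σ.ρ π.1 j →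
      IsDenseModel σ.ρ π'.1 j' → UnitaryRep.setoid.r π π' := fun σ π π' j j' h h' =>
    h.exists_unitaryEquiv h' σ.smooth σ.irreducible (hfin σ)
  refine ⟨Quotient.lift (fun σ => (Quotient.mk _ (Ψ σ) : UnitaryDual.{u} G)) ?_,
    fun σ c => ⟨hirr σ c, ?_⟩, ?_, ?_⟩
  · rintro σ τ ⟨T, hT⟩
    obtain ⟨j, hj⟩ := hΨ σ
    obtain ⟨i, hi⟩ := hΨ τ
    exact Quotient.sound (huniq σ _ _ _ _ hj (hi.comp_equiv T hT))
  · obtain ⟨j, hj⟩ := hΨ σ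
    exact Quotient.sound (huniq σ _ ⟨_, hirr σ c⟩ _ _ hj (c.isDenseModel σ.smooth))
  · intro a b
    induction a using Quotient.inductionOn with | _ σ
    induction b using Quotient.inductionOn with | _ τ
    intro hab
    obtain ⟨U, hU⟩ := Quotient.exact hab
    obtain ⟨j, hj⟩ := hΨ σ
    obtain ⟨i, hi⟩ := hΨ τ
    have h1 := hj.map U hU
    refine Quotient.sound (h1.exists_linearEquiv hi ?_)
    -- Both models are the full space of smooth vectors of the same unitary representation, so they
    -- coincide.
    rw [h1.range_eq σ.smooth hK (hfin σ), hi.range_eq τ.smooth hK (hfin τ)]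
  · intro b
    induction b using Quotient.inductionOn with | _ π
    have hπ := π.2
    obtain ⟨σ, j, hj⟩ := hπ.exists_isDenseModel hK
      (hadm (π.1.isSmoothRep_smoothRep hK) (hπ.isPrimeRep_smoothRep hK))
    obtain ⟨i, hi⟩ := hΨ σ
    -- Here `σ` is a dense model both of `π` and of its own completion, and such unitary
    -- representations are equivalent.
    exact ⟨Quotient.mk _ σ, Quotient.sound (huniq σ _ _ _ _ hi hj)⟩

end Dual

end

theorem mainTheorem4 (p : ℕ) [Fact p.Prime] (A : Type v) [CommRing A] [HopfAlgebra ℚ A]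
    (hA : IsUnipotentGroup ℚ A) :
    (∀ σ : IrrSmoothRep.{u} (QpPoints p A), Nonempty (InvariantForm σ.ρ)) ∧
    ∃ Φ : SmoothDual.{u} (QpPoints p A) → UnitaryDual.{u} (QpPoints p A),
      (∀ (σ : IrrSmoothRep.{u} (QpPoints p A)) (c : InvariantForm σ.ρ),
        ∃ h : (c.completion σ.smooth).IsIrreducible,
          Φ (Quotient.mk _ σ) = Quotient.mk _ ⟨c.completion σ.smooth, h⟩) ∧
      Function.Bijective Φ := by
  obtain ⟨n, M, hdiag, hlower, hcomul, hcounit, hadjoin⟩ := hA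
  have hM : IsUnitriangularEmbedding M := ⟨hdiag, hlower, hcomul, hcounit, hadjoin⟩
  have hK := hM.compactOpenFiltration (p := p)
  exact ⟨fun σ => exists_invariantForm hK σ.smooth σ.irreducible,
    exists_bijective_completion hK fun hs hρ =>
      CentralCoords.hasAdmissibleIrr _ (hM.centralCoords (p := p)) rfl hs hρ⟩
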